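/- Let $M$ be a closed smooth Riemannian manifold with distance $\mathrm{dist}_M$, isometrically embedded in some $\mathbf R^N$ and with injectivity radius at least $8\pi$. Let $\mathbf S^1=\mathbf R/2\pi\mathbf Z$. For a $W^{1,2}$ map $f:\mathbf S^1\to M\subset\mathbf R^N$ let $\mathrm{Energy}(f)=\int_{\mathbf S^1}|f'|^2$; the square of the $W^{1,2}$ norm is $\int_{\mathbf S^1}(|f|^2+|f'|^2)$. Let $\Omega$ be the set of continuous maps $\sigma:\mathbf S^1\times[-1,1]\to M$ such that each slice $\sigma(\cdot,t)$ is in $W^{1,2}$, the map $t\mapsto\sigma(\cdot,t)$ is continuous from $[-1,1]$ to $W^{1,2}$, and $\sigma(\cdot,-1)$ and $\sigma(\cdot,1)$ are constant. Two elements $\sigma,\tau$ of $\Omega$ are homotopic in $\Omega$ if there is a continuous map $F:\mathbf S^1\times[-1,1]\times[0,1]\to M$ with $F(\cdot,\cdot,0)=\sigma$, $F(\cdot,\cdot,1)=\tau$ and $F(\cdot,\cdot,s)\in\Omega$ for every $s$. For $\hat\sigma\in\Omega$ let $\Omega_{\hat\sigma}$ be the set of elements of $\Omega$ that are homotopic to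 $\hat\sigma$ in $\Omega$. Fix an integer $L\ge1$, a number $x_0\in\mathbf R$, and put $x_j=x_0+j\pi/L$ for $j\ge 0$, so that $x_{2L}=x_0$ on $\mathbf S^1$. Let $\gamma\in\Omega$ satisfy $$\mathrm{Energy}(\gamma(\cdot,t))\le L\qquad\text{for all } t\in[-1,1].$$ Then the following curves exist and are unique for every $t$: * $\gamma_e(\cdot,t)$, the curve that for each $0\le j<L$ is on $[x_{2j},x_{2j+2}]$ a shortest constant speed geodesic from $\gamma(x_{2j},t)$ to $\gamma(x_{2j+2},t)$; * $\tilde\gamma_e(\cdot,t)$, the constant speed reparametrization of $\gamma_e(\cdot,t)$ that fixes the image of $x_0$; that is, the curve in $W^{1,2}$ whose speed is almost everywhere equal to a constant and for which $\gamma_e(\cdot,t)=\tilde\gamma_e(\cdot,t)\circ P$ for some continuous monotone $P:\mathbf R\to\mathbf R$ with $P(x_0)=x_0$ and $P(x+2\pi)=P(x)+2\pi$; * $\gamma_o(\cdot,t)$, the curve that for each $0\le j<L$ is on $[x_{2j+1},x_{2j+3}]$ a shortest constant speed geodesic from $\gamma_e(x_{2j+1},t)$ to $\gamma_e(x_{2j+3},t)$;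 * $\Psi(\gamma)(\cdot,t)$, the constant speed reparametrization of $\gamma_o(\cdot,t)$ that fixes the image of $x_0$, in the same sense. The maps $\gamma_e$, $\tilde\gamma_e$, $\gamma_o$, $\Psi(\gamma)$ are continuous on $\mathbf S^1\times[-1,1]$, and $\gamma$, $\gamma_e$ and $\tilde\gamma_e$ are all homotopic in $\Omega$. Consequently, if $\hat\sigma\in\Omega$ and $\gamma\in\Omega_{\hat\sigma}$, then $\gamma_e$, $\tilde\gamma_e$ and $\Psi(\gamma)$ belong to $\Omega_{\hat\sigma}$. -/

import Mathlib

open Set Filter Topology MeasureTheory Bundle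
open scoped Manifold ContDiff ENNReal

noncomputable section

namespace CurveSweepout

/-- The circle of length `2π`. -/
abbrev Circ : Type := AddCircle (2 * Real.pi)

/-- The parameter interval `[-1, 1]` of a sweepout. -/
abbrev Param : Type := Icc (-1 : ℝ) 1

/-- The ambient Euclidean space. -/
abbrev Euc (N : ℕ) : Type := EuclideanSpace ℝ (Fin N)

/-- The `2π`-periodic map on the line that corresponds to a map on the circle. -/
def lift {X : Type*} (f : Circ → X) : ℝ → X := fun x => f (x : Circ)

section Sobolev

variable {N : ℕ}

/-- Maps of class `W^{1,2}` from the circle to Euclidean space, given by their continuous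
representatives: absolutely continuous maps whose derivative (which exists almost everywhere and is
the weak derivative) is square integrable. -/
def IsW12 (f : Circ → Euc N) : Prop :=
  AbsolutelyContinuousOnInterval (lift f) 0 (2 * Real.pi) ∧
    MemLp (deriv (lift f)) 2 (volume.restrict (Ioc 0 (2 * Real.pi)))

/-- The energy `∫ |f'|²`. -/
def energy (f : Circ → Euc N) : ℝ :=
  ∫ x in (0 : ℝ)..(2 * Real.pi), ‖deriv (lift f) x‖ ^ 2

/-- The `W^{1,2}` distance `(∫ |f - g|² + |f' - g'|²)^{1/2}` of two maps of class `W^{1,2}`. -/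
def w12Dist (f g : Circ → Euc N) : ℝ :=
  Real.sqrt (∫ x in (0 : ℝ)..(2 * Real.pi),
    (‖lift f x - lift g x‖ ^ 2 + ‖deriv (lift f) x - deriv (lift g) x‖ ^ 2))

end Sobolev

section Riemannian

variable {n N : ℕ} {M : Type*} [EMetricSpace M]
  [ChartedSpace (EuclideanSpace ℝ (Fin n)) M]

/-- The differential of a map `ι : M → ℝ^N`. -/
def differential (ι : M → Euc N) (p : M) : TangentSpace (𝓡 n) p →L[ℝ] Euc N :=
  mfderiv (𝓡 n) 𝓘(ℝ, Euc N) ι p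

variable (n) in
/-- Geodesics (with affine parameter, hence of constant speed) of an isometrically embedded
manifold: smooth curves whose acceleration in the ambient Euclidean space is normal to the
manifold. -/
def IsGeodesic (ι : M → Euc N) (c : ℝ → M) : Prop :=
  ContMDiff 𝓘(ℝ, ℝ) (𝓡 n) ∞ c ∧
    ∀ (s : ℝ) (v : TangentSpace (𝓡 n) (c s)),
      inner ℝ (deriv (deriv (ι ∘ c)) s) (differential ι (c s) v) = 0

open scoped Classical in
/-- The exponential map at `p`: the vector `v` goes to `c 1`, where `c` is the geodesic with
`c 0 = p` and initial velocity `v`. -/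
def expMap (ι : M → Euc N) (p : M) (v : TangentSpace (𝓡 n) p) : M :=
  if h : ∃ c : ℝ → M, IsGeodesic n ι c ∧ c 0 = p ∧ deriv (ι ∘ c) 0 = differential ι p v
  then h.choose 1 else p

variable (n) [RiemannianBundle (fun x : M => TangentSpace (𝓡 n) x)]

/-- Smooth isometric embeddings of a Riemannian manifold into Euclidean space. -/
structure IsIsometricEmbedding (ι : M → Euc N) : Prop where
  contMDiff : ContMDiff (𝓡 n) 𝓘(ℝ, Euc N) ∞ ι
  isEmbedding : IsEmbedding ι
  norm_differential : ∀ (p : M) (v : TangentSpace (𝓡 n) p), ‖differential ι p v‖ = ‖v‖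

/-- The exponential map at `p` restricts to a diffeomorphism from the ball of radius `r` in the
tangent space onto the metric ball of radius `r` in the manifold. -/
def IsNormalRadius (ι : M → Euc N) (p : M) (r : ℝ≥0∞) : Prop :=
  ∃ Φ : PartialDiffeomorph 𝓘(ℝ, TangentSpace (𝓡 n) p) (𝓡 n) (TangentSpace (𝓡 n) p) M ∞,
    Φ.source = Metric.eball 0 r ∧ Φ.target = Metric.eball p r ∧ EqOn Φ (expMap ι p) Φ.source

/-- The injectivity radius of `M`: the infimum over the points `p` of the supremum of the `r` such
that the exponential map at `p` is a diffeomorphism from the tangent ball of any radius at most `r`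
onto the metric ball of the same radius. -/
def injectivityRadius (ι : M → Euc N) : ℝ≥0∞ :=
  ⨅ p : M, sSup {r | ∀ r' ≤ r, IsNormalRadius n ι p r'}

/-- On `[a, b]` the curve `β` is a shortest (constant speed) geodesic between its endpoints. -/
def IsShortestGeodesicOn (ι : M → Euc N) (β : ℝ → M) (a b : ℝ) : Prop :=
  ∃ c : ℝ → M, IsGeodesic n ι c ∧ EqOn β c (Icc a b) ∧
    Manifold.pathELength (𝓡 n) c a b = edist (c a) (c b)

/-- The partition point `x_j = x₀ + jπ/L`; the points `x_0, …, x_{2L-1}` are evenly spaced on the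
circle, and `x_{2L} = x_0` there. -/
def node (L : ℕ) (x₀ : ℝ) (j : ℕ) : ℝ := x₀ + j * (Real.pi / L)

/-- `β` is obtained from `α` by geodesic replacement on the intervals `[x_{2j}, x_{2j+2}]`: on each
of them it is a shortest constant speed geodesic with the same endpoints as `α`. -/
def IsGeodesicReplacement (ι : M → Euc N) (L : ℕ) (x₀ : ℝ) (α β : Circ → M) : Prop :=
  ∀ j < L,
    lift β (node L x₀ (2 * j)) = lift α (node L x₀ (2 * j)) ∧
    lift β (node L x₀ (2 * j + 2)) = lift α (node L x₀ (2 * j + 2)) ∧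
    IsShortestGeodesicOn n ι (lift β) (node L x₀ (2 * j)) (node L x₀ (2 * j + 2))

end Riemannian

section Sweepouts

variable {N : ℕ} {M : Type*}

/-- `β` is the constant speed reparametrization of `α` that fixes the image of `x₀`: the speed of
`β` is almost everywhere equal to a constant, and `α = β ∘ P` for a monotone continuous map `P` of
the circle of degree one (lifted to the line) that fixes `x₀`. -/
def IsConstantSpeedReparam (ι : M → Euc N) (x₀ : ℝ) (α β : Circ → M) : Prop :=
  (IsW12 (ι ∘ β) ∧ ∃ S : ℝ, ∀ᵐ x : ℝ, ‖deriv (lift (ι ∘ β)) x‖ = S) ∧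
    ∃ P : ℝ → ℝ, Monotone P ∧ Continuous P ∧ P x₀ = x₀ ∧
      (∀ x, P (x + 2 * Real.pi) = P x + 2 * Real.pi) ∧ ∀ x, lift α x = lift β (P x)

variable [TopologicalSpace M]

/-- The slice `σ(·, t)`. -/
def slice (σ : C(Circ × Param, M)) (t : Param) : Circ → M := fun x => σ (x, t)

/-- The set `Ω` of sweepouts: continuous maps `S¹ × [-1, 1] → M` with slices in `W^{1,2}` that
depend continuously on `t` in `W^{1,2}`, and with constant first and last slice. -/
structure IsSweepout (ι : M → Euc N) (σ : C(Circ × Param, M)) : Prop where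
  isW12 : ∀ t, IsW12 (ι ∘ slice σ t)
  continuous_slice : ∀ t, Tendsto (fun s => w12Dist (ι ∘ slice σ s) (ι ∘ slice σ t)) (𝓝 t) (𝓝 0)
  start : ∃ p : M, ∀ x, slice σ ⟨-1, by norm_num⟩ x = p
  finish : ∃ p : M, ∀ x, slice σ ⟨1, by norm_num⟩ x = p

/-- Two maps are homotopic in `Ω` if they are homotopic through maps in `Ω`. -/
def HomotopicInΩ (ι : M → Euc N) (σ τ : C(Circ × Param, M)) : Prop :=
  ContinuousMap.HomotopicWith σ τ (IsSweepout ι)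

/-- The homotopy class `Ω_σ`: the sweepouts that are homotopic to `σ` in `Ω`. -/
def homotopyClass (ι : M → Euc N) (σ : C(Circ × Param, M)) : Set C(Circ × Param, M) :=
  {τ | IsSweepout ι τ ∧ HomotopicInΩ ι τ σ}

end Sweepouts

end CurveSweepout

end

open CurveSweepout

namespace CurveSweepout

/-! The replacements are well defined because shortest geodesics between points at distance less
than 8 are unique and depend continuously on their endpoints. By Cauchy-Schwarz, a curve of energy
at most `L` has length at most √(2π) < 8 over an interval of length 2π/L (`edist_lift_lt`), so all
geodesics that occur stay well inside the injectivity radius.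

Uniqueness. The exponential map sends each tangent ball of radius r ≤ 8 onto the metric ball of the
same radius, so in normal coordinates the distance to the centre is the norm
(`exists_isNormalBall`). The only part of the Gauss lemma that is needed follows from the triangle
inequality: the norm grows at most at unit rate along unit speed curves. A curve for which equality
holds is an integral curve of the gradient of the distance, so ODE uniqueness shows that a point
between `p` and `q` lies on every shortest geodesic joining them (`HasNormalRadius.eq_of_edist_le`).
Compactness of the manifold turns this into continuity (`HasNormalRadius.continuousOn_geo`).

Topology of sweepouts. Uniform convergence together with convergence of energies implies convergence
in W^{1,2} (`tendsto_w12Dist`), by lower semicontinuity of the energy and the parallelogram law. A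
jointly continuous family of curves is therefore a sweepout as soon as its energy is continuous in
`t`, and a homotopy needs this only for each fixed `s` (`exists_homotopicInΩ`).

Homotopies. For geodesic replacement, at time `s` each interval carries the shortest geodesic across
its initial fraction `s`, followed by the old curve. The energy is explicit, continuous in `t`, and
at most that of the old curve; this gives a uniform Hölder bound, hence joint continuity, and allows
a second replacement. For reparametrization, the curve is written as a function of arc length and
the parameter is interpolated linearly between the arc length and a linear function. The speed is
then almost everywhere the same interpolation between the old speed and its mean, so the energy is a
polynomial in continuous quantities. -/

/-- A transitive relation that holds within every cell of a grid holds for all `x ≤ y`. -/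
theorem rel_of_grid {P : ℝ → ℝ → Prop} {c h : ℝ} (hh : 0 < h)
    (trans : ∀ x y z, x ≤ y → y ≤ z → P x y → P y z → P x z)
    (cell : ∀ k : ℤ, ∀ x y, c + k * h ≤ x → x ≤ y → y ≤ c + (k + 1) * h → P x y)
    (x y : ℝ) (hxy : x ≤ y) : P x y := by
  have key : ∀ m : ℕ, ∀ k : ℤ, ∀ x y, c + k * h ≤ x → x ≤ c + (k + 1) * h → x ≤ y →
      y ≤ c + (k + 1 + m) * h → P x y := by
    intro m
    induction m with
    | zero => intro k x y h1 _ h3 h4; exact cell k x y h1 h3 (by simpa using h4)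
    | succ m ih =>
      intro k x y h1 h2 h3 h4
      by_cases hy : y ≤ c + (k + 1) * h
      · exact cell k x y h1 h3 hy
      · push Not at hy
        refine trans x (c + (k + 1) * h) y h2 hy.le (cell k _ _ h1 h2 le_rfl) ?_
        refine ih (k + 1) _ _ (by push_cast; exact le_rfl) ?_ hy.le ?_
        · push_cast; nlinarith
        · push_cast at h4 ⊢; nlinarith
  set k := ⌊(x - c) / h⌋ with hk
  have h1 : (k : ℝ) * h ≤ x - c := by
    have := Int.floor_le ((x - c) / h); rwa [le_div_iff₀ hh] at this
  have h2 : x - c ≤ (k + 1) * h := by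
    have := (Int.lt_floor_add_one ((x - c) / h)).le; rwa [div_le_iff₀ hh] at this
  obtain ⟨m, hm⟩ := exists_nat_ge ((y - x) / h)
  rw [div_le_iff₀ hh] at hm
  exact key m k x y (by linarith) (by linarith) hxy (by nlinarith)

/-! ### Curves with an integrable speed bound -/

/-- `f` moves over `[x, y]` by at most the integral of `v` over `[x, y]`. -/
structure SpeedBound {F : Type*} [NormedAddCommGroup F] (f : ℝ → F) (v : ℝ → ℝ) : Prop where
  intervalIntegrable : ∀ a b, IntervalIntegrable v volume a b
  norm_sub_le : ∀ x y, x ≤ y → ‖f y - f x‖ ≤ ∫ z in x..y, v z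

theorem _root_.AbsolutelyContinuousOnInterval.of_dist_le {X Y : Type*} [PseudoMetricSpace X]
    [PseudoMetricSpace Y] {f : ℝ → X} {g : ℝ → Y} {a b C : ℝ}
    (hf : AbsolutelyContinuousOnInterval f a b)
    (h : ∀ x ∈ uIcc a b, ∀ y ∈ uIcc a b, dist (g x) (g y) ≤ C * dist (f x) (f y)) :
    AbsolutelyContinuousOnInterval g a b := by
  have hf' := Tendsto.const_mul C hf
  rw [mul_zero] at hf'
  refine squeeze_zero' (Eventually.of_forall fun _ => Finset.sum_nonneg fun _ _ => dist_nonneg)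
    ?_ hf'
  have : ∀ᶠ E in AbsolutelyContinuousOnInterval.totalLengthFilter ⊓
      𝓟 (AbsolutelyContinuousOnInterval.disjWithin a b),
      E ∈ AbsolutelyContinuousOnInterval.disjWithin a b :=
    mem_inf_of_right (mem_principal_self _)
  filter_upwards [this] with E hE
  rw [Finset.mul_sum]
  exact Finset.sum_le_sum fun i hi => h _ (hE.1 i hi).1 _ (hE.1 i hi).2

section Euclidean

variable {N : ℕ}

theorem _root_.AbsolutelyContinuousOnInterval.ae_differentiableAt_euclidean {f : ℝ → Euc N}
    {a b : ℝ} (hf : AbsolutelyContinuousOnInterval f a b) :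
    ∀ᵐ x, x ∈ uIcc a b → DifferentiableAt ℝ f x :=
  hf.boundedVariationOn.ae_differentiableAt_of_mem_uIcc

/-- Pairing with the fixed vector `f b - f a` reduces the vector-valued estimate to the fundamental
theorem of calculus for a real absolutely continuous function. -/
theorem _root_.AbsolutelyContinuousOnInterval.norm_sub_le_integral {f : ℝ → Euc N} {a b : ℝ}
    (hf : AbsolutelyContinuousOnInterval f a b) (hab : a ≤ b)
    (hi : IntervalIntegrable (fun x => ‖deriv f x‖) volume a b) :
    ‖f b - f a‖ ≤ ∫ x in a..b, ‖deriv f x‖ := by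
  set w := f b - f a with hw
  let g : ℝ → ℝ := fun x => inner ℝ w (f x)
  have hg : AbsolutelyContinuousOnInterval g a b := by
    refine hf.of_dist_le (C := ‖w‖) fun x _ y _ => ?_
    rw [Real.dist_eq, dist_eq_norm, ← inner_sub_right]
    exact abs_real_inner_le_norm _ _
  have h1 : ∫ x in a..b, deriv g x = ‖w‖ ^ 2 := by
    rw [hg.integral_deriv_eq_sub, ← inner_sub_right, real_inner_self_eq_norm_sq]
  have h2 : ∫ x in a..b, deriv g x ≤ ∫ x in a..b, ‖w‖ * ‖deriv f x‖ := by
    refine intervalIntegral.integral_mono_ae_restrict hab hg.intervalIntegrable_deriv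
      (hi.const_mul _) ?_
    rw [EventuallyLE, ae_restrict_iff' measurableSet_Icc]
    filter_upwards [hf.ae_differentiableAt_euclidean] with x hx hx'
    have hd := (hx (by rwa [uIcc_of_le hab])).hasDerivAt
    have : HasDerivAt g (inner ℝ w (deriv f x)) x := by
      simpa [g] using (hasDerivAt_const x w).inner ℝ hd
    rw [this.deriv]
    exact real_inner_le_norm _ _
  rw [h1, intervalIntegral.integral_const_mul, sq] at h2
  rcases (norm_nonneg w).eq_or_lt with h0 | h0
  · rw [← h0]
    exact intervalIntegral.integral_nonneg hab fun _ _ => norm_nonneg _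
  · exact le_of_mul_le_mul_left h2 h0

theorem SpeedBound.continuous {f : ℝ → Euc N} {v : ℝ → ℝ} (h : SpeedBound f v) :
    Continuous f := by
  have hc : Continuous fun x => ∫ z in (0 : ℝ)..x, v z :=
    intervalIntegral.continuous_primitive h.intervalIntegrable 0
  rw [continuous_iff_continuousAt]
  intro x
  rw [ContinuousAt, tendsto_iff_norm_sub_tendsto_zero]
  have hx : Tendsto (fun y => |(∫ z in (0 : ℝ)..y, v z) - ∫ z in (0 : ℝ)..x, v z|) (𝓝 x) (𝓝 0) := by
    have := ((hc.sub continuous_const).abs).tendsto x (f := fun y =>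
      |(∫ z in (0 : ℝ)..y, v z) - ∫ z in (0 : ℝ)..x, v z|)
    simpa using this
  refine squeeze_zero (fun _ => norm_nonneg _) (fun y => ?_) hx
  rw [intervalIntegral.integral_interval_sub_left (h.intervalIntegrable _ _)
    (h.intervalIntegrable _ _)]
  rcases le_total x y with hxy | hxy
  · exact (h.norm_sub_le x y hxy).trans (le_abs_self _)
  · rw [norm_sub_rev, intervalIntegral.integral_symm, abs_neg]
    exact (h.norm_sub_le y x hxy).trans (le_abs_self _)

theorem SpeedBound.absolutelyContinuousOnInterval {f : ℝ → Euc N} {v : ℝ → ℝ}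
    (h : SpeedBound f v) (a b : ℝ) : AbsolutelyContinuousOnInterval f a b := by
  refine ((h.intervalIntegrable a b).absolutelyContinuousOnInterval_intervalIntegral
    (c := a) left_mem_uIcc).of_dist_le (C := 1) fun x _ y _ => ?_
  rw [one_mul, dist_eq_norm, Real.dist_eq,
    intervalIntegral.integral_interval_sub_left (h.intervalIntegrable _ _)
    (h.intervalIntegrable _ _)]
  rcases le_total x y with hxy | hxy
  · rw [norm_sub_rev, intervalIntegral.integral_symm, abs_neg]
    exact (h.norm_sub_le x y hxy).trans (le_abs_self _)
  · exact (h.norm_sub_le y x hxy).trans (le_abs_self _)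

theorem ae_of_forall_uIcc {p : ℝ → Prop} (h : ∀ a b : ℝ, ∀ᵐ x : ℝ, x ∈ uIcc a b → p x) :
    ∀ᵐ x : ℝ, p x := by
  have : ∀ᵐ x : ℝ, ∀ m : ℕ, x ∈ uIcc (-(m : ℝ)) m → p x :=
    ae_all_iff.2 fun m => h _ _
  filter_upwards [this] with x hx
  obtain ⟨m, hm⟩ := exists_nat_ge |x|
  refine hx m ?_
  rw [uIcc_of_le (by linarith [abs_nonneg x])]
  exact abs_le.1 hm

theorem SpeedBound.ae_differentiableAt {f : ℝ → Euc N} {v : ℝ → ℝ} (h : SpeedBound f v) :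
    ∀ᵐ x, DifferentiableAt ℝ f x :=
  ae_of_forall_uIcc fun a b => (h.absolutelyContinuousOnInterval a b).ae_differentiableAt_euclidean

theorem locallyIntegrable_of_intervalIntegrable {v : ℝ → ℝ}
    (h : ∀ a b, IntervalIntegrable v volume a b) : LocallyIntegrable v volume := by
  intro x
  refine ⟨Ioc (x - 1) (x + 1), mem_of_superset (Ioo_mem_nhds (by linarith) (by linarith))
    Ioo_subset_Ioc_self, ?_⟩
  exact (intervalIntegrable_iff_integrableOn_Ioc_of_le (by linarith)).1 (h _ _)

/-- Difference quotients of `f` are bounded by those of a primitive of `v`, which converge to `v`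
almost everywhere by Lebesgue differentiation. -/
theorem SpeedBound.norm_deriv_le {f : ℝ → Euc N} {v : ℝ → ℝ} (h : SpeedBound f v) :
    ∀ᵐ x, ‖deriv f x‖ ≤ v x := by
  filter_upwards [h.ae_differentiableAt,
    _root_.LocallyIntegrable.ae_hasDerivAt_integral
      (locallyIntegrable_of_intervalIntegrable h.intervalIntegrable)]
    with x hx hv
  have h1 := (hx.hasDerivAt.tendsto_slope.mono_left (nhdsGT_le_nhdsNE x)).norm
  have h2 := (hv x).tendsto_slope.mono_left (nhdsGT_le_nhdsNE x)
  refine le_of_tendsto_of_tendsto h1 h2 ?_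
  filter_upwards [self_mem_nhdsWithin] with y hy
  have hy' : x < y := hy
  rw [slope_def_module, slope_def_field, norm_smul, intervalIntegral.integral_same, sub_zero,
    norm_inv, Real.norm_of_nonneg (by linarith : 0 ≤ y - x), div_eq_inv_mul]
  exact mul_le_mul_of_nonneg_left (h.norm_sub_le x y hy'.le) (by
    have : 0 < y - x := by linarith
    positivity)

/-- The actual speed is the best bound: any crude integrable bound, once available, can be traded
for it. -/
theorem SpeedBound.norm_deriv {f : ℝ → Euc N} {v : ℝ → ℝ} (h : SpeedBound f v) :
    SpeedBound f fun x => ‖deriv f x‖ := by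
  have hi : ∀ a b, IntervalIntegrable (fun x => ‖deriv f x‖) volume a b := fun a b => by
    refine (h.intervalIntegrable a b).mono_fun
      (measurable_deriv f).norm.aestronglyMeasurable ?_
    refine ae_restrict_of_ae ?_
    filter_upwards [h.norm_deriv_le] with x hx
    rw [norm_norm]
    exact hx.trans (le_abs_self _)
  exact ⟨hi, fun x y hxy =>
    (h.absolutelyContinuousOnInterval x y).norm_sub_le_integral hxy (hi x y)⟩

end Euclidean

/-! ### Variation as the integral of the speed -/

section Variation

variable {N : ℕ}

theorem SpeedBound.integral_nonneg {f : ℝ → Euc N} {v : ℝ → ℝ} (h : SpeedBound f v) {a b : ℝ}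
    (hab : a ≤ b) : 0 ≤ ∫ x in a..b, v x :=
  (norm_nonneg _).trans (h.norm_sub_le a b hab)

theorem SpeedBound.eVariationOn_le {f : ℝ → Euc N} {v : ℝ → ℝ} (h : SpeedBound f v) {a b : ℝ}
    (hab : a ≤ b) : eVariationOn f (Icc a b) ≤ ENNReal.ofReal (∫ x in a..b, v x) := by
  set K : ℝ → ℝ := fun x => ∫ z in a..x, v z with hK
  have hsub : ∀ x y, K y - K x = ∫ z in x..y, v z := fun x y =>
    intervalIntegral.integral_interval_sub_left (h.intervalIntegrable _ _)
      (h.intervalIntegrable _ _)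
  have hmono : Monotone K := fun x y hxy => by
    have := h.integral_nonneg hxy
    rw [← hsub] at this; linarith
  have h1 : eVariationOn f (Icc a b) ≤ eVariationOn K (Icc a b) := by
    refine iSup_mono fun p => Finset.sum_le_sum fun i _ => ?_
    have hle := p.2.2.1 (Nat.le_succ i)
    rw [edist_eq_enorm_sub, edist_dist, Real.dist_eq, hsub,
      abs_of_nonneg (h.integral_nonneg hle), ← ofReal_norm]
    exact ENNReal.ofReal_le_ofReal (h.norm_sub_le _ _ hle)
  refine h1.trans ?_
  have := (hmono.monotoneOn (Icc a b)).eVariationOn_eq (left_mem_Icc.2 hab) (right_mem_Icc.2 hab)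
  rw [inter_self, hsub] at this
  exact this.le

theorem SpeedBound.locallyBoundedVariationOn {f : ℝ → Euc N} {v : ℝ → ℝ} (h : SpeedBound f v) :
    LocallyBoundedVariationOn f univ := by
  intro a b _ _
  rw [univ_inter]
  rcases le_total a b with hab | hab
  · exact ne_top_of_le_ne_top ENNReal.ofReal_ne_top (h.eVariationOn_le hab)
  · rw [BoundedVariationOn, eVariationOn.subsingleton _ (subsingleton_Icc_of_ge hab)]
    exact ENNReal.zero_ne_top

/-- For the lower bound, the variation function is monotone, its derivative dominates the speed, and
the integral of the derivative of a monotone function is at most its increment. -/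
theorem SpeedBound.eVariationOn_eq {f : ℝ → Euc N} (h : SpeedBound f fun x => ‖deriv f x‖)
    {a b : ℝ} (hab : a ≤ b) :
    eVariationOn f (Icc a b) = ENNReal.ofReal (∫ x in a..b, ‖deriv f x‖) := by
  refine le_antisymm (h.eVariationOn_le hab) ?_
  have hbv := h.locallyBoundedVariationOn
  set V := variationOnFromTo f univ a with hV
  have hVm : Monotone V := fun x y hxy =>
    variationOnFromTo.monotoneOn hbv (mem_univ a) (mem_univ x) (mem_univ y) hxy
  have hVsub : ∀ x y, x ≤ y → V y - V x = (eVariationOn f (Icc x y)).toReal := fun x y hxy => by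
    have := variationOnFromTo.add hbv (mem_univ a) (mem_univ x) (mem_univ y)
    rw [hV, ← this, add_sub_cancel_left, variationOnFromTo.eq_of_le _ _ hxy, univ_inter]
  have hfin : ∀ x y, eVariationOn f (Icc x y) ≠ ⊤ := fun x y => by
    have := hbv x y (mem_univ _) (mem_univ _); rwa [univ_inter] at this
  have hle : ∀ x y, x ≤ y → ‖f y - f x‖ ≤ V y - V x := fun x y hxy => by
    rw [hVsub x y hxy, ← dist_eq_norm, dist_edist]
    exact ENNReal.toReal_mono (hfin x y)
      (eVariationOn.edist_le f (right_mem_Icc.2 hxy) (left_mem_Icc.2 hxy))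
  have hd : ∀ᵐ x, ‖deriv f x‖ ≤ deriv V x := by
    filter_upwards [h.ae_differentiableAt, hVm.ae_differentiableAt] with x hx hv
    have h1 := (hx.hasDerivAt.tendsto_slope.mono_left (nhdsGT_le_nhdsNE x)).norm
    have h2 := hv.hasDerivAt.tendsto_slope.mono_left (nhdsGT_le_nhdsNE x)
    refine le_of_tendsto_of_tendsto h1 h2 ?_
    filter_upwards [self_mem_nhdsWithin] with y hy
    have hy' : x < y := hy
    have hpos : 0 < y - x := by linarith
    rw [slope_def_module, slope_def_field, norm_smul, norm_inv, Real.norm_of_nonneg hpos.le,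
      div_eq_inv_mul]
    exact mul_le_mul_of_nonneg_left (hle x y hy'.le) (by positivity)
  have hmem := (hVm.monotoneOn (uIcc a b)).intervalIntegral_deriv_mem_uIcc
  rw [uIcc_of_le (sub_nonneg.2 (hVm hab))] at hmem
  have h3 : ∫ x in a..b, ‖deriv f x‖ ≤ ∫ x in a..b, deriv V x :=
    intervalIntegral.integral_mono_ae hab (h.intervalIntegrable a b)
      (hVm.monotoneOn (uIcc a b)).intervalIntegrable_deriv hd
  have h4 := h3.trans hmem.2
  rw [hVsub a b hab] at h4
  exact ENNReal.ofReal_le_of_le_toReal h4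

/-- An upper bound for the speed whose integrals exhaust the variation has no room to be strict.
This computes speeds of reparametrized curves without a chain rule. -/
theorem SpeedBound.norm_deriv_eq {f : ℝ → Euc N} {v : ℝ → ℝ} (h : SpeedBound f v)
    (hV : ∀ a b, a ≤ b → eVariationOn f (Icc a b) = ENNReal.ofReal (∫ x in a..b, v x)) :
    ∀ᵐ x, ‖deriv f x‖ = v x := by
  refine ae_of_forall_uIcc fun a b => ?_
  wlog hab : a ≤ b generalizing a b
  · have := this b a (by linarith)
    rwa [uIcc_comm] at this
  have h1 := h.norm_deriv.eVariationOn_eq hab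
  rw [hV a b hab, ENNReal.ofReal_eq_ofReal_iff (h.integral_nonneg hab)
    (h.norm_deriv.integral_nonneg hab)] at h1
  have h2 : ∫ x in a..b, (v x - ‖deriv f x‖) = 0 := by
    rw [intervalIntegral.integral_sub (h.intervalIntegrable _ _)
      (h.norm_deriv.intervalIntegrable _ _), h1, sub_self]
  rw [intervalIntegral.integral_eq_zero_iff_of_le_of_nonneg_ae hab
    (ae_restrict_of_ae (by filter_upwards [h.norm_deriv_le] with x hx; simpa using hx))
    ((h.intervalIntegrable _ _).sub (h.norm_deriv.intervalIntegrable _ _)),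
    EventuallyEq, ae_restrict_iff' measurableSet_Ioc] at h2
  have h3 : ∀ᵐ x : ℝ, x ≠ a := by simp [ae_iff, measure_singleton]
  filter_upwards [h2, h3] with x hx hxa hm
  rw [uIcc_of_le hab] at hm
  have := hx ⟨lt_of_le_of_ne hm.1 (Ne.symm hxa), hm.2⟩
  simp only [Pi.zero_apply] at this
  linarith

theorem SpeedBound.of_grid {f : ℝ → Euc N} {v : ℝ → ℝ} {c h : ℝ} (hh : 0 < h)
    (hv : ∀ a b, IntervalIntegrable v volume a b)
    (cell : ∀ k : ℤ, ∀ x y, c + k * h ≤ x → x ≤ y → y ≤ c + (k + 1) * h →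
      ‖f y - f x‖ ≤ ∫ z in x..y, v z) : SpeedBound f v := by
  refine ⟨hv, rel_of_grid hh (fun x y z _ _ h1 h2 => ?_) cell⟩
  rw [← intervalIntegral.integral_add_adjacent_intervals (hv x y) (hv y z)]
  calc ‖f z - f x‖ = ‖(f z - f y) + (f y - f x)‖ := by rw [sub_add_sub_cancel]
    _ ≤ _ := (norm_add_le _ _).trans (by linarith)

end Variation

/-! ### Maps of class W^{1,2} on the circle -/

section Circle

variable {N : ℕ}

theorem lift_periodic {X : Type*} (f : Circ → X) : Function.Periodic (lift f) (2 * Real.pi) :=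
  fun x => by simp [lift]

theorem _root_.Function.Periodic.deriv_periodic {F : Type*} [NormedAddCommGroup F]
    [NormedSpace ℝ F] {f : ℝ → F} {T : ℝ} (hf : Function.Periodic f T) :
    Function.Periodic (deriv f) T := fun x => by
  rw [← deriv_comp_add_const f T x, hf.funext]

theorem IsW12.sq_intervalIntegrable {f : Circ → Euc N} (h : IsW12 f) (a b : ℝ) :
    IntervalIntegrable (fun x => ‖deriv (lift f) x‖ ^ 2) volume a b := by
  have hp : Function.Periodic (fun x => ‖deriv (lift f) x‖ ^ 2) (2 * Real.pi) := fun x => by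
    simp only [(lift_periodic f).deriv_periodic x]
  refine hp.intervalIntegrable (by positivity) (t := 0) ?_ a b
  rw [zero_add, intervalIntegrable_iff_integrableOn_Ioc_of_le (by positivity)]
  exact (memLp_two_iff_integrable_sq_norm h.2.1).1 h.2

theorem intervalIntegrable_of_sq {v : ℝ → ℝ} (hm : AEStronglyMeasurable v volume) {a b : ℝ}
    (h : IntervalIntegrable (fun x => v x ^ 2) volume a b) :
    IntervalIntegrable v volume a b := by
  refine (h.add (intervalIntegrable_const (c := (1 : ℝ)))).mono_fun hm.restrict ?_
  refine Eventually.of_forall fun x => ?_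
  simp only [Real.norm_eq_abs]
  rw [abs_of_nonneg (by positivity : (0 : ℝ) ≤ v x ^ 2 + 1)]
  nlinarith [sq_abs (v x), sq_nonneg (|v x| - 1)]

/-- Absolute continuity is given on one period only; translation by multiples of the period and
gluing over the grid extend the bound to the line. -/
theorem IsW12.speedBound {f : Circ → Euc N} (h : IsW12 f) :
    SpeedBound (lift f) fun x => ‖deriv (lift f) x‖ := by
  have hv : ∀ a b, IntervalIntegrable (fun x => ‖deriv (lift f) x‖) volume a b := fun a b =>
    intervalIntegrable_of_sq (measurable_deriv _).norm.aestronglyMeasurable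
      (h.sq_intervalIntegrable a b)
  refine SpeedBound.of_grid (c := 0) (h := 2 * Real.pi) (by positivity) hv ?_
  intro k x y hx hxy hy
  have hper : Function.Periodic (lift f) (k * (2 * Real.pi)) := by
    simpa using (lift_periodic f).int_mul k
  have h1 := (h.1.mono (c := x - k * (2 * Real.pi)) (d := y - k * (2 * Real.pi)) (by
    rw [uIcc_of_le (by linarith), uIcc_of_le (by positivity)]
    exact Icc_subset_Icc (by linarith) (by linarith))).norm_sub_le_integral (by linarith) (hv _ _)
  rw [hper.sub_eq, hper.sub_eq] at h1
  refine h1.trans (le_of_eq ?_)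
  have := intervalIntegral.integral_comp_sub_right (a := x) (b := y)
    (fun z => ‖deriv (lift f) z‖) (k * (2 * Real.pi))
  rw [← this]
  simp only [hper.deriv_periodic.sub_eq]

theorem IsW12.of_speedBound {f : Circ → Euc N} {v : ℝ → ℝ} (h : SpeedBound (lift f) v)
    (hv : ∀ a b, IntervalIntegrable (fun x => v x ^ 2) volume a b) : IsW12 f := by
  refine ⟨h.absolutelyContinuousOnInterval _ _, ?_⟩
  rw [memLp_two_iff_integrable_sq_norm (measurable_deriv _).aestronglyMeasurable]
  have h1 := hv 0 (2 * Real.pi)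
  rw [intervalIntegrable_iff_integrableOn_Ioc_of_le (by positivity)] at h1
  refine Integrable.mono h1 ((measurable_deriv _).norm.pow_const 2).aestronglyMeasurable ?_
  refine ae_restrict_of_ae ?_
  filter_upwards [h.norm_deriv_le] with x hx
  simp only [norm_pow, Real.norm_eq_abs, abs_norm]
  exact pow_le_pow_left₀ (norm_nonneg _) (hx.trans (le_abs_self _)) 2

theorem IsW12.continuous_lift {f : Circ → Euc N} (h : IsW12 f) : Continuous (lift f) :=
  h.speedBound.continuous

/-- Cauchy-Schwarz, from the nonnegativity of the integral of the squared deviation from the mean.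
-/
theorem sq_integral_le {v : ℝ → ℝ} {a b : ℝ} (hab : a ≤ b) (hv : IntervalIntegrable v volume a b)
    (hv2 : IntervalIntegrable (fun x => v x ^ 2) volume a b) :
    (∫ x in a..b, v x) ^ 2 ≤ (b - a) * ∫ x in a..b, v x ^ 2 := by
  rcases hab.eq_or_lt with rfl | hlt
  · simp
  set m := (∫ x in a..b, v x) / (b - a) with hm
  have hpos : 0 < b - a := by linarith
  have h0 : 0 ≤ ∫ x in a..b, (v x - m) ^ 2 :=
    intervalIntegral.integral_nonneg hab fun _ _ => sq_nonneg _
  have h1 : ∫ x in a..b, (v x - m) ^ 2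
      = (∫ x in a..b, v x ^ 2) - 2 * m * (∫ x in a..b, v x) + (b - a) * m ^ 2 := by
    have : (fun x => (v x - m) ^ 2) = fun x => v x ^ 2 - 2 * m * v x + m ^ 2 := by
      funext x; ring
    rw [this, intervalIntegral.integral_add (hv2.sub (hv.const_mul _)) intervalIntegrable_const,
      intervalIntegral.integral_sub hv2 (hv.const_mul _), intervalIntegral.integral_const_mul,
      intervalIntegral.integral_const, smul_eq_mul]
  have h2 : (∫ x in a..b, v x) = m * (b - a) := by rw [hm]; field_simp
  rw [h1, h2] at h0
  rw [h2]
  nlinarith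

end Circle

/-! ### Lower semicontinuity of the energy and W^{1,2} convergence -/

section Energy

variable {N : ℕ}

theorem integral_periodic_circle {v : ℝ → ℝ} (hv : Function.Periodic v (2 * Real.pi)) (a : ℝ) :
    ∫ x in a..a + 2 * Real.pi, v x = ∫ x in (0 : ℝ)..2 * Real.pi, v x := by
  have := hv.intervalIntegral_add_eq a 0
  rwa [zero_add] at this

theorem sq_norm_deriv_periodic (f : Circ → Euc N) :
    Function.Periodic (fun x => ‖deriv (lift f) x‖ ^ 2) (2 * Real.pi) := fun x => by
  simp only [(lift_periodic f).deriv_periodic x]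

theorem energy_eq_integral (f : Circ → Euc N) (a : ℝ) :
    energy f = ∫ x in a..a + 2 * Real.pi, ‖deriv (lift f) x‖ ^ 2 :=
  (integral_periodic_circle (sq_norm_deriv_periodic f) a).symm

theorem IsW12.sq_norm_sub_le {f : Circ → Euc N} (h : IsW12 f) {x y : ℝ} (hxy : x ≤ y) :
    ‖lift f y - lift f x‖ ^ 2 ≤ (y - x) * ∫ z in x..y, ‖deriv (lift f) z‖ ^ 2 :=
  (pow_le_pow_left₀ (norm_nonneg _) (h.speedBound.norm_sub_le x y hxy) 2).trans
    (sq_integral_le hxy (h.speedBound.intervalIntegrable _ _) (h.sq_intervalIntegrable _ _))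

/-- With `K` a primitive of the squared speed, the integrand is at most δ(K(x+δ) - K(x)). Since `K`
grows by exactly the energy over a period, the shift integrates to `δ` times the energy. -/
theorem IsW12.integral_sq_norm_diff_le {f : Circ → Euc N} (h : IsW12 f) {δ : ℝ} (hδ : 0 ≤ δ) :
    ∫ x in (0 : ℝ)..2 * Real.pi, ‖lift f (x + δ) - lift f x‖ ^ 2 ≤ δ ^ 2 * energy f := by
  set K : ℝ → ℝ := fun x => ∫ z in (0 : ℝ)..x, ‖deriv (lift f) z‖ ^ 2 with hK
  have hKc : Continuous K := intervalIntegral.continuous_primitive h.sq_intervalIntegrable 0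
  have hKsub : ∀ x y, K y - K x = ∫ z in x..y, ‖deriv (lift f) z‖ ^ 2 := fun x y =>
    intervalIntegral.integral_interval_sub_left (h.sq_intervalIntegrable _ _)
      (h.sq_intervalIntegrable _ _)
  have hKi : ∀ a b, IntervalIntegrable K volume a b := fun a b => hKc.intervalIntegrable a b
  have hfc := h.continuous_lift
  have h1 : ∫ x in (0 : ℝ)..2 * Real.pi, ‖lift f (x + δ) - lift f x‖ ^ 2 ≤
      ∫ x in (0 : ℝ)..2 * Real.pi, δ * (K (x + δ) - K x) := by
    refine intervalIntegral.integral_mono (by positivity)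
      (Continuous.intervalIntegrable (by fun_prop) _ _)
      (Continuous.intervalIntegrable (by fun_prop) _ _) fun x => ?_
    have := h.sq_norm_sub_le (x := x) (y := x + δ) (by linarith)
    rwa [add_sub_cancel_left, ← hKsub] at this
  refine h1.trans (le_of_eq ?_)
  rw [intervalIntegral.integral_const_mul, intervalIntegral.integral_sub
    (Continuous.intervalIntegrable (by fun_prop) _ _) (hKi _ _),
    intervalIntegral.integral_comp_add_right]
  have h2 : (∫ x in 0 + δ..2 * Real.pi + δ, K x) - ∫ x in (0 : ℝ)..2 * Real.pi, K x =
      ∫ x in (0 : ℝ)..δ, (K (x + 2 * Real.pi) - K x) := by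
    rw [intervalIntegral.integral_sub (Continuous.intervalIntegrable (by fun_prop) _ _) (hKi _ _),
      intervalIntegral.integral_comp_add_right, zero_add, zero_add, add_comm δ]
    have e1 := intervalIntegral.integral_add_adjacent_intervals (hKi 0 δ)
      (hKi δ (2 * Real.pi + δ))
    have e2 := intervalIntegral.integral_add_adjacent_intervals (hKi 0 (2 * Real.pi))
      (hKi (2 * Real.pi) (2 * Real.pi + δ))
    linarith
  rw [h2]
  have h3 : ∀ x, K (x + 2 * Real.pi) - K x = energy f := fun x => by
    rw [hKsub, ← energy_eq_integral]
  simp only [h3, intervalIntegral.integral_const, smul_eq_mul]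
  ring

/-- Fatou's lemma applied to the difference quotients with steps 1/(m+1), which converge to the
derivative almost everywhere. -/
theorem IsW12.exists_lt_integral_sq_norm_diff {f : Circ → Euc N} (h : IsW12 f) {c : ℝ}
    (hc : c < energy f) :
    ∃ δ > 0, δ ^ 2 * c < ∫ x in (0 : ℝ)..2 * Real.pi, ‖lift f (x + δ) - lift f x‖ ^ 2 := by
  by_contra! H
  have hfc := h.continuous_lift
  set δ : ℕ → ℝ := fun m => 1 / ((m : ℝ) + 1) with hδ
  have hδpos : ∀ m, 0 < δ m := fun m => by positivity
  have hδlim : Tendsto δ atTop (𝓝 0) := tendsto_one_div_add_atTop_nhds_zero_nat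
  set μ := (volume : Measure ℝ).restrict (Ioc 0 (2 * Real.pi)) with hμ
  set q : ℕ → ℝ → ℝ := fun m x => ((δ m)⁻¹ * ‖lift f (x + δ m) - lift f x‖) ^ 2 with hq
  have hqc : ∀ m, Continuous (q m) := fun m => by fun_prop
  have hqi : ∀ m, ∫⁻ x, ENNReal.ofReal (q m x) ∂μ ≤ ENNReal.ofReal c := fun m => by
    rw [← ofReal_integral_eq_lintegral_ofReal]
    · refine ENNReal.ofReal_le_ofReal ?_
      have := H (δ m) (hδpos m)
      rw [hμ, ← intervalIntegral.integral_of_le (by positivity)]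
      simp only [hq, mul_pow, intervalIntegral.integral_const_mul]
      rw [inv_pow, inv_mul_le_iff₀ (by have := hδpos m; positivity)]
      exact this
    · have := (hqc m).intervalIntegrable (μ := volume) 0 (2 * Real.pi)
      rwa [intervalIntegrable_iff_integrableOn_Ioc_of_le (by positivity)] at this
    · exact Eventually.of_forall fun x => by positivity
  have hlim : ∀ᵐ x ∂μ, Tendsto (fun m => ENNReal.ofReal (q m x)) atTop
      (𝓝 (ENNReal.ofReal (‖deriv (lift f) x‖ ^ 2))) := by
    refine ae_restrict_of_ae ?_
    filter_upwards [h.speedBound.ae_differentiableAt] with x hx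
    refine ENNReal.tendsto_ofReal (Tendsto.pow ?_ 2)
    have h1 := hx.hasDerivAt.tendsto_slope_zero_right.norm.comp
      (tendsto_nhdsWithin_iff.2 ⟨hδlim, Eventually.of_forall hδpos⟩)
    refine h1.congr fun m => ?_
    simp [norm_smul, abs_of_pos (hδpos m)]
  have hF := lintegral_liminf_le (μ := μ) (u := atTop) (f := fun (m : ℕ) x => ENNReal.ofReal (q m x))
    fun m => (hqc m).measurable.ennreal_ofReal
  have h2 : ∫⁻ x, ENNReal.ofReal (‖deriv (lift f) x‖ ^ 2) ∂μ ≤ ENNReal.ofReal c := by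
    calc _ = ∫⁻ x, liminf (fun m => ENNReal.ofReal (q m x)) atTop ∂μ :=
          lintegral_congr_ae (hlim.mono fun x hx => hx.liminf_eq.symm)
      _ ≤ _ := hF
      _ ≤ liminf (fun _ : ℕ => ENNReal.ofReal c) atTop :=
          liminf_le_liminf (Eventually.of_forall hqi)
      _ = _ := liminf_const _
  have h3 : energy f = ∫ x, ‖deriv (lift f) x‖ ^ 2 ∂μ := by
    rw [energy, intervalIntegral.integral_of_le (by positivity)]
  have hint := h.sq_intervalIntegrable 0 (2 * Real.pi)
  rw [intervalIntegrable_iff_integrableOn_Ioc_of_le (by positivity)] at hint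
  rw [← ofReal_integral_eq_lintegral_ofReal hint (Eventually.of_forall fun x => by positivity),
    ← h3] at h2
  -- For `c ≤ 0` the truncation in `ENNReal.ofReal` loses `c`; the shift by 1 then gives `0 ≤ c`,
  -- against `c < energy f ≤ 0`.
  rcases lt_or_ge 0 c with h0 | h0
  · rw [ENNReal.ofReal_le_ofReal_iff h0.le] at h2
    linarith
  · rw [ENNReal.ofReal_eq_zero.2 h0, nonpos_iff_eq_zero, ENNReal.ofReal_eq_zero] at h2
    have h4 := H 1 one_pos
    have h5 : 0 ≤ ∫ x in (0 : ℝ)..2 * Real.pi, ‖lift f (x + 1) - lift f x‖ ^ 2 :=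
      intervalIntegral.integral_nonneg (by positivity) fun _ _ => by positivity
    linarith

/-- Lower semicontinuity of the energy: for a fixed shift the difference quotients pass to the
uniform limit, and they bound the energy from below. -/
theorem eventually_lt_energy {T : Type*} {l : Filter T} [l.IsCountablyGenerated]
    {f : T → Circ → Euc N} {g : Circ → Euc N} (hf : ∀ t, IsW12 (f t)) (hg : IsW12 g)
    (hu : ∀ ε > 0, ∀ᶠ t in l, ∀ x, ‖lift (f t) x - lift g x‖ ≤ ε) {c : ℝ} (hc : c < energy g) :
    ∀ᶠ t in l, c < energy (f t) := by
  obtain ⟨δ, hδ, hlt⟩ := hg.exists_lt_integral_sq_norm_diff hc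
  have hgc := hg.continuous_lift
  have hpt : ∀ x, Tendsto (fun t => lift (f t) x) l (𝓝 (lift g x)) := fun x => by
    rw [Metric.tendsto_nhds]
    intro ε hε
    filter_upwards [hu (ε / 2) (by positivity)] with t ht
    rw [dist_eq_norm]
    linarith [ht x]
  have hlim : Tendsto (fun t => ∫ x in (0 : ℝ)..2 * Real.pi,
      ‖lift (f t) (x + δ) - lift (f t) x‖ ^ 2) l
      (𝓝 (∫ x in (0 : ℝ)..2 * Real.pi, ‖lift g (x + δ) - lift g x‖ ^ 2)) := by
    refine intervalIntegral.tendsto_integral_filter_of_dominated_convergence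
      (fun x => (‖lift g (x + δ) - lift g x‖ + 2) ^ 2) ?_ ?_
      (Continuous.intervalIntegrable (by fun_prop) _ _) ?_
    · refine Eventually.of_forall fun t => ?_
      have := (hf t).continuous_lift
      exact Continuous.aestronglyMeasurable (by fun_prop)
    · filter_upwards [hu 1 one_pos] with t ht
      refine Eventually.of_forall fun x _ => ?_
      rw [norm_pow, norm_norm]
      refine pow_le_pow_left₀ (norm_nonneg _) ?_ 2
      calc ‖lift (f t) (x + δ) - lift (f t) x‖ = ‖(lift g (x + δ) - lift g x) +
            (lift (f t) (x + δ) - lift g (x + δ)) - (lift (f t) x - lift g x)‖ := by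
            congr 1; abel
        _ ≤ _ := (norm_sub_le _ _).trans (by
            linarith [norm_add_le (lift g (x + δ) - lift g x)
              (lift (f t) (x + δ) - lift g (x + δ)), ht x, ht (x + δ)])
    · exact Eventually.of_forall fun x _ => (((hpt _).sub (hpt _)).norm.pow 2)
  filter_upwards [hlim.eventually (lt_mem_nhds hlt)] with t ht
  exact lt_of_mul_lt_mul_left (ht.trans_le ((hf t).integral_sq_norm_diff_le hδ.le)) (by positivity)

theorem IsW12.integrable_sq_deriv_sub {f g : Circ → Euc N} (hf : IsW12 f) (hg : IsW12 g)
    (a b : ℝ) :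
    IntervalIntegrable (fun x => ‖deriv (lift f) x - deriv (lift g) x‖ ^ 2) volume a b := by
  refine (((hf.sq_intervalIntegrable a b).const_mul 2).add
    ((hg.sq_intervalIntegrable a b).const_mul 2)).mono_fun
    (((measurable_deriv _).sub (measurable_deriv _)).norm.pow_const 2).aestronglyMeasurable ?_
  refine Eventually.of_forall fun x => ?_
  beta_reduce
  rw [Real.norm_of_nonneg (by positivity), Real.norm_of_nonneg (by positivity)]
  have := parallelogram_law_with_norm ℝ (deriv (lift f) x) (deriv (lift g) x)
  nlinarith [sq_nonneg ‖deriv (lift f) x + deriv (lift g) x‖]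

/-- The parallelogram law. If the energies of `f` and of the midpoint are both close to that of `g`,
then the derivatives are close in L². -/
theorem IsW12.midpoint {f g : Circ → Euc N} (hf : IsW12 f) (hg : IsW12 g) :
    IsW12 (fun x => (2⁻¹ : ℝ) • (f x + g x)) ∧
    ∫ x in (0 : ℝ)..2 * Real.pi, ‖deriv (lift f) x - deriv (lift g) x‖ ^ 2 =
      2 * energy f + 2 * energy g - 4 * energy (fun x => (2⁻¹ : ℝ) • (f x + g x)) := by
  set h : Circ → Euc N := fun x => (2⁻¹ : ℝ) • (f x + g x) with hh
  have hd : ∀ᵐ x, deriv (lift h) x = (2⁻¹ : ℝ) • (deriv (lift f) x + deriv (lift g) x) := by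
    filter_upwards [hf.speedBound.ae_differentiableAt, hg.speedBound.ae_differentiableAt]
      with x h1 h2
    exact ((h1.hasDerivAt.add h2.hasDerivAt).const_smul (2⁻¹ : ℝ)).deriv
  have hsum : ∀ a b, IntervalIntegrable (fun x => (‖deriv (lift f) x‖ + ‖deriv (lift g) x‖) ^ 2)
      volume a b := fun a b => by
    refine (((hf.sq_intervalIntegrable a b).const_mul 2).add
      ((hg.sq_intervalIntegrable a b).const_mul 2)).mono_fun
      (((measurable_deriv _).norm.add (measurable_deriv _).norm).pow_const 2).aestronglyMeasurable
      ?_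
    refine Eventually.of_forall fun x => ?_
    beta_reduce
    rw [Real.norm_of_nonneg (by positivity), Real.norm_of_nonneg (by positivity)]
    nlinarith [sq_nonneg (‖deriv (lift f) x‖ - ‖deriv (lift g) x‖)]
  have hW : IsW12 h := by
    refine IsW12.of_speedBound (v := fun x => ‖deriv (lift f) x‖ + ‖deriv (lift g) x‖)
      ⟨fun a b => (hf.speedBound.intervalIntegrable a b).add
        (hg.speedBound.intervalIntegrable a b), fun x y hxy => ?_⟩ hsum
    rw [intervalIntegral.integral_add (hf.speedBound.intervalIntegrable x y)
        (hg.speedBound.intervalIntegrable x y)]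
    have e : lift h y - lift h x =
        (2⁻¹ : ℝ) • ((lift f y - lift f x) + (lift g y - lift g x)) := by
      simp only [lift, hh]; module
    rw [e, norm_smul]
    have h1 := hf.speedBound.norm_sub_le x y hxy
    have h2 := hg.speedBound.norm_sub_le x y hxy
    have h3 := norm_add_le (lift f y - lift f x) (lift g y - lift g x)
    have h4 := norm_nonneg ((lift f y - lift f x) + (lift g y - lift g x))
    norm_num
    linarith
  refine ⟨hW, ?_⟩
  have h0 : (∫ x in (0 : ℝ)..2 * Real.pi, ‖deriv (lift f) x - deriv (lift g) x‖ ^ 2) =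
      ∫ x in (0 : ℝ)..2 * Real.pi, (2 * ‖deriv (lift f) x‖ ^ 2 + 2 * ‖deriv (lift g) x‖ ^ 2
        - 4 * ‖deriv (lift h) x‖ ^ 2) := by
    refine intervalIntegral.integral_congr_ae (hd.mono fun x hx _ => ?_)
    simp only [hx, norm_smul]
    have := parallelogram_law_with_norm ℝ (deriv (lift f) x) (deriv (lift g) x)
    norm_num
    nlinarith
  rw [h0, intervalIntegral.integral_sub, intervalIntegral.integral_add,
    intervalIntegral.integral_const_mul, intervalIntegral.integral_const_mul,
    intervalIntegral.integral_const_mul]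
  · rfl
  · exact (hf.sq_intervalIntegrable _ _).const_mul _
  · exact (hg.sq_intervalIntegrable _ _).const_mul _
  · exact ((hf.sq_intervalIntegrable _ _).const_mul _).add
      ((hg.sq_intervalIntegrable _ _).const_mul _)
  · exact (hW.sq_intervalIntegrable _ _).const_mul _

/-- Uniform convergence together with convergence of the energies is convergence in `W^{1,2}`. -/
theorem tendsto_w12Dist {T : Type*} {l : Filter T} [l.IsCountablyGenerated]
    {f : T → Circ → Euc N} {g : Circ → Euc N} (hf : ∀ t, IsW12 (f t)) (hg : IsW12 g)
    (hu : ∀ ε > 0, ∀ᶠ t in l, ∀ x, ‖lift (f t) x - lift g x‖ ≤ ε)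
    (hE : Tendsto (fun t => energy (f t)) l (𝓝 (energy g))) :
    Tendsto (fun t => w12Dist (f t) g) l (𝓝 0) := by
  have hgc := hg.continuous_lift
  have h1 : Tendsto (fun t => ∫ x in (0 : ℝ)..2 * Real.pi, ‖lift (f t) x - lift g x‖ ^ 2) l
      (𝓝 0) := by
    rw [Metric.tendsto_nhds]
    intro ε hε
    set η := Real.sqrt (ε / (2 * (2 * Real.pi))) with hη
    have hη2 : η ^ 2 = ε / (2 * (2 * Real.pi)) := Real.sq_sqrt (by positivity)
    filter_upwards [hu η (by positivity)] with t ht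
    have hfc := (hf t).continuous_lift
    have h0 : 0 ≤ ∫ x in (0 : ℝ)..2 * Real.pi, ‖lift (f t) x - lift g x‖ ^ 2 :=
      intervalIntegral.integral_nonneg (by positivity) fun _ _ => by positivity
    rw [Real.dist_eq, sub_zero, abs_of_nonneg h0]
    have : ∫ x in (0 : ℝ)..2 * Real.pi, ‖lift (f t) x - lift g x‖ ^ 2 ≤
        ∫ x in (0 : ℝ)..2 * Real.pi, η ^ 2 :=
      intervalIntegral.integral_mono (by positivity)
        (Continuous.intervalIntegrable (by fun_prop) _ _) intervalIntegrable_const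
        fun x => pow_le_pow_left₀ (norm_nonneg _) (ht x) 2
    refine this.trans_lt ?_
    rw [intervalIntegral.integral_const, smul_eq_mul, hη2, sub_zero]
    have hp : (0 : ℝ) < 2 * Real.pi := by positivity
    rw [show 2 * Real.pi * (ε / (2 * (2 * Real.pi))) = ε / 2 by field_simp]
    linarith
  have h2 : Tendsto (fun t => ∫ x in (0 : ℝ)..2 * Real.pi,
      ‖deriv (lift (f t)) x - deriv (lift g) x‖ ^ 2) l (𝓝 0) := by
    rw [Metric.tendsto_nhds]
    intro ε hε
    have hu' : ∀ ε > 0, ∀ᶠ t in l, ∀ x,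
        ‖lift (fun x => (2⁻¹ : ℝ) • (f t x + g x)) x - lift g x‖ ≤ ε := by
      intro ε hε
      filter_upwards [hu ε hε] with t ht x
      have e : lift (fun x => (2⁻¹ : ℝ) • (f t x + g x)) x - lift g x =
          (2⁻¹ : ℝ) • (lift (f t) x - lift g x) := by
        simp only [lift]; module
      rw [e, norm_smul]
      have := ht x
      have := norm_nonneg (lift (f t) x - lift g x)
      norm_num
      linarith
    -- The midpoints also converge uniformly to `g`, so semicontinuity applies to them. The
    -- parallelogram identity then gives less than 2(ε/8) + 4(ε/8) < ε.
    filter_upwards [eventually_lt_energy (fun t => ((hf t).midpoint hg).1) hg hu'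
      (c := energy g - ε / 8) (by linarith),
      hE.eventually (gt_mem_nhds (show energy g < energy g + ε / 8 by linarith))] with t ht1 ht2
    rw [Real.dist_eq, sub_zero, abs_of_nonneg
      (intervalIntegral.integral_nonneg (by positivity) fun _ _ => by positivity),
      ((hf t).midpoint hg).2]
    linarith
  have h3 := (h1.add h2).sqrt
  rw [add_zero, Real.sqrt_zero] at h3
  refine h3.congr fun t => ?_
  have hfc := (hf t).continuous_lift
  rw [w12Dist, intervalIntegral.integral_add (Continuous.intervalIntegrable (by fun_prop) _ _)
    ((hf t).integrable_sq_deriv_sub hg _ _)]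

theorem tendsto_integral_sq_deriv_sub {T : Type*} {l : Filter T}
    {f : T → Circ → Euc N} {g : Circ → Euc N} (hf : ∀ t, IsW12 (f t)) (hg : IsW12 g)
    (h : Tendsto (fun t => w12Dist (f t) g) l (𝓝 0)) {a b : ℝ} (hab : a ≤ b) :
    Tendsto (fun t => ∫ x in a..b, ‖deriv (lift (f t)) x - deriv (lift g) x‖ ^ 2) l (𝓝 0) := by
  obtain ⟨m, hm⟩ := exists_nat_ge ((b - a) / (2 * Real.pi))
  rw [div_le_iff₀ (by positivity)] at hm
  have h2 := (h.pow 2).const_mul (m : ℝ)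
  rw [zero_pow two_ne_zero, mul_zero] at h2
  refine squeeze_zero (fun t => intervalIntegral.integral_nonneg hab fun _ _ => by positivity)
    (fun t => ?_) h2
  have hi := (hf t).integrable_sq_deriv_sub hg
  have hfc := (hf t).continuous_lift
  have hgc := hg.continuous_lift
  have hper : Function.Periodic (fun x => ‖deriv (lift (f t)) x - deriv (lift g) x‖ ^ 2)
      (2 * Real.pi) := fun x => by
    simp only [(lift_periodic (f t)).deriv_periodic x, (lift_periodic g).deriv_periodic x]
  have h3 : ∫ x in a..b, ‖deriv (lift (f t)) x - deriv (lift g) x‖ ^ 2 ≤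
      ∫ x in a..a + m * (2 * Real.pi), ‖deriv (lift (f t)) x - deriv (lift g) x‖ ^ 2 := by
    rw [← intervalIntegral.integral_add_adjacent_intervals (hi a b)
      (hi b (a + m * (2 * Real.pi)))]
    have := intervalIntegral.integral_nonneg (μ := volume) (a := b) (b := a + m * (2 * Real.pi))
      (f := fun x => ‖deriv (lift (f t)) x - deriv (lift g) x‖ ^ 2) (by linarith)
      fun _ _ => by positivity
    linarith
  have h4 := hper.intervalIntegral_add_zsmul_eq m a hi
  simp only [zsmul_eq_mul, Int.cast_natCast] at h4
  rw [h4, integral_periodic_circle hper] at h3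
  refine h3.trans (mul_le_mul_of_nonneg_left ?_ (by positivity))
  have hci : IntervalIntegrable (fun x => ‖lift (f t) x - lift g x‖ ^ 2) volume 0 (2 * Real.pi) :=
    Continuous.intervalIntegrable (by fun_prop) _ _
  rw [w12Dist, Real.sq_sqrt (intervalIntegral.integral_nonneg (by positivity)
    fun _ _ => by positivity), intervalIntegral.integral_add hci (hi _ _)]
  have := intervalIntegral.integral_nonneg (μ := volume) (a := 0) (b := 2 * Real.pi)
      (f := fun x => ‖lift (f t) x - lift g x‖ ^ 2) (by positivity)
      fun _ _ => by positivity
  linarith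

theorem tendsto_integral_norm_deriv_sub {T : Type*} {l : Filter T}
    {f : T → Circ → Euc N} {g : Circ → Euc N} (hf : ∀ t, IsW12 (f t)) (hg : IsW12 g)
    (h : Tendsto (fun t => w12Dist (f t) g) l (𝓝 0)) {a b : ℝ} (hab : a ≤ b) :
    Tendsto (fun t => ∫ x in a..b, ‖deriv (lift (f t)) x - deriv (lift g) x‖) l (𝓝 0) := by
  have h1 := ((tendsto_integral_sq_deriv_sub hf hg h hab).const_mul (b - a)).sqrt
  rw [mul_zero, Real.sqrt_zero] at h1
  refine squeeze_zero (fun t => intervalIntegral.integral_nonneg hab fun _ _ => norm_nonneg _)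
    (fun t => ?_) h1
  have hi := (hf t).integrable_sq_deriv_sub hg a b
  exact Real.le_sqrt_of_sq_le (sq_integral_le hab (intervalIntegrable_of_sq
    ((measurable_deriv _).sub (measurable_deriv _)).norm.aestronglyMeasurable hi) hi)

theorem tendsto_integral_norm_deriv {T : Type*} {l : Filter T}
    {f : T → Circ → Euc N} {g : Circ → Euc N} (hf : ∀ t, IsW12 (f t)) (hg : IsW12 g)
    (h : Tendsto (fun t => w12Dist (f t) g) l (𝓝 0)) (a b : ℝ) :
    Tendsto (fun t => ∫ x in a..b, ‖deriv (lift (f t)) x‖) l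
      (𝓝 (∫ x in a..b, ‖deriv (lift g) x‖)) := by
  wlog hab : a ≤ b generalizing a b
  · have := (this b a (by linarith)).neg
    simpa only [← intervalIntegral.integral_symm] using this
  rw [tendsto_iff_norm_sub_tendsto_zero]
  refine squeeze_zero (fun _ => norm_nonneg _) (fun t => ?_)
    (tendsto_integral_norm_deriv_sub hf hg h hab)
  rw [← intervalIntegral.integral_sub ((hf t).speedBound.intervalIntegrable _ _)
    (hg.speedBound.intervalIntegrable _ _)]
  refine intervalIntegral.norm_integral_le_of_norm_le hab
    (Eventually.of_forall fun x _ => ?_) (intervalIntegrable_of_sq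
      ((measurable_deriv _).sub (measurable_deriv _)).norm.aestronglyMeasurable
      ((hf t).integrable_sq_deriv_sub hg a b))
  exact abs_norm_sub_norm_le _ _

/-- Young's inequality: with `d` the norm of the difference, |p² - r²| ≤ (1 + 1/ε) d² + ε r², where
the last term is small uniformly in `t`. -/
theorem tendsto_integral_sq_norm_deriv {T : Type*} {l : Filter T}
    {f : T → Circ → Euc N} {g : Circ → Euc N} (hf : ∀ t, IsW12 (f t)) (hg : IsW12 g)
    (h : Tendsto (fun t => w12Dist (f t) g) l (𝓝 0)) {a b : ℝ} (hab : a ≤ b) :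
    Tendsto (fun t => ∫ x in a..b, ‖deriv (lift (f t)) x‖ ^ 2) l
      (𝓝 (∫ x in a..b, ‖deriv (lift g) x‖ ^ 2)) := by
  set G := ∫ x in a..b, ‖deriv (lift g) x‖ ^ 2 with hG
  have hG0 : 0 ≤ G := intervalIntegral.integral_nonneg hab fun _ _ => by positivity
  have hbound : ∀ t, ∀ ε > 0, |(∫ x in a..b, ‖deriv (lift (f t)) x‖ ^ 2) - G| ≤
      (1 + 1 / ε) * (∫ x in a..b, ‖deriv (lift (f t)) x - deriv (lift g) x‖ ^ 2) + ε * G := by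
    intro t ε hε
    have hi := (hf t).integrable_sq_deriv_sub hg a b
    rw [hG, ← intervalIntegral.integral_sub ((hf t).sq_intervalIntegrable _ _)
      (hg.sq_intervalIntegrable _ _), ← intervalIntegral.integral_const_mul,
      ← intervalIntegral.integral_const_mul, ← intervalIntegral.integral_add (hi.const_mul _)
        ((hg.sq_intervalIntegrable _ _).const_mul _), ← Real.norm_eq_abs]
    refine intervalIntegral.norm_integral_le_of_norm_le hab
      (Eventually.of_forall fun x _ => ?_) ((hi.const_mul _).add
        ((hg.sq_intervalIntegrable _ _).const_mul _))
    set p := ‖deriv (lift (f t)) x‖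
    set r := ‖deriv (lift g) x‖
    set d := ‖deriv (lift (f t)) x - deriv (lift g) x‖
    have hd : |p - r| ≤ d := abs_norm_sub_norm_le _ _
    have hr : 0 ≤ r := norm_nonneg _
    have h1 : |p ^ 2 - r ^ 2| ≤ d * (d + 2 * r) := by
      rw [show p ^ 2 - r ^ 2 = (p - r) * (p + r) by ring, abs_mul]
      have hp : 0 ≤ p := norm_nonneg _
      rw [abs_of_nonneg (by positivity : 0 ≤ p + r)]
      have := abs_le.1 hd
      exact mul_le_mul hd (by linarith) (by positivity) (norm_nonneg _)
    refine h1.trans ?_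
    have h2 : 0 ≤ (1 / ε) * (d - ε * r) ^ 2 := by positivity
    have h3 : (1 / ε) * (d - ε * r) ^ 2 = (1 / ε) * d ^ 2 - 2 * d * r + ε * r ^ 2 := by
      field_simp
      ring
    nlinarith
  rw [Metric.tendsto_nhds]
  intro ε hε
  set η := ε / (2 * (G + 1)) with hη
  have hηpos : 0 < η := by positivity
  have hlim := (tendsto_integral_sq_deriv_sub hf hg h hab).const_mul (1 + 1 / η)
  rw [mul_zero] at hlim
  filter_upwards [hlim.eventually (gt_mem_nhds (show 0 < ε / 2 by linarith))] with t ht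
  rw [Real.dist_eq]
  have h1 := hbound t η hηpos
  have h2 : η * G ≤ ε / 2 := by
    rw [hη, div_mul_eq_mul_div, div_le_div_iff₀ (by positivity) two_pos]
    nlinarith
  linarith

end Energy

/-! ### Speed and length of geodesics -/

section Geodesic

variable {n N : ℕ} {M : Type*} [EMetricSpace M]
  [ChartedSpace (EuclideanSpace ℝ (Fin n)) M]

theorem IsGeodesic.mdifferentiableAt {ι : M → Euc N} {c : ℝ → M} (hc : IsGeodesic n ι c) (s : ℝ) :
    MDifferentiableAt 𝓘(ℝ, ℝ) (𝓡 n) c s :=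
  hc.1.contMDiffAt.mdifferentiableAt (by simp)

theorem isGeodesic_const (ι : M → Euc N) (p : M) : IsGeodesic n ι (fun _ => p) := by
  refine ⟨contMDiff_const, fun s v => ?_⟩
  have : deriv (ι ∘ fun _ : ℝ => p) = fun _ => 0 := by
    funext x; exact deriv_const x (ι p)
  rw [this, deriv_const, inner_zero_left]

theorem deriv_comp_affine {F : Type*} [NormedAddCommGroup F] [NormedSpace ℝ F] (g : ℝ → F)
    (a b s : ℝ) : deriv (fun s => g (a * s + b)) s = a • deriv g (a * s + b) := by
  have e1 := deriv_comp_mul_left a (fun x => g (x + b)) s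
  rw [e1, deriv_comp_add_const]

theorem IsGeodesic.comp_affine {ι : M → Euc N} {c : ℝ → M} (hc : IsGeodesic n ι c) (a b : ℝ) :
    IsGeodesic n ι (fun s => c (a * s + b)) := by
  refine ⟨hc.1.comp (g := c) (f := fun s : ℝ => a * s + b) ?_, fun s v => ?_⟩
  · exact ContDiff.contMDiff (by fun_prop)
  · have h2 : deriv (ι ∘ fun s => c (a * s + b)) = fun s => a • deriv (ι ∘ c) (a * s + b) :=
      funext fun s => deriv_comp_affine (ι ∘ c) a b s
    rw [h2, deriv_fun_const_smul_field, deriv_comp_affine, inner_smul_left, inner_smul_left]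
    have := hc.2 (a * s + b) v
    rw [this, mul_zero, mul_zero]

variable [RiemannianBundle (fun x : M => TangentSpace (𝓡 n) x)]

theorem IsIsometricEmbedding.mdifferentiableAt {ι : M → Euc N} (hι : IsIsometricEmbedding n ι)
    (p : M) : MDifferentiableAt (𝓡 n) 𝓘(ℝ, Euc N) ι p :=
  hι.contMDiff.contMDiffAt.mdifferentiableAt (by simp)

theorem IsIsometricEmbedding.hasDerivAt_comp {ι : M → Euc N} (hι : IsIsometricEmbedding n ι)
    {c : ℝ → M} {s : ℝ} (hc : MDifferentiableAt 𝓘(ℝ, ℝ) (𝓡 n) c s) :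
    HasDerivAt (ι ∘ c) (differential ι (c s) (mfderiv 𝓘(ℝ, ℝ) (𝓡 n) c s (1 : ℝ))) s := by
  have h : HasFDerivAt (ι ∘ c) ((differential ι (c s)).comp (mfderiv 𝓘(ℝ, ℝ) (𝓡 n) c s)) s :=
    ((hι.mdifferentiableAt (c s)).hasMFDerivAt.comp s hc.hasMFDerivAt).hasFDerivAt
  exact h.hasDerivAt

theorem IsIsometricEmbedding.enorm_mfderiv {ι : M → Euc N} (hι : IsIsometricEmbedding n ι)
    {c : ℝ → M} {s : ℝ} (hc : MDifferentiableAt 𝓘(ℝ, ℝ) (𝓡 n) c s) :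
    ‖mfderiv 𝓘(ℝ, ℝ) (𝓡 n) c s (1 : ℝ)‖ₑ = ‖deriv (ι ∘ c) s‖ₑ := by
  rw [(hι.hasDerivAt_comp hc).deriv, ← ofReal_norm, ← ofReal_norm, hι.norm_differential]

theorem IsIsometricEmbedding.pathELength_eq {ι : M → Euc N} (hι : IsIsometricEmbedding n ι)
    {c : ℝ → M} {a b : ℝ} (hc : ∀ s ∈ Icc a b, MDifferentiableAt 𝓘(ℝ, ℝ) (𝓡 n) c s) :
    Manifold.pathELength (𝓡 n) c a b = ∫⁻ s in Icc a b, ‖deriv (ι ∘ c) s‖ₑ := by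
  rw [Manifold.pathELength_eq_lintegral_mfderiv_Icc]
  exact setLIntegral_congr_fun measurableSet_Icc fun s hs => hι.enorm_mfderiv (hc s hs)

theorem IsGeodesic.contDiff_comp {ι : M → Euc N} {c : ℝ → M} (hc : IsGeodesic n ι c)
    (hι : IsIsometricEmbedding n ι) : ContDiff ℝ ∞ (ι ∘ c) :=
  (hι.contMDiff.comp hc.1).contDiff

/-- The velocity is tangent to the manifold and the acceleration is normal, so the squared speed has
zero derivative. -/
theorem IsGeodesic.norm_deriv_eq {ι : M → Euc N} {c : ℝ → M} (hc : IsGeodesic n ι c)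
    (hι : IsIsometricEmbedding n ι) (s s' : ℝ) :
    ‖deriv (ι ∘ c) s‖ = ‖deriv (ι ∘ c) s'‖ := by
  have hsm : ContDiff ℝ ∞ (ι ∘ c) := hc.contDiff_comp hι
  have hd : Differentiable ℝ (deriv (ι ∘ c)) :=
    ((contDiff_infty_iff_deriv.1 hsm).2).differentiable (by simp)
  have h0 : ∀ s, HasDerivAt (fun s => ‖deriv (ι ∘ c) s‖ ^ 2) 0 s := fun s => by
    have h1 := (hd s).hasDerivAt.norm_sq
    have h2 : (inner ℝ (deriv (ι ∘ c) s) (deriv (deriv (ι ∘ c)) s) : ℝ) = 0 := by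
      rw [real_inner_comm]
      conv_lhs => rw [(hι.hasDerivAt_comp (hc.mdifferentiableAt s)).deriv]
      exact hc.2 s _
    rwa [h2, mul_zero] at h1
  have h3 := is_const_of_deriv_eq_zero (fun s => (h0 s).differentiableAt)
    (fun s => (h0 s).deriv) s s'
  exact (sq_eq_sq₀ (norm_nonneg _) (norm_nonneg _)).1 h3

theorem IsGeodesic.pathELength_eq {ι : M → Euc N} {c : ℝ → M} (hc : IsGeodesic n ι c)
    (hι : IsIsometricEmbedding n ι) {a b : ℝ} (hab : a ≤ b) :
    Manifold.pathELength (𝓡 n) c a b = ENNReal.ofReal ((b - a) * ‖deriv (ι ∘ c) 0‖) := by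
  rw [hι.pathELength_eq fun s _ => hc.mdifferentiableAt s]
  have : ∀ s, ‖deriv (ι ∘ c) s‖ₑ = ‖deriv (ι ∘ c) 0‖ₑ := fun s => by
    rw [← ofReal_norm, ← ofReal_norm, hc.norm_deriv_eq hι s 0]
  simp only [this]
  rw [lintegral_const, Measure.restrict_apply_univ, Real.volume_Icc, mul_comm,
    ENNReal.ofReal_mul (by linarith), ofReal_norm]

theorem edist_le_lintegral [IsRiemannianManifold (𝓡 n) M] {ι : M → Euc N}
    (hι : IsIsometricEmbedding n ι) {c : ℝ → M} {a b : ℝ} (hab : a ≤ b)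
    (hc : ∀ s ∈ Icc a b, ContMDiffAt 𝓘(ℝ, ℝ) (𝓡 n) 1 c s) :
    edist (c a) (c b) ≤ ∫⁻ s in Icc a b, ‖deriv (ι ∘ c) s‖ₑ := by
  rw [← hι.pathELength_eq fun s hs => (hc s hs).mdifferentiableAt (by simp),
    IsRiemannianManifold.out (I := 𝓡 n) (c a) (c b)]
  exact Manifold.riemannianEDist_le_pathELength (fun s hs => (hc s hs).contMDiffWithinAt) rfl rfl hab

theorem IsGeodesic.edist_le [IsRiemannianManifold (𝓡 n) M] {ι : M → Euc N}
    {c : ℝ → M} (hc : IsGeodesic n ι c)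
    (hι : IsIsometricEmbedding n ι) {a b : ℝ} (hab : a ≤ b) :
    edist (c a) (c b) ≤ ENNReal.ofReal ((b - a) * ‖deriv (ι ∘ c) 0‖) := by
  rw [← hc.pathELength_eq hι hab, IsRiemannianManifold.out (I := 𝓡 n) (c a) (c b)]
  exact Manifold.riemannianEDist_le_pathELength
    (fun s hs => (hc.1.of_le (by simp)).contMDiffAt.contMDiffWithinAt) rfl rfl hab

end Geodesic

/-! ### Linear algebra behind the Gauss lemma -/

section GaussLemma

variable {E F : Type*} [NormedAddCommGroup E] [InnerProductSpace ℝ E] [FiniteDimensional ℝ E]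
  [NormedAddCommGroup F] [InnerProductSpace ℝ F] [FiniteDimensional ℝ F]

omit [FiniteDimensional ℝ E] [FiniteDimensional ℝ F] in
/-- If the functional `⟪u, ·⟫` is dominated by the seminorm `‖A ·‖` and both are `1` at `w`, then
`u` represents `⟪A w, A ·⟫`. -/
theorem inner_map_eq_of_le {A : E →L[ℝ] F} {u w : E} (hle : ∀ h, inner ℝ u h ≤ ‖A h‖)
    (hw : ‖A w‖ = 1) (hu : inner ℝ u w = (1 : ℝ)) (h : E) :
    inner ℝ (A w) (A h) = (inner ℝ u h : ℝ) := by
  have hsq : ∀ h, (inner ℝ u h : ℝ) ^ 2 ≤ ‖A h‖ ^ 2 := fun h => by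
    refine sq_le_sq' ?_ (hle h)
    have := hle (-h)
    rw [inner_neg_right, map_neg, norm_neg] at this
    linarith
  set d : ℝ := inner ℝ (A w) (A h) - inner ℝ u h with hd
  set k : ℝ := ‖A h‖ ^ 2 - inner ℝ u h ^ 2 with hk
  have hk0 : 0 ≤ k := sub_nonneg.2 (hsq h)
  -- The difference of squares along `w + t • h` vanishes at `t = 0` and is nonnegative, so its
  -- linear coefficient `2 * d` must be zero. The test value below uses `k + 1` in place of `k` to
  -- keep the denominator positive.
  have hpoly : ∀ t : ℝ, 0 ≤ 2 * t * d + t ^ 2 * k := fun t => by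
    have h1 := hsq (w + t • h)
    rw [map_add, map_smul, norm_add_sq_real, inner_add_right, inner_smul_right, inner_smul_right,
      norm_smul, mul_pow, Real.norm_eq_abs, sq_abs, hw, hu] at h1
    rw [hd, hk]
    nlinarith
  have h2 := hpoly (-d / (k + 1))
  have h3 : 2 * (-d / (k + 1)) * d + (-d / (k + 1)) ^ 2 * k = -(d ^ 2 * (k + 2)) / (k + 1) ^ 2 := by
    field_simp
    ring
  rw [h3, le_div_iff₀ (by positivity), zero_mul] at h2
  have h4 : d ^ 2 = 0 := by nlinarith [sq_nonneg d]
  have h5 : d = 0 := by simpa using h4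
  linarith

/-- The real-linear version of taking adjoints. -/
noncomputable def adjointL : (E →L[ℝ] F) →L[ℝ] (F →L[ℝ] E) :=
  LinearMap.mkContinuous
    { toFun := fun A => ContinuousLinearMap.adjoint A
      map_add' := fun A B => map_add _ A B
      map_smul' := fun c A => by simp } 1 (fun A => by simp)

theorem adjointL_apply (A : E →L[ℝ] F) : adjointL A = ContinuousLinearMap.adjoint A := rfl

/-- The gradient of the norm in the metric pulled back by the differential of `Ψ`. -/
noncomputable def radialField (Ψ : E → F) (y : E) : E :=
  ContinuousLinearMap.inverse ((adjointL (fderiv ℝ Ψ y)).comp (fderiv ℝ Ψ y)) (‖y‖⁻¹ • y)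

/-- The Gram operator A*A of an injective `A` is injective because ⟪A*A v, v⟫ = ‖A v‖², hence
invertible in finite dimension. -/
theorem exists_equiv_adjoint_comp {A : E →L[ℝ] F} (hA : Function.Injective A) :
    ∃ e : E ≃L[ℝ] E, (e : E →L[ℝ] E) = (adjointL A).comp A := by
  set T : E →L[ℝ] E := (adjointL A).comp A with hT
  have hinj : Function.Injective (T : E →ₗ[ℝ] E) := by
    rw [injective_iff_map_eq_zero]
    intro v hv
    have h1 : inner ℝ (T v) v = (inner ℝ (A v) (A v) : ℝ) := by
      rw [hT, ContinuousLinearMap.comp_apply, adjointL_apply,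
        ContinuousLinearMap.adjoint_inner_left]
    have hv' : T v = 0 := hv
    rw [hv', inner_zero_left, eq_comm, inner_self_eq_zero] at h1
    exact (injective_iff_map_eq_zero A).1 hA v h1
  refine ⟨(LinearEquiv.ofInjectiveEndo (T : E →ₗ[ℝ] E) hinj).toContinuousLinearEquiv, ?_⟩
  ext v
  rfl

theorem contDiffAt_radialField {Ψ : E → F} {y : E} (hΨ : ContDiffAt ℝ ∞ Ψ y)
    (hinj : Function.Injective (fderiv ℝ Ψ y)) (hy : y ≠ 0) :
    ContDiffAt ℝ 1 (radialField Ψ) y := by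
  have hF : ContDiffAt ℝ 1 (fderiv ℝ Ψ) y := 
    (contDiffAt_infty.1 hΨ 2).fderiv_right (m := 1) (by norm_num)
  have hT : ContDiffAt ℝ 1 (fun y => (adjointL (fderiv ℝ Ψ y)).comp (fderiv ℝ Ψ y)) y :=
    ContDiffAt.clm_comp (ContDiffAt.comp y (g := (adjointL : (E →L[ℝ] F) →L[ℝ] (F →L[ℝ] E)))
      (ContinuousLinearMap.contDiff _).contDiffAt hF) hF
  obtain ⟨e, he⟩ := exists_equiv_adjoint_comp hinj
  have hI : ContDiffAt ℝ 1 (fun y => ContinuousLinearMap.inverse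
      ((adjointL (fderiv ℝ Ψ y)).comp (fderiv ℝ Ψ y))) y := by
    refine ContDiffAt.comp y (g := ContinuousLinearMap.inverse) ?_ hT
    rw [← he]
    exact contDiffAt_map_inverse e
  exact hI.clm_apply (((contDiffAt_norm ℝ hy).inv (norm_ne_zero_iff.2 hy)).smul contDiffAt_id)

/-- Equality in the Lipschitz bound for the norm determines the velocity: it must represent the
differential of the norm in the pulled back metric. -/
theorem eq_radialField {Ψ : E → F} {y w : E} (hinj : Function.Injective (fderiv ℝ Ψ y))
    (hle : ∀ h, inner ℝ (‖y‖⁻¹ • y) h ≤ ‖fderiv ℝ Ψ y h‖)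
    (hw : ‖fderiv ℝ Ψ y w‖ = 1) (hu : inner ℝ (‖y‖⁻¹ • y) w = (1 : ℝ)) :
    w = radialField Ψ y := by
  obtain ⟨e, he⟩ := exists_equiv_adjoint_comp hinj
  have h1 : e w = ‖y‖⁻¹ • y := by
    refine ext_inner_right ℝ fun h => ?_
    rw [← inner_map_eq_of_le hle hw hu h]
    have : e w = (adjointL (fderiv ℝ Ψ y)).comp (fderiv ℝ Ψ y) w := by rw [← he]; rfl
    rw [this, ContinuousLinearMap.comp_apply, adjointL_apply,
      ContinuousLinearMap.adjoint_inner_left]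
  rw [radialField, ← he, ContinuousLinearMap.inverse_equiv, ← h1]
  simp

end GaussLemma

/-! ### The distance function in normal coordinates -/

section NormalBall

variable {n N : ℕ} {M : Type*} [EMetricSpace M]
  [ChartedSpace (EuclideanSpace ℝ (Fin n)) M]
  {E : Type*} [NormedAddCommGroup E] [InnerProductSpace ℝ E]

/-- Normal coordinates on the ball of radius `R` around `p`, as far as distances from `p` go. -/
structure IsNormalBall (Φ : PartialDiffeomorph 𝓘(ℝ, E) (𝓡 n) E M ∞) (p : M) (R : ℝ) : Prop where
  source_eq : Φ.source = Metric.ball 0 R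
  target_eq : Φ.target = Metric.eball p (ENNReal.ofReal R)
  edist_eq : ∀ v ∈ Metric.ball (0 : E) R, edist p (Φ v) = ENNReal.ofReal ‖v‖

variable [RiemannianBundle (fun x : M => TangentSpace (𝓡 n) x)]
  {ι : M → Euc N} {Φ : PartialDiffeomorph 𝓘(ℝ, E) (𝓡 n) E M ∞} {p : M} {R : ℝ}

omit [RiemannianBundle (fun x : M => TangentSpace (𝓡 n) x)] in
theorem IsNormalBall.contMDiffAt (hΦ : IsNormalBall Φ p R) {y : E} (hy : y ∈ Metric.ball 0 R) :
    ContMDiffAt 𝓘(ℝ, E) (𝓡 n) ∞ Φ y :=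
  Φ.contMDiffOn.contMDiffAt (Φ.open_source.mem_nhds (by rwa [hΦ.source_eq]))

theorem IsNormalBall.contDiffAt (hΦ : IsNormalBall Φ p R) (hι : IsIsometricEmbedding n ι) {y : E}
    (hy : y ∈ Metric.ball 0 R) : ContDiffAt ℝ ∞ (ι ∘ Φ) y :=
  (hι.contMDiff.contMDiffAt.comp y (hΦ.contMDiffAt hy)).contDiffAt

theorem IsNormalBall.differentiableAt (hΦ : IsNormalBall Φ p R) (hι : IsIsometricEmbedding n ι)
    {y : E} (hy : y ∈ Metric.ball 0 R) : DifferentiableAt ℝ (ι ∘ Φ) y :=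
  (hΦ.contDiffAt hι hy).differentiableAt (by simp)

theorem IsNormalBall.injective_fderiv (hΦ : IsNormalBall Φ p R) (hι : IsIsometricEmbedding n ι)
    {y : E} (hy : y ∈ Metric.ball 0 R) : Function.Injective (fderiv ℝ (ι ∘ Φ) y) := by
  have hloc : IsLocalDiffeomorphAt 𝓘(ℝ, E) (𝓡 n) ∞ Φ y :=
    PartialDiffeomorph.isLocalDiffeomorphAt _ _ _ Φ (by rwa [hΦ.source_eq])
  let A : E →L[ℝ] Euc N := (differential ι (Φ y)).comp (mfderiv 𝓘(ℝ, E) (𝓡 n) Φ y)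
  have h1 : HasFDerivAt (ι ∘ Φ) A y :=
    ((hι.mdifferentiableAt (Φ y)).hasMFDerivAt.comp y
      ((hΦ.contMDiffAt hy).mdifferentiableAt (by simp)).hasMFDerivAt).hasFDerivAt
  rw [h1.fderiv]
  refine Function.Injective.comp (g := differential ι (Φ y)) (fun v w hvw => ?_)
    (hloc.mfderivToContinuousLinearEquiv (by simp)).injective
  rw [← sub_eq_zero, ← norm_eq_zero, ← hι.norm_differential, map_sub, hvw, sub_self, norm_zero]

theorem IsNormalBall.edist_le [IsRiemannianManifold (𝓡 n) M] (hΦ : IsNormalBall Φ p R)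
    (hι : IsIsometricEmbedding n ι) {y h : E} {C : ℝ}
    (hmem : ∀ t ∈ Icc (0 : ℝ) 1, y + t • h ∈ Metric.ball 0 R)
    (hC : ∀ t ∈ Icc (0 : ℝ) 1, ‖fderiv ℝ (ι ∘ Φ) (y + t • h) h‖ ≤ C) :
    edist (Φ y) (Φ (y + h)) ≤ ENNReal.ofReal C := by
  have hline : ∀ t : ℝ, HasDerivAt (fun t : ℝ => y + t • h) h t := fun t => by
    simpa using ((hasDerivAt_id t).smul_const h).const_add y
  have h1 := edist_le_lintegral (c := fun t : ℝ => Φ (y + t • h)) hι zero_le_one fun t ht =>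
    ContMDiffAt.comp (g := Φ) t ((hΦ.contMDiffAt (hmem t ht)).of_le (by simp))
      (ContDiff.contMDiff (f := fun t : ℝ => y + t • h) (by fun_prop)).contMDiffAt
  simp only [zero_smul, add_zero, one_smul] at h1
  refine h1.trans ?_
  calc _ ≤ ∫⁻ _ in Icc (0 : ℝ) 1, ENNReal.ofReal C := by
        refine setLIntegral_mono' measurableSet_Icc fun t ht => ?_
        have h2 : HasDerivAt (ι ∘ fun t : ℝ => Φ (y + t • h))
            (fderiv ℝ (ι ∘ Φ) (y + t • h) h) t :=
          (hΦ.differentiableAt hι (hmem t ht)).hasFDerivAt.comp_hasDerivAt t (hline t)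
        rw [h2.deriv, ← ofReal_norm]
        exact ENNReal.ofReal_le_ofReal (hC t ht)
    _ = _ := by simp

/-- The norm is the distance to `p`, so the triangle inequality bounds its increment by the length
of the image of a short segment. -/
theorem IsNormalBall.eventually_norm_sub_le [IsRiemannianManifold (𝓡 n) M]
    (hΦ : IsNormalBall Φ p R) (hι : IsIsometricEmbedding n ι) {y : E}
    (hy : y ∈ Metric.ball 0 R) (h : E) {ε : ℝ} (hε : 0 < ε) :
    ∀ᶠ t : ℝ in 𝓝[>] 0, ‖y + t • h‖ - ‖y‖ ≤ t * (‖fderiv ℝ (ι ∘ Φ) y h‖ + ε) := by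
  have hcont : ContinuousAt (fun w => ‖fderiv ℝ (ι ∘ Φ) w h‖) y := by
    have h1 : ContinuousAt (fderiv ℝ (ι ∘ Φ)) y :=
      (ContDiffAt.fderiv_right (m := 0) (hΦ.contDiffAt hι hy) (by simp)).continuousAt
    exact (h1.clm_apply continuousAt_const).norm
  have h2 : ∀ᶠ w in 𝓝 y, w ∈ Metric.ball (0 : E) R ∧
      ‖fderiv ℝ (ι ∘ Φ) w h‖ < ‖fderiv ℝ (ι ∘ Φ) y h‖ + ε :=
    Filter.Eventually.and (Metric.isOpen_ball.mem_nhds hy) (hcont.eventually (gt_mem_nhds (by linarith)))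
  obtain ⟨r, hr, hball⟩ := Metric.eventually_nhds_iff.1 h2
  have h3 : ∀ᶠ t : ℝ in 𝓝[>] 0, t * ‖h‖ < r := by
    have : Tendsto (fun t : ℝ => t * ‖h‖) (𝓝[>] 0) (𝓝 0) := by
      refine Tendsto.mono_left ?_ nhdsWithin_le_nhds
      exact Continuous.tendsto' (by fun_prop) _ _ (by simp)
    exact this.eventually (gt_mem_nhds hr)
  filter_upwards [h3, self_mem_nhdsWithin] with t ht htpos
  have htpos' : 0 < t := htpos
  have hseg : ∀ τ ∈ Icc (0 : ℝ) 1, dist (y + τ • (t • h)) y < r := fun τ hτ => by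
    rw [dist_self_add_left, norm_smul, norm_smul, Real.norm_of_nonneg hτ.1,
      Real.norm_of_nonneg htpos'.le]
    exact (mul_le_of_le_one_left (by positivity) hτ.2).trans_lt ht
  have h4 := hΦ.edist_le hι (y := y) (h := t • h) (C := t * (‖fderiv ℝ (ι ∘ Φ) y h‖ + ε))
    (fun τ hτ => (hball (hseg τ hτ)).1) (fun τ hτ => by
      rw [map_smul, norm_smul, Real.norm_of_nonneg htpos'.le]
      exact mul_le_mul_of_nonneg_left (hball (hseg τ hτ)).2.le htpos'.le)
  have h5 : y + t • h ∈ Metric.ball 0 R := by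
    simpa using (hball (hseg 1 (by simp))).1
  have h6 := edist_triangle p (Φ y) (Φ (y + t • h))
  rw [hΦ.edist_eq _ hy, hΦ.edist_eq _ h5] at h6
  have h7 := h6.trans (add_le_add_right h4 _)
  rw [← ENNReal.ofReal_add (norm_nonneg _) (by positivity),
    ENNReal.ofReal_le_ofReal_iff (by positivity)] at h7
  linarith

/-- At the origin the norm is not differentiable, but its one-sided difference quotient in direction
`h` is exactly `‖h‖`. -/
theorem IsNormalBall.norm_le_fderiv_zero [IsRiemannianManifold (𝓡 n) M]
    (hΦ : IsNormalBall Φ p R) (hι : IsIsometricEmbedding n ι) (hR : 0 < R) (h : E) :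
    ‖h‖ ≤ ‖fderiv ℝ (ι ∘ Φ) 0 h‖ := by
  refine le_of_forall_pos_le_add fun ε hε => ?_
  obtain ⟨t, ht, htpos⟩ := ((hΦ.eventually_norm_sub_le hι (Metric.mem_ball_self hR) h hε).and
    self_mem_nhdsWithin).exists
  have htpos' : 0 < t := htpos
  rw [zero_add, norm_zero, sub_zero, norm_smul, Real.norm_of_nonneg htpos'.le] at ht
  exact le_of_mul_le_mul_left ht htpos'

/-- The infinitesimal form of the triangle inequality, obtained by differentiating the norm along `y
+ t • h`. No orthogonality statement is needed. -/
theorem IsNormalBall.inner_le_fderiv [IsRiemannianManifold (𝓡 n) M]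
    (hΦ : IsNormalBall Φ p R) (hι : IsIsometricEmbedding n ι) {y : E}
    (hy : y ∈ Metric.ball 0 R) (hy0 : y ≠ 0) (h : E) :
    inner ℝ (‖y‖⁻¹ • y) h ≤ ‖fderiv ℝ (ι ∘ Φ) y h‖ := by
  refine le_of_forall_pos_le_add fun ε hε => ?_
  have hpos : 0 < ‖y‖ := norm_pos_iff.2 hy0
  have hd : HasDerivAt (fun t : ℝ => ‖y + t • h‖) (inner ℝ (‖y‖⁻¹ • y) h) 0 := by
    have h1 : HasDerivAt (fun t : ℝ => y + t • h) h 0 := by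
      simpa using ((hasDerivAt_id (0 : ℝ)).smul_const h).const_add y
    have h2 := h1.norm_sq.sqrt (by simpa using hpos.ne')
    simp only [zero_smul, add_zero, Real.sqrt_sq (norm_nonneg _)] at h2
    convert h2 using 1
    rw [inner_smul_left, conj_trivial]
    field_simp
  have h3 := hd.tendsto_slope.mono_left (nhdsGT_le_nhdsNE 0)
  refine le_of_tendsto h3 ?_
  filter_upwards [hΦ.eventually_norm_sub_le hι hy h hε, self_mem_nhdsWithin] with t ht htpos
  have htpos' : 0 < t := htpos
  rw [slope_def_field, sub_zero, zero_smul, add_zero, div_le_iff₀ htpos', mul_comm]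
  exact ht

end NormalBall

/-! ### Comparison with the ambient distance; uniqueness of radial curves -/

section NormalBall

variable {n N : ℕ} {M : Type*} [EMetricSpace M]
  [ChartedSpace (EuclideanSpace ℝ (Fin n)) M]
  {E : Type*} [NormedAddCommGroup E] [InnerProductSpace ℝ E]
  {ι : M → Euc N} {Φ : PartialDiffeomorph 𝓘(ℝ, E) (𝓡 n) E M ∞} {p : M} {R : ℝ}

theorem IsNormalBall.symm_mem (hΦ : IsNormalBall Φ p R) {q : M}
    (hq : q ∈ Metric.eball p (ENNReal.ofReal R)) : Φ.symm q ∈ Metric.ball (0 : E) R := by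
  rw [← hΦ.source_eq]
  exact Φ.map_target (by rwa [hΦ.target_eq])

theorem IsNormalBall.apply_symm (hΦ : IsNormalBall Φ p R) {q : M}
    (hq : q ∈ Metric.eball p (ENNReal.ofReal R)) : Φ (Φ.symm q) = q :=
  Φ.right_inv (by rwa [hΦ.target_eq])

theorem IsNormalBall.norm_symm (hΦ : IsNormalBall Φ p R) {q : M}
    (hq : q ∈ Metric.eball p (ENNReal.ofReal R)) :
    ENNReal.ofReal ‖Φ.symm q‖ = edist p q := by
  rw [← hΦ.edist_eq _ (hΦ.symm_mem hq), hΦ.apply_symm hq]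

theorem IsNormalBall.contMDiffAt_symm (hΦ : IsNormalBall Φ p R) {q : M}
    (hq : q ∈ Metric.eball p (ENNReal.ofReal R)) :
    ContMDiffAt (𝓡 n) 𝓘(ℝ, E) ∞ Φ.symm q :=
  Φ.symm.contMDiffOn.contMDiffAt (Φ.open_target.mem_nhds (by rwa [hΦ.target_eq]))

theorem IsNormalBall.apply_zero (hΦ : IsNormalBall Φ p R) (hR : 0 < R) : Φ 0 = p := by
  have := hΦ.edist_eq 0 (Metric.mem_ball_self hR)
  rw [norm_zero, ENNReal.ofReal_zero, edist_eq_zero] at this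
  exact this.symm

variable [RiemannianBundle (fun x : M => TangentSpace (𝓡 n) x)] [IsRiemannianManifold (𝓡 n) M]

/-- Near `p` the Riemannian distance to `p` is almost the distance in the ambient space. -/
theorem IsNormalBall.eventually_edist_le (hΦ : IsNormalBall Φ p R)
    (hι : IsIsometricEmbedding n ι) (hR : 0 < R) {ε : ℝ} (hε : 0 < ε) :
    ∀ᶠ q in 𝓝 p, edist p q ≤ ENNReal.ofReal ((1 + ε) * ‖ι q - ι p‖) := by
  -- Chosen so that 1 - δ = 1/(1 + ε), which absorbs the linearization error.
  set δ := ε / (1 + ε) with hδ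
  have hδpos : 0 < δ := by positivity
  have hp : p ∈ Metric.eball p (ENNReal.ofReal R) := Metric.mem_eball_self (by simpa)
  have h0 : Φ.symm p = 0 := by
    have := hΦ.norm_symm hp
    rw [edist_self, ENNReal.ofReal_eq_zero] at this
    exact norm_le_zero_iff.1 this
  have hlim : Tendsto Φ.symm (𝓝 p) (𝓝 (0 : E)) := by
    have := (hΦ.contMDiffAt_symm hp).continuousAt.tendsto
    rwa [h0] at this
  have hd := (hΦ.differentiableAt hι (Metric.mem_ball_self hR)).hasFDerivAt
  have h1 := hlim.eventually ((hasFDerivAt_iff_isLittleO.1 hd).def hδpos)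
  have hball : ∀ᶠ q in 𝓝 p, q ∈ Metric.eball p (ENNReal.ofReal R) :=
    Metric.isOpen_eball.mem_nhds hp
  filter_upwards [h1, hball] with q hq hqR
  rw [← hΦ.norm_symm hqR]
  refine ENNReal.ofReal_le_ofReal ?_
  simp only [Function.comp_apply, hΦ.apply_symm hqR, hΦ.apply_zero hR, sub_zero] at hq
  set v := Φ.symm q
  have h2 := hΦ.norm_le_fderiv_zero hι hR v
  have h3 : ‖fderiv ℝ (ι ∘ Φ) 0 v‖ ≤ ‖ι q - ι p‖ + δ * ‖v‖ := by
    have h4 := norm_sub_norm_le (fderiv ℝ (ι ∘ Φ) 0 v) (ι q - ι p)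
    have h6 := norm_sub_rev (ι q - ι p) (fderiv ℝ (ι ∘ Φ) 0 v)
    have h5 : ‖ι q - ι p - fderiv ℝ (ι ∘ Φ) 0 v‖ ≤ δ * ‖v‖ := hq
    linarith
  have h6 : (1 - δ) * ‖v‖ ≤ ‖ι q - ι p‖ := by linarith
  have h7 : 1 - δ = 1 / (1 + ε) := by rw [hδ]; field_simp; ring
  rw [h7, div_mul_eq_mul_div, one_mul, div_le_iff₀ (by positivity)] at h6
  linarith

/-- Two unit speed curves along which the distance to `p` grows at unit rate coincide if they have
a common endpoint. -/
theorem IsNormalBall.eq_of_edist_eq [FiniteDimensional ℝ E] (hΦ : IsNormalBall Φ p R)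
    (hι : IsIsometricEmbedding n ι) {a b : ℝ} (ha : 0 < a) (hab : a ≤ b) (hb : b < R)
    {c e : ℝ → M} (hc : ContMDiff 𝓘(ℝ, ℝ) (𝓡 n) ∞ c) (he : ContMDiff 𝓘(ℝ, ℝ) (𝓡 n) ∞ e)
    (hc1 : ∀ s, ‖deriv (ι ∘ c) s‖ = 1) (he1 : ∀ s, ‖deriv (ι ∘ e) s‖ = 1)
    (hcd : ∀ s ∈ Icc a b, edist p (c s) = ENNReal.ofReal s)
    (hed : ∀ s ∈ Icc a b, edist p (e s) = ENNReal.ofReal s)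
    (hend : c b = e b) : c a = e a := by
  rcases hab.eq_or_lt with rfl | hlt
  · exact hend
  have main : ∀ c : ℝ → M, ContMDiff 𝓘(ℝ, ℝ) (𝓡 n) ∞ c → (∀ s, ‖deriv (ι ∘ c) s‖ = 1) →
      (∀ s ∈ Icc a b, edist p (c s) = ENNReal.ofReal s) → ∀ s ∈ Icc a b,
        c s ∈ Metric.eball p (ENNReal.ofReal R) ∧ ‖Φ.symm (c s)‖ = s ∧
        HasDerivAt (fun s => Φ.symm (c s)) (radialField (ι ∘ Φ) (Φ.symm (c s))) s := by
    intro c hc hc1 hcd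
    have hmem : ∀ s ∈ Icc a b, c s ∈ Metric.eball p (ENNReal.ofReal R) := fun s hs => by
      rw [Metric.mem_eball, edist_comm, hcd s hs]
      exact (ENNReal.ofReal_lt_ofReal_iff (by linarith)).2 (by linarith [hs.2])
    have hnorm : ∀ s ∈ Icc a b, ‖Φ.symm (c s)‖ = s := fun s hs => by
      have := hΦ.norm_symm (hmem s hs)
      rwa [hcd s hs, ENNReal.ofReal_eq_ofReal_iff (norm_nonneg _) (by linarith [hs.1])] at this
    intro s hs
    refine ⟨hmem s hs, hnorm s hs, ?_⟩
    have hyd : DifferentiableAt ℝ (fun s => Φ.symm (c s)) s :=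
      (((hΦ.contMDiffAt_symm (hmem s hs)).comp s hc.contMDiffAt).contDiffAt).differentiableAt
        (by simp)
    set y : ℝ → E := fun s => Φ.symm (c s) with hy
    have hys := hΦ.symm_mem (hmem s hs)
    have hspos : 0 < s := ha.trans_le hs.1
    have hy0 : y s ≠ 0 := norm_pos_iff.1 (by rw [hnorm s hs]; exact hspos)
    -- Differentiate ‖y s‖² = s². The identity is known only on `[a, b]`, whence the derivatives
    -- within that interval.
    have hu : inner ℝ (‖y s‖⁻¹ • y s) (deriv y s) = (1 : ℝ) := by
      have h1 := (hyd.hasDerivAt.norm_sq).hasDerivWithinAt (s := Icc a b)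
      have h2 : HasDerivWithinAt (fun s : ℝ => s ^ 2) (2 * s) (Icc a b) s := by
        simpa using (hasDerivAt_pow 2 s).hasDerivWithinAt
      have h3 := (uniqueDiffOn_Icc hlt s hs).eq_deriv (Icc a b)
        (h1.congr (fun x hx => (congrArg (· ^ 2) (hnorm x hx)).symm)
          (congrArg (· ^ 2) (hnorm s hs)).symm) h2
      rw [inner_smul_left, conj_trivial, hnorm s hs]
      field_simp
      linarith
    have hcomp : HasDerivAt (ι ∘ c) (fderiv ℝ (ι ∘ Φ) (y s) (deriv y s)) s := by
      have h1 : HasDerivAt ((ι ∘ Φ) ∘ y) (fderiv ℝ (ι ∘ Φ) (y s) (deriv y s)) s :=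
        (hΦ.differentiableAt hι hys).hasFDerivAt.comp_hasDerivAt s hyd.hasDerivAt
      refine h1.congr_of_eventuallyEq ?_
      have h2 : ∀ᶠ x in 𝓝 s, c x ∈ Metric.eball p (ENNReal.ofReal R) :=
        hc.continuous.continuousAt.eventually (Metric.isOpen_eball.mem_nhds (hmem s hs))
      filter_upwards [h2] with x hx
      simp only [Function.comp_apply, hy, hΦ.apply_symm hx]
    have := eq_radialField (hΦ.injective_fderiv hι hys) (hΦ.inner_le_fderiv hι hys hy0)
      (by rw [← hcomp.deriv]; exact hc1 s) hu
    rw [← this]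
    exact hyd.hasDerivAt
  have Hc := main c hc hc1 hcd
  have He := main e he he1 hed
  set yc : ℝ → E := fun s => Φ.symm (c s)
  set ye : ℝ → E := fun s => Φ.symm (e s)
  have hycc : ContinuousOn yc (Icc a b) := fun s hs => (Hc s hs).2.2.continuousAt.continuousWithinAt
  have hyec : ContinuousOn ye (Icc a b) := fun s hs => (He s hs).2.2.continuousAt.continuousWithinAt
  set K : Set E := yc '' Icc a b ∪ ye '' Icc a b with hK
  have hKc : IsCompact K := (isCompact_Icc.image_of_continuousOn hycc).union
    (isCompact_Icc.image_of_continuousOn hyec)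
  -- The radial field is C¹ away from the origin, and the two traces avoid the origin since `0 < a`.
  -- Compactness yields the single Lipschitz constant required by ODE uniqueness.
  have hlip : LocallyLipschitzOn K (radialField (ι ∘ Φ)) := by
    intro y hyK
    have hy : y ∈ Metric.ball (0 : E) R ∧ y ≠ 0 := by
      rcases hyK with ⟨s, hs, rfl⟩ | ⟨s, hs, rfl⟩
      · exact ⟨hΦ.symm_mem (Hc s hs).1, norm_pos_iff.1 (by
          rw [(Hc s hs).2.1]; exact ha.trans_le hs.1)⟩
      · exact ⟨hΦ.symm_mem (He s hs).1, norm_pos_iff.1 (by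
          rw [(He s hs).2.1]; exact ha.trans_le hs.1)⟩
    obtain ⟨L, t, ht, hL⟩ := (contDiffAt_radialField (hΦ.contDiffAt hι hy.1)
      (hΦ.injective_fderiv hι hy.1) hy.2).exists_lipschitzOnWith
    exact ⟨L, t, mem_nhdsWithin_of_mem_nhds ht, hL⟩
  obtain ⟨L, hL⟩ := hlip.exists_lipschitzOnWith_of_compact hKc
  -- The common value is at the right end, so uniqueness is used backwards in time.
  have heq := ODE_solution_unique_of_mem_Icc_left (v := fun _ => radialField (ι ∘ Φ))
    (s := fun _ => K) (K := L) (f := yc) (g := ye) (a := a) (b := b) (fun _ _ => hL) hycc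
    (fun t ht => (Hc t ⟨ht.1.le, ht.2⟩).2.2.hasDerivWithinAt)
    (fun t ht => Or.inl ⟨t, ⟨ht.1.le, ht.2⟩, rfl⟩) hyec
    (fun t ht => (He t ⟨ht.1.le, ht.2⟩).2.2.hasDerivWithinAt)
    (fun t ht => Or.inr ⟨t, ⟨ht.1.le, ht.2⟩, rfl⟩) (by simp only [yc, ye, hend])
  have h1 : Φ.symm (c a) = Φ.symm (e a) := heq (left_mem_Icc.2 hab)
  rw [← hΦ.apply_symm (Hc a (left_mem_Icc.2 hab)).1, h1,
    hΦ.apply_symm (He a (left_mem_Icc.2 hab)).1]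

end NormalBall

/-! ### From the injectivity radius to normal balls and geodesics -/

section NormalRadius

variable {n N : ℕ} {M : Type*} [EMetricSpace M]
  [ChartedSpace (EuclideanSpace ℝ (Fin n)) M]
  [RiemannianBundle (fun x : M => TangentSpace (𝓡 n) x)]
  {ι : M → Euc N} {p : M} {R : ℝ}

instance (p : M) : FiniteDimensional ℝ (TangentSpace (𝓡 n) p) :=
  inferInstanceAs (FiniteDimensional ℝ (EuclideanSpace ℝ (Fin n)))

theorem isNormalRadius_of_le_injectivityRadius {R : ℝ≥0∞} (h : R ≤ injectivityRadius n ι) (p : M)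
    {r : ℝ≥0∞} (hr : r < R) : IsNormalRadius n ι p r := by
  have h1 : r < sSup {r | ∀ r' ≤ r, IsNormalRadius n ι p r'} :=
    hr.trans_le (h.trans (iInf_le _ p))
  obtain ⟨r₁, hr₁, hlt⟩ := lt_sSup_iff.1 h1
  exact hr₁ r hlt.le

/-- Since exp maps the tangent ball onto the metric ball for every radius r up to `R`, and is
injective on the largest one, dist(p, exp v) < r exactly when ‖v‖ < r. Comparing all such r gives
equality. -/
theorem exists_isNormalBall (h : ∀ r ≤ ENNReal.ofReal R, IsNormalRadius n ι p r) :
    ∃ Φ : PartialDiffeomorph 𝓘(ℝ, TangentSpace (𝓡 n) p) (𝓡 n) (TangentSpace (𝓡 n) p) M ∞,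
      IsNormalBall Φ p R ∧ EqOn Φ (expMap (n := n) ι p) (Metric.ball 0 R) := by
  obtain ⟨Φ, hs, ht, hexp⟩ := h _ le_rfl
  have hball : ∀ v : TangentSpace (𝓡 n) p, v ∈ Metric.eball 0 (ENNReal.ofReal R) ↔
      v ∈ Metric.ball 0 R := fun v => by rw [Metric.eball_ofReal]
  have hinj : InjOn (expMap (n := n) ι p) (Metric.eball 0 (ENNReal.ofReal R)) := by
    rw [← hs]
    exact Φ.injOn.congr hexp
  refine ⟨Φ, ⟨by rw [hs, Metric.eball_ofReal], ht, fun v hv => ?_⟩, fun v hv => hexp (by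
    rw [hs]; exact (hball v).2 hv)⟩
  have hv' := (hball v).2 hv
  have hΦv : Φ v = expMap (n := n) ι p v := hexp (by rwa [hs])
  have key : ∀ r ≤ ENNReal.ofReal R, edist p (Φ v) < r ↔ ENNReal.ofReal ‖v‖ < r := by
    intro r hr
    obtain ⟨Φ', hs', ht', hexp'⟩ := h r hr
    have hv0 : ENNReal.ofReal ‖v‖ < r ↔ v ∈ Φ'.source := by
      rw [hs', Metric.mem_eball, edist_zero_right, ofReal_norm]
    have hp0 : edist p (Φ v) < r ↔ expMap (n := n) ι p v ∈ Φ'.target := by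
      rw [ht', Metric.mem_eball, edist_comm, hΦv]
    rw [hv0, hp0]
    constructor
    · intro hmem
      have hw := Φ'.map_target hmem
      have hw2 : Φ' (Φ'.invFun (expMap (n := n) ι p v)) = expMap (n := n) ι p v := Φ'.right_inv hmem
      have hw3 := (hexp' hw).symm.trans hw2
      have hw' : Φ'.symm (expMap (n := n) ι p v) ∈ Metric.eball 0 (ENNReal.ofReal R) := by
        have : Φ'.invFun (expMap (n := n) ι p v) ∈ Metric.eball 0 r := by rw [← hs']; exact hw
        exact Metric.eball_subset_eball hr this
      have := hinj hw' hv' hw3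
      rw [← this]; exact hw
    · intro hmem
      rw [← hexp' hmem]
      exact Φ'.map_source hmem
  have h1 : edist p (Φ v) < ENNReal.ofReal R := by
    rw [key _ le_rfl]
    rwa [Metric.mem_eball, edist_zero_right, ← ofReal_norm] at hv'
  have h2 : ENNReal.ofReal ‖v‖ < ENNReal.ofReal R := (key _ le_rfl).1 h1
  refine le_antisymm ?_ ?_
  · by_contra! hlt
    exact lt_irrefl _ ((key _ h1.le).2 hlt)
  · by_contra! hlt
    exact lt_irrefl _ ((key _ h2.le).1 hlt)

/-- The delicate point is that `expMap` takes the default value `p` when no geodesic exists on the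
whole line; injectivity on the ball rules this out. -/
theorem exists_geodesic_of_isNormalRadius (h : ∀ r ≤ ENNReal.ofReal R, IsNormalRadius n ι p r)
    {q : M} (hq : edist p q < ENNReal.ofReal R) (hι : IsIsometricEmbedding n ι) :
    ∃ c : ℝ → M, IsGeodesic n ι c ∧ c 0 = p ∧ c 1 = q ∧
      ENNReal.ofReal ‖deriv (ι ∘ c) 0‖ = edist p q := by
  obtain ⟨Φ, hΦ, hexp⟩ := exists_isNormalBall h
  have hqm : q ∈ Metric.eball p (ENNReal.ofReal R) := by rwa [Metric.mem_eball, edist_comm]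
  set v := Φ.symm q
  have hv := hΦ.symm_mem hqm
  have hinj : InjOn (expMap (n := n) ι p) (Metric.ball 0 R) := by
    have := Φ.injOn
    rw [hΦ.source_eq] at this
    exact this.congr hexp
  have hR : 0 < R := by
    rw [Metric.mem_ball] at hv; exact dist_nonneg.trans_lt hv
  have hexists : ∃ c : ℝ → M, IsGeodesic n ι c ∧ c 0 = p ∧
      deriv (ι ∘ c) 0 = differential ι p v := by
    by_contra hno
    -- If `v` had no geodesic, neither would `v/2`, by running at double speed. Both would be sent
    -- to `p`, forcing `v = 0`, for which the constant geodesic exists.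
    have hno' : ¬ ∃ c : ℝ → M, IsGeodesic n ι c ∧ c 0 = p ∧
        deriv (ι ∘ c) 0 = differential ι p ((2⁻¹ : ℝ) • v) := by
      rintro ⟨c, hc, hc0, hcd⟩
      refine hno ⟨_, hc.comp_affine 2 0, by simpa using hc0, ?_⟩
      have := deriv_comp_affine (ι ∘ c) 2 0 0
      simp only [mul_zero, add_zero] at this
      simp only [add_zero]
      refine this.trans ?_
      rw [hcd, map_smul, smul_smul]
      norm_num
    have e1 : expMap (n := n) ι p v = p := dif_neg hno
    have e2 : expMap (n := n) ι p ((2⁻¹ : ℝ) • v) = p := dif_neg hno'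
    have hv2 : (2⁻¹ : ℝ) • v ∈ Metric.ball (0 : TangentSpace (𝓡 n) p) R := by
      rw [mem_ball_zero_iff] at hv ⊢
      rw [norm_smul]
      norm_num
      linarith [norm_nonneg v]
    have e3 := hinj hv2 hv (e2.trans e1.symm)
    have hv0 : v = 0 := by
      have h1 : ‖(2⁻¹ : ℝ) • v‖ = ‖v‖ := by rw [e3]
      rw [norm_smul] at h1
      norm_num at h1
      exact norm_eq_zero.1 (by linarith)
    refine hno ⟨fun _ => p, isGeodesic_const ι p, rfl, ?_⟩
    rw [hv0, map_zero]
    exact deriv_const _ (ι p)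
  have hspec := hexists.choose_spec
  refine ⟨hexists.choose, hspec.1, hspec.2.1, ?_, ?_⟩
  · have : expMap (n := n) ι p v = hexists.choose 1 := dif_pos hexists
    rw [← this, ← hexp hv]
    exact hΦ.apply_symm hqm
  · rw [hspec.2.2, hι.norm_differential]
    exact hΦ.norm_symm hqm

end NormalRadius

/-- Slack in either upper bound would contradict the triangle inequality. -/
theorem edist_eq_of_edist_le {X : Type*} [PseudoEMetricSpace X] {p q z : X} {s t : ℝ}
    (hs : 0 ≤ s) (ht : 0 ≤ t) (hpq : ENNReal.ofReal (s + t) ≤ edist p q)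
    (hpz : edist p z ≤ ENNReal.ofReal s) (hzq : edist z q ≤ ENNReal.ofReal t) :
    edist p z = ENNReal.ofReal s ∧ edist z q = ENNReal.ofReal t := by
  have h := hpq.trans (edist_triangle p z q)
  rw [ENNReal.ofReal_add hs ht] at h
  refine ⟨le_antisymm hpz ?_, le_antisymm hzq ?_⟩
  · have h1 := h.trans (add_le_add_right hzq _)
    exact (ENNReal.add_le_add_iff_right ENNReal.ofReal_ne_top).1 h1
  · have h1 := h.trans (add_le_add_left hpz _)
    exact (ENNReal.add_le_add_iff_left ENNReal.ofReal_ne_top).1 h1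

/-! ### Uniqueness and continuity of shortest geodesics -/

section Geodesics

variable {n N : ℕ} {M : Type*} [EMetricSpace M]
  [ChartedSpace (EuclideanSpace ℝ (Fin n)) M]
  [RiemannianBundle (fun x : M => TangentSpace (𝓡 n) x)]
  {ι : M → Euc N} {R : ℝ}

variable (n) in
/-- Every ball of radius at most `R` is a normal ball. -/
def HasNormalRadius (ι : M → Euc N) (R : ℝ) : Prop :=
  ∀ (p : M), ∀ r ≤ ENNReal.ofReal R, IsNormalRadius n ι p r

variable (n) in
/-- `c` is a shortest geodesic from `p` to `q`, with parameter interval `[0, 1]`. -/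
structure IsMinimizing (ι : M → Euc N) (c : ℝ → M) (p q : M) : Prop where
  isGeodesic : IsGeodesic n ι c
  zero : c 0 = p
  one : c 1 = q
  speed : ENNReal.ofReal ‖deriv (ι ∘ c) 0‖ = edist p q

theorem HasNormalRadius.exists_isMinimizing (hR : HasNormalRadius n ι R)
    (hι : IsIsometricEmbedding n ι) {p q : M} (hpq : edist p q < ENNReal.ofReal R) :
    ∃ c, IsMinimizing n ι c p q := by
  obtain ⟨c, h1, h2, h3, h4⟩ := exists_geodesic_of_isNormalRadius (hR p) hpq hι
  exact ⟨c, h1, h2, h3, h4⟩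

omit [RiemannianBundle (fun x : M => TangentSpace (𝓡 n) x)] in
theorem IsMinimizing.speed_eq {c : ℝ → M} {p q : M} (hc : IsMinimizing n ι c p q) :
    ‖deriv (ι ∘ c) 0‖ = (edist p q).toReal := by
  rw [← hc.speed, ENNReal.toReal_ofReal (norm_nonneg _)]

variable [IsRiemannianManifold (𝓡 n) M]

theorem IsMinimizing.edist_eq {c : ℝ → M} {p q : M} (hc : IsMinimizing n ι c p q)
    (hι : IsIsometricEmbedding n ι) {θ : ℝ} (hθ : θ ∈ Icc (0 : ℝ) 1) :
    edist p (c θ) = ENNReal.ofReal (θ * (edist p q).toReal) ∧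
      edist (c θ) q = ENNReal.ofReal ((1 - θ) * (edist p q).toReal) := by
  have h0 : 0 ≤ (edist p q).toReal := ENNReal.toReal_nonneg
  refine edist_eq_of_edist_le (mul_nonneg hθ.1 h0)
    (mul_nonneg (by linarith [hθ.2]) h0) ?_ ?_ ?_
  · rw [← hc.speed_eq, ← hc.speed]
    exact ENNReal.ofReal_le_ofReal (by linarith)
  · have := hc.isGeodesic.edist_le hι hθ.1
    rwa [hc.zero, sub_zero, hc.speed_eq] at this
  · have := hc.isGeodesic.edist_le hι hθ.2
    rwa [hc.one, hc.speed_eq] at this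

/-- A point between `p` and `q` lies on every shortest geodesic from `p` to `q`. -/
theorem HasNormalRadius.eq_of_edist_le (hR : HasNormalRadius n ι R)
    (hι : IsIsometricEmbedding n ι) {p q z : M} (hpq : edist p q < ENNReal.ofReal R)
    {c : ℝ → M} (hc : IsMinimizing n ι c p q) {θ : ℝ} (hθ : θ ∈ Icc (0 : ℝ) 1)
    (hpz : edist p z ≤ ENNReal.ofReal (θ * (edist p q).toReal))
    (hzq : edist z q ≤ ENNReal.ofReal ((1 - θ) * (edist p q).toReal)) : z = c θ := by
  set d := (edist p q).toReal with hd
  have hfin : edist p q ≠ ⊤ := ne_top_of_lt hpq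
  have hde : edist p q = ENNReal.ofReal d := (ENNReal.ofReal_toReal hfin).symm
  have hd0 : 0 ≤ d := ENNReal.toReal_nonneg
  have hcθ := hc.edist_eq hι hθ
  rw [← hd] at hcθ
  obtain ⟨hpz', hzq'⟩ := edist_eq_of_edist_le (mul_nonneg hθ.1 hd0)
    (mul_nonneg (by linarith [hθ.2]) hd0) (by rw [hde]; exact ENNReal.ofReal_le_ofReal (by linarith))
    hpz hzq
  rcases (mul_nonneg hθ.1 hd0).eq_or_lt with h0 | hpos
  · rw [← h0, ENNReal.ofReal_zero, edist_eq_zero] at hpz'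
    rw [← h0, ENNReal.ofReal_zero, edist_eq_zero] at hcθ
    rw [← hpz', ← hcθ.1]
  have hdpos : 0 < d := by
    rcases hd0.eq_or_lt with h | h
    · rw [← h, mul_zero] at hpos; exact absurd hpos (lt_irrefl _)
    · exact h
  have hθpos : 0 < θ := by
    rcases hθ.1.eq_or_lt with h | h
    · rw [← h, zero_mul] at hpos; exact absurd hpos (lt_irrefl _)
    · exact h
  rcases hθ.2.eq_or_lt with h1 | h1
  · rw [h1, sub_self, zero_mul, ENNReal.ofReal_zero, edist_eq_zero] at hzq'
    rw [hzq', h1, hc.one]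
  have hRd : d < R := by
    rw [hde] at hpq
    exact (ENNReal.ofReal_lt_ofReal_iff_of_nonneg hd0).1 hpq
  have hzqR : edist z q < ENNReal.ofReal R := by
    rw [hzq']
    exact (ENNReal.ofReal_lt_ofReal_iff (by linarith)).2 (by nlinarith)
  -- A shortest geodesic from `z` to `q` prolongs a shortest path from `p` to `z`. Parametrized so
  -- that it is at `z` at time θd and at `q` at time d, it recedes from `p` at unit rate, just like
  -- `c`.
  obtain ⟨e, he⟩ := hR.exists_isMinimizing hι hzqR
  set ℓ := (1 - θ) * d with hℓ
  have hℓpos : 0 < ℓ := mul_pos (by linarith) hdpos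
  have hzqr : (edist z q).toReal = ℓ := by rw [hzq', ENNReal.toReal_ofReal hℓpos.le]
  obtain ⟨Φ, hΦ, -⟩ := exists_isNormalBall (hR p)
  have hunit : ∀ (g : ℝ → M) (hg : IsGeodesic n ι g) (l b : ℝ), 0 < l →
      ‖deriv (ι ∘ g) 0‖ = l → ∀ s, ‖deriv (ι ∘ fun s => g (l⁻¹ * s + b)) s‖ = 1 := by
    intro g hg l b hl hgl s
    have := deriv_comp_affine (ι ∘ g) l⁻¹ b s
    have h2 : deriv (ι ∘ fun s => g (l⁻¹ * s + b)) s = l⁻¹ • deriv (ι ∘ g) (l⁻¹ * s + b) := this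
    rw [h2, norm_smul, hg.norm_deriv_eq hι _ 0, hgl, norm_inv, Real.norm_of_nonneg hl.le]
    exact inv_mul_cancel₀ hl.ne'
  have hcd : ∀ s ∈ Icc (θ * d) d, edist p (c (d⁻¹ * s + 0)) = ENNReal.ofReal s := by
    intro s hs
    have hmem : d⁻¹ * s + 0 ∈ Icc (0 : ℝ) 1 := by
      rw [add_zero, inv_mul_eq_div]
      exact ⟨div_nonneg (hpos.le.trans hs.1) hd0, (div_le_one hdpos).2 hs.2⟩
    rw [(hc.edist_eq hι hmem).1, ← hd, add_zero]
    congr 1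
    field_simp
  have hed : ∀ s ∈ Icc (θ * d) d,
      edist p (e (ℓ⁻¹ * s + (1 - ℓ⁻¹ * d))) = ENNReal.ofReal s := by
    intro s hs
    have hmem : ℓ⁻¹ * s + (1 - ℓ⁻¹ * d) ∈ Icc (0 : ℝ) 1 := by
      have e1 : ℓ⁻¹ * s + (1 - ℓ⁻¹ * d) = 1 - (d - s) / ℓ := by field_simp; ring
      rw [e1]
      have h2 : (d - s) / ℓ ≤ 1 := (div_le_one hℓpos).2 (by rw [hℓ]; linarith [hs.1])
      have h3 : 0 ≤ (d - s) / ℓ := div_nonneg (by linarith [hs.2]) hℓpos.le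
      exact ⟨by linarith, by linarith⟩
    obtain ⟨e1, e2⟩ := he.edist_eq hι hmem
    rw [hzqr] at e1 e2
    refine (edist_eq_of_edist_le (q := q) (t := d - s) (hpos.le.trans hs.1) (by linarith [hs.2])
      (by rw [hde]; exact ENNReal.ofReal_le_ofReal (by linarith)) ?_ ?_).1
    · refine (edist_triangle p z _).trans ?_
      rw [hpz', e1, ← ENNReal.ofReal_add hpos.le (mul_nonneg hmem.1 hℓpos.le)]
      refine ENNReal.ofReal_le_ofReal (le_of_eq ?_)
      field_simp
      rw [hℓ]; ring
    · rw [e2]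
      refine ENNReal.ofReal_le_ofReal (le_of_eq ?_)
      field_simp
      ring
  -- Both curves reach `q` at time `d`, so they already agree at time θd.
  have hfinal := hΦ.eq_of_edist_eq hι hpos (by nlinarith) hRd
    (hc.isGeodesic.comp_affine d⁻¹ 0).1 (he.isGeodesic.comp_affine ℓ⁻¹ (1 - ℓ⁻¹ * d)).1
    (hunit c hc.isGeodesic d 0 hdpos (hc.speed_eq))
    (hunit e he.isGeodesic ℓ (1 - ℓ⁻¹ * d) hℓpos (by rw [he.speed_eq, hzqr])) hcd hed (by
      have e1 : d⁻¹ * d + 0 = 1 := by field_simp; ring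
      have e2 : ℓ⁻¹ * d + (1 - ℓ⁻¹ * d) = 1 := by ring
      simp only [e1, e2, hc.one, he.one])
  have e1 : d⁻¹ * (θ * d) + 0 = θ := by field_simp; ring
  have e2 : ℓ⁻¹ * (θ * d) + (1 - ℓ⁻¹ * d) = 0 := by
    field_simp
    rw [hℓ]; ring
  simp only [e1, e2, he.zero] at hfinal
  exact hfinal.symm

open scoped Classical in
variable (n) in
/-- The shortest geodesic from `p` to `q`, with parameter interval `[0, 1]`. -/
noncomputable def geo (ι : M → Euc N) (p q : M) : ℝ → M :=
  if h : ∃ c, IsMinimizing n ι c p q then h.choose else fun _ => p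

omit [IsRiemannianManifold (𝓡 n) M] in
theorem HasNormalRadius.isMinimizing_geo (hR : HasNormalRadius n ι R)
    (hι : IsIsometricEmbedding n ι) {p q : M} (hpq : edist p q < ENNReal.ofReal R) :
    IsMinimizing n ι (geo n ι p q) p q := by
  have h := hR.exists_isMinimizing hι hpq
  rw [geo, dif_pos h]
  exact h.choose_spec

theorem HasNormalRadius.geo_self (hR : HasNormalRadius n ι R)
    (hι : IsIsometricEmbedding n ι) (hRpos : 0 < R) (p : M) {θ : ℝ} (hθ : θ ∈ Icc (0 : ℝ) 1) :
    geo n ι p p θ = p := by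
  have h := ((hR.isMinimizing_geo (p := p) (q := p) hι (by simpa using hRpos)).edist_eq hι hθ).1
  rw [edist_self, ENNReal.toReal_zero, mul_zero, ENNReal.ofReal_zero, edist_eq_zero] at h
  exact h.symm

/-- In a compact space it suffices to identify cluster points. The two distance bounds that
characterize the point at fraction θ are closed conditions, so a cluster point satisfies them and
uniqueness applies. -/
theorem HasNormalRadius.continuousOn_geo [CompactSpace M] (hR : HasNormalRadius n ι R)
    (hι : IsIsometricEmbedding n ι) :
    ContinuousOn (fun x : (M × M) × ℝ => geo n ι x.1.1 x.1.2 x.2)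
      {x | edist x.1.1 x.1.2 < ENNReal.ofReal R ∧ x.2 ∈ Icc (0 : ℝ) 1} := by
  rintro ⟨⟨p, q⟩, θ⟩ ⟨hpq, hθ⟩
  refine isCompact_univ.tendsto_nhds_of_unique_mapClusterPt (by simp) fun z _ hz => ?_
  obtain ⟨U, hU, hUz⟩ := mapClusterPt_iff_ultrafilter.1 hz
  have hUn : (U : Filter ((M × M) × ℝ)) ≤ 𝓝 ((p, q), θ) := hU.trans nhdsWithin_le_nhds
  have hUS : ∀ᶠ x in (U : Filter ((M × M) × ℝ)),
      edist x.1.1 x.1.2 < ENNReal.ofReal R ∧ x.2 ∈ Icc (0 : ℝ) 1 := hU self_mem_nhdsWithin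
  have h1 : Tendsto (fun x : (M × M) × ℝ => x.1.1) U (𝓝 p) :=
    Tendsto.mono_left (Continuous.tendsto' (by fun_prop) _ _ rfl) hUn
  have h2 : Tendsto (fun x : (M × M) × ℝ => x.1.2) U (𝓝 q) :=
    Tendsto.mono_left (Continuous.tendsto' (by fun_prop) _ _ rfl) hUn
  have h3 : Tendsto (fun x : (M × M) × ℝ => x.2) U (𝓝 θ) :=
    Tendsto.mono_left (Continuous.tendsto' (by fun_prop) _ _ rfl) hUn
  have h4 : Tendsto (fun x : (M × M) × ℝ => (edist x.1.1 x.1.2).toReal) U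
      (𝓝 (edist p q).toReal) :=
    (ENNReal.tendsto_toReal (ne_top_of_lt hpq)).comp (h1.edist h2)
  refine hR.eq_of_edist_le hι hpq (hR.isMinimizing_geo hι hpq) hθ ?_ ?_
  · refine le_of_tendsto_of_tendsto (h1.edist hUz) (ENNReal.tendsto_ofReal (h3.mul h4)) ?_
    filter_upwards [hUS] with x hx
    exact (((hR.isMinimizing_geo hι hx.1).edist_eq hι hx.2).1).le
  · refine le_of_tendsto_of_tendsto (hUz.edist h2)
      (ENNReal.tendsto_ofReal ((h3.const_sub 1).mul h4)) ?_
    filter_upwards [hUS] with x hx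
    exact (((hR.isMinimizing_geo hι hx.1).edist_eq hι hx.2).2).le

/-- On `[a, b]` the shortest geodesics are exactly the curves given by `geo`. -/
theorem HasNormalRadius.isShortestGeodesicOn_iff (hR : HasNormalRadius n ι R)
    (hι : IsIsometricEmbedding n ι) {β : ℝ → M} {a b : ℝ} (hab : a < b)
    (hβ : edist (β a) (β b) < ENNReal.ofReal R) :
    IsShortestGeodesicOn n ι β a b ↔
      ∀ x ∈ Icc a b, β x = geo n ι (β a) (β b) ((x - a) / (b - a)) := by
  have hpos : 0 < b - a := by linarith
  have hg := hR.isMinimizing_geo hι hβ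
  constructor
  · rintro ⟨c, hc, heq, hlen⟩ x hx
    have ha := heq (left_mem_Icc.2 hab.le)
    have hb := heq (right_mem_Icc.2 hab.le)
    have hmin : IsMinimizing n ι (fun s => c ((b - a) * s + a)) (β a) (β b) := by
      refine ⟨hc.comp_affine _ _, by simp [ha], by simp [hb], ?_⟩
      have h1 : deriv (ι ∘ fun s => c ((b - a) * s + a)) 0 =
        (b - a) • deriv (ι ∘ c) ((b - a) * 0 + a) := deriv_comp_affine (ι ∘ c) (b - a) a 0
      rw [h1, norm_smul, Real.norm_of_nonneg hpos.le, hc.norm_deriv_eq hι _ 0,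
        ← hc.pathELength_eq hι hab.le, hlen, ha, hb]
    have hθ : (x - a) / (b - a) ∈ Icc (0 : ℝ) 1 :=
      ⟨div_nonneg (by linarith [hx.1]) hpos.le, (div_le_one hpos).2 (by linarith [hx.2])⟩
    have hd := hmin.edist_eq hι hθ
    have h2 := hR.eq_of_edist_le hι hβ hg hθ hd.1.le hd.2.le
    rw [heq hx, ← h2]
    congr 1
    field_simp
    ring
  · intro h
    refine ⟨fun s => geo n ι (β a) (β b) ((b - a)⁻¹ * s + -((b - a)⁻¹ * a)),
      hg.isGeodesic.comp_affine _ _, fun x hx => ?_, ?_⟩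
    · rw [h x hx]
      congr 1
      field_simp
      ring
    · rw [(hg.isGeodesic.comp_affine _ _).pathELength_eq hι hab.le]
      have h1 : deriv (ι ∘ fun s => geo n ι (β a) (β b) ((b - a)⁻¹ * s + -((b - a)⁻¹ * a))) 0 =
        (b - a)⁻¹ • deriv (ι ∘ geo n ι (β a) (β b)) ((b - a)⁻¹ * 0 + -((b - a)⁻¹ * a)) :=
        deriv_comp_affine (ι ∘ geo n ι (β a) (β b)) _ _ 0
      rw [h1, norm_smul, norm_inv, Real.norm_of_nonneg hpos.le, ← mul_assoc,
        mul_inv_cancel₀ hpos.ne', one_mul, hg.isGeodesic.norm_deriv_eq hι _ 0, hg.speed]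
      have e1 : (b - a)⁻¹ * a + -((b - a)⁻¹ * a) = 0 := by ring
      have e2 : (b - a)⁻¹ * b + -((b - a)⁻¹ * a) = 1 := by field_simp; ring
      simp only [e1, e2, hg.zero, hg.one]

/-- The Riemannian distance of the endpoints of a curve is at most its length. -/
theorem HasNormalRadius.edist_le_integral (hR : HasNormalRadius n ι R)
    (hι : IsIsometricEmbedding n ι) (hRpos : 0 < R) {σ : ℝ → M} {v : ℝ → ℝ}
    (h : SpeedBound (ι ∘ σ) v) {a b : ℝ} (hab : a ≤ b) :
    edist (σ a) (σ b) ≤ ENNReal.ofReal (∫ x in a..b, v x) := by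
  have hσ : Continuous σ := hι.isEmbedding.continuous_iff.2 h.continuous
  set K : ℝ → ℝ := fun x => ∫ z in a..x, v z with hK
  have hKc : Continuous K := intervalIntegral.continuous_primitive h.intervalIntegrable a
  have hKsub : ∀ x y, K y - K x = ∫ z in x..y, v z := fun x y =>
    intervalIntegral.integral_interval_sub_left (h.intervalIntegrable _ _)
      (h.intervalIntegrable _ _)
  have hK0 : K a = 0 := intervalIntegral.integral_same
  have hKnn : ∀ x, a ≤ x → 0 ≤ K x := fun x hx => (norm_nonneg _).trans (h.norm_sub_le a x hx)
  have main : ∀ ε > 0, edist (σ a) (σ b) ≤ ENNReal.ofReal ((1 + ε) * K b) := by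
    intro ε hε
    -- Continuous induction along `[a, b]`: the set is closed, and the local comparison of intrinsic
    -- and ambient distance lets one advance past any of its points.
    set s : Set ℝ := {x | edist (σ a) (σ x) ≤ ENNReal.ofReal ((1 + ε) * K x)} with hs
    have hclosed : IsClosed (s ∩ Icc a b) :=
      (isClosed_le (by fun_prop) (ENNReal.continuous_ofReal.comp (by fun_prop))).inter isClosed_Icc
    refine hclosed.Icc_subset_of_forall_exists_gt (by simp [hs]) (fun x hx y hy => ?_)
      (right_mem_Icc.2 hab)
    obtain ⟨Φ, hΦ, -⟩ := exists_isNormalBall (hR (σ x))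
    have hev := (hσ.tendsto x).eventually (hΦ.eventually_edist_le hι hRpos hε)
    have hy' : x < y := hy
    obtain ⟨z, hz1, hz2⟩ := ((hev.filter_mono nhdsWithin_le_nhds).and
      (Ioc_mem_nhdsGT hy')).exists
    refine ⟨z, ?_, hz2⟩
    refine (edist_triangle (σ a) (σ x) (σ z)).trans ?_
    have hxs : edist (σ a) (σ x) ≤ ENNReal.ofReal ((1 + ε) * K x) := hx.1
    refine (add_le_add hxs hz1).trans ?_
    rw [← ENNReal.ofReal_add (mul_nonneg (by positivity) (hKnn x hx.2.1)) (by positivity),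
      ← mul_add]
    refine ENNReal.ofReal_le_ofReal (mul_le_mul_of_nonneg_left ?_ (by positivity))
    have := h.norm_sub_le x z hz2.1.le
    rw [← hKsub] at this
    simp only [Function.comp_apply] at this
    linarith
  have hlim : Tendsto (fun ε : ℝ => ENNReal.ofReal ((1 + ε) * K b)) (𝓝[>] 0)
      (𝓝 (ENNReal.ofReal (K b))) := by
    refine Tendsto.mono_left ?_ nhdsWithin_le_nhds
    exact Continuous.tendsto' (ENNReal.continuous_ofReal.comp (by fun_prop)) _ _ (by simp)
  refine ge_of_tendsto hlim ?_
  filter_upwards [self_mem_nhdsWithin] with ε hε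
  exact main ε hε

end Geodesics

/-! ### Partial geodesic replacement of one curve -/

section Replacement

variable {n N : ℕ} {M : Type*} [EMetricSpace M]
  [ChartedSpace (EuclideanSpace ℝ (Fin n)) M]

/-- The left endpoint of the cell `[x₀ + k * h, x₀ + (k + 1) * h)` that contains `x`. -/
noncomputable def cellStart (x₀ h x : ℝ) : ℝ := x₀ + ⌊(x - x₀) / h⌋ * h

theorem cellStart_eq {x₀ h x : ℝ} (hh : 0 < h) {k : ℤ} (h1 : x₀ + k * h ≤ x)
    (h2 : x < x₀ + (k + 1) * h) : cellStart x₀ h x = x₀ + k * h := by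
  have : ⌊(x - x₀) / h⌋ = k := by
    rw [Int.floor_eq_iff, le_div_iff₀ hh, div_lt_iff₀ hh]
    constructor <;> linarith
  rw [cellStart, this]

theorem exists_cell (x₀ : ℝ) {h : ℝ} (hh : 0 < h) (x : ℝ) :
    ∃ k : ℤ, x₀ + k * h ≤ x ∧ x < x₀ + (k + 1) * h ∧ cellStart x₀ h x = x₀ + k * h := by
  have h1 := Int.floor_le ((x - x₀) / h)
  have h2 := Int.lt_floor_add_one ((x - x₀) / h)
  rw [le_div_iff₀ hh] at h1
  rw [div_lt_iff₀ hh] at h2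
  exact ⟨_, by linarith, by linarith, rfl⟩

theorem cellStart_add {x₀ h T : ℝ} (hh : 0 < h) {m : ℤ} (hT : m * h = T) (x : ℝ) :
    cellStart x₀ h (x + T) = cellStart x₀ h x + T := by
  have : (x + T - x₀) / h = (x - x₀) / h + m := by rw [← hT]; field_simp; ring
  rw [cellStart, cellStart, this, Int.floor_add_intCast]
  push_cast
  rw [← hT]; ring

variable (n) in
/-- On each cell, follow the shortest geodesic to the point of the curve at the fraction `s` of
the cell and the curve itself afterwards. -/
noncomputable def replaceCurve (ι : M → Euc N) (x₀ h s : ℝ) (σ : ℝ → M) (x : ℝ) : M :=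
  geo n ι (σ (cellStart x₀ h x)) (σ (max (cellStart x₀ h x + s * h) x))
    ((x - cellStart x₀ h x) / (max (cellStart x₀ h x + s * h) x - cellStart x₀ h x))

theorem replaceCurve_periodic (ι : M → Euc N) {x₀ h T : ℝ} (s : ℝ) {σ : ℝ → M} (hh : 0 < h)
    {m : ℤ} (hT : m * h = T) (hσ : Function.Periodic σ T) :
    Function.Periodic (replaceCurve n ι x₀ h s σ) T := fun x => by
  rw [replaceCurve, replaceCurve, cellStart_add hh hT, hσ,
    show cellStart x₀ h x + T + s * h = cellStart x₀ h x + s * h + T by ring,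
    max_add_add_right, hσ]
  congr 1
  congr 1 <;> ring

variable [RiemannianBundle (fun x : M => TangentSpace (𝓡 n) x)]
  {ι : M → Euc N} {R x₀ h s : ℝ} {σ : ℝ → M}

theorem HasNormalRadius.geo_zero (hR : HasNormalRadius n ι R) (hι : IsIsometricEmbedding n ι)
    {p q : M} (hpq : edist p q < ENNReal.ofReal R) : geo n ι p q 0 = p :=
  (hR.isMinimizing_geo hι hpq).zero

theorem HasNormalRadius.geo_one (hR : HasNormalRadius n ι R) (hι : IsIsometricEmbedding n ι)
    {p q : M} (hpq : edist p q < ENNReal.ofReal R) : geo n ι p q 1 = q :=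
  (hR.isMinimizing_geo hι hpq).one

theorem HasNormalRadius.norm_geo_sub_le (hR : HasNormalRadius n ι R)
    (hι : IsIsometricEmbedding n ι) {p q : M} (hpq : edist p q < ENNReal.ofReal R) (x y : ℝ) :
    ‖ι (geo n ι p q y) - ι (geo n ι p q x)‖ ≤ (edist p q).toReal * |y - x| := by
  have hg := hR.isMinimizing_geo hι hpq
  have hd : Differentiable ℝ (ι ∘ geo n ι p q) :=
    (hg.isGeodesic.contDiff_comp hι).differentiable (by simp)
  have := convex_univ.norm_image_sub_le_of_norm_deriv_le (f := ι ∘ geo n ι p q)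
    (C := (edist p q).toReal) (fun x _ => hd x)
    (fun x _ => by rw [hg.isGeodesic.norm_deriv_eq hι x 0, hg.speed_eq]) (mem_univ x) (mem_univ y)
  rwa [Real.norm_eq_abs] at this

theorem HasNormalRadius.replaceCurve_of_le (hR : HasNormalRadius n ι R)
    (hι : IsIsometricEmbedding n ι) (hh : 0 < h) (hs : s ∈ Icc (0 : ℝ) 1)
    (hσ : ∀ x y, x ≤ y → y ≤ x + h → edist (σ x) (σ y) < ENNReal.ofReal R)
    {k : ℤ} {x : ℝ} (h1 : x₀ + k * h ≤ x) (h2 : x ≤ x₀ + k * h + s * h) :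
    replaceCurve n ι x₀ h s σ x =
      geo n ι (σ (x₀ + k * h)) (σ (x₀ + k * h + s * h)) ((x - (x₀ + k * h)) / (s * h)) := by
  have hsh : s * h ≤ h := mul_le_of_le_one_left hh.le hs.2
  have hsh0 : 0 ≤ s * h := mul_nonneg hs.1 hh.le
  rcases lt_or_ge x (x₀ + (k + 1) * h) with h3 | h3
  · rw [replaceCurve, cellStart_eq hh h1 h3, max_eq_left h2, add_sub_cancel_left]
  -- The right endpoint belongs to the next cell by the floor convention. This happens only for `s =
  -- 1`, and the start of the next geodesic is the end of the present one.
  · have hx : x = x₀ + (k + 1) * h := le_antisymm (by linarith) h3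
    have hsh' : s * h = h := le_antisymm hsh (by linarith)
    have hk1 : x₀ + ((k + 1 : ℤ) : ℝ) * h = x := by rw [hx]; push_cast; ring
    have hstart : cellStart x₀ h x = x := by
      rw [cellStart_eq hh (k := k + 1) hk1.le (by push_cast; linarith), hk1]
    rw [replaceCurve, hstart, sub_self, zero_div, hsh', show x - (x₀ + k * h) = h by rw [hx]; ring,
      div_self hh.ne', hR.geo_zero hι (hσ _ _ (le_max_right _ _) (max_le le_rfl (by linarith))),
      hR.geo_one hι (hσ _ _ (by linarith) le_rfl)]
    congr 1
    rw [hx]; ring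

/-- Past the fraction `s` the `max` makes `x` itself the endpoint, and the geodesic is evaluated at
parameter 1. At the start of a cell the quotient is 0/0 = 0, which also gives `σ x`. -/
theorem HasNormalRadius.replaceCurve_of_ge (hR : HasNormalRadius n ι R)
    (hι : IsIsometricEmbedding n ι) (hh : 0 < h) (hs : s ∈ Icc (0 : ℝ) 1)
    (hσ : ∀ x y, x ≤ y → y ≤ x + h → edist (σ x) (σ y) < ENNReal.ofReal R)
    {k : ℤ} {x : ℝ} (h1 : x₀ + k * h + s * h ≤ x) (h2 : x ≤ x₀ + (k + 1) * h) :
    replaceCurve n ι x₀ h s σ x = σ x := by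
  have hsh0 : 0 ≤ s * h := mul_nonneg hs.1 hh.le
  have hsh : s * h ≤ h := mul_le_of_le_one_left hh.le hs.2
  rcases h2.lt_or_eq with h3 | h3
  · rw [replaceCurve, cellStart_eq hh (by linarith) h3, max_eq_right h1]
    have hd : edist (σ (x₀ + k * h)) (σ x) < ENNReal.ofReal R := hσ _ _ (by linarith) (by linarith)
    rcases (show x₀ + k * h ≤ x by linarith).eq_or_lt with h4 | h4
    · rw [h4, sub_self, zero_div]
      rw [h4] at hd
      exact hR.geo_zero hι hd
    · rw [div_self (by linarith), hR.geo_one hι hd]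
  · have hk1 : x₀ + ((k + 1 : ℤ) : ℝ) * h = x := by rw [h3]; push_cast; ring
    have hstart : cellStart x₀ h x = x := by
      rw [cellStart_eq hh (k := k + 1) hk1.le (by push_cast; linarith), hk1]
    rw [replaceCurve, hstart, sub_self, zero_div]
    exact hR.geo_zero hι (hσ _ _ (le_max_right _ _) (max_le (by linarith) (by linarith)))

/-- A crude bound whose only role is membership in W^{1,2}. For `s = 0` the quotient is zero by
convention, and the geodesic part is a single point. -/
theorem HasNormalRadius.speedBound_replaceCurve (hR : HasNormalRadius n ι R)
    (hι : IsIsometricEmbedding n ι) (hR0 : 0 ≤ R) (hh : 0 < h) (hs : s ∈ Icc (0 : ℝ) 1)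
    (hσ : ∀ x y, x ≤ y → y ≤ x + h → edist (σ x) (σ y) < ENNReal.ofReal R)
    {v : ℝ → ℝ} (hv : SpeedBound (ι ∘ σ) v) :
    SpeedBound (ι ∘ replaceCurve n ι x₀ h s σ) fun x => R / (s * h) + v x := by
  have hsh0 : 0 ≤ s * h := mul_nonneg hs.1 hh.le
  have hsh : s * h ≤ h := mul_le_of_le_one_left hh.le hs.2
  have hint : ∀ a b, IntervalIntegrable (fun x => R / (s * h) + v x) volume a b := fun a b =>
    intervalIntegrable_const.add (hv.intervalIntegrable a b)
  have hval : ∀ a b, ∫ x in a..b, (R / (s * h) + v x) =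
      R / (s * h) * (b - a) + ∫ x in a..b, v x := fun a b => by
    rw [intervalIntegral.integral_add intervalIntegrable_const (hv.intervalIntegrable a b),
      intervalIntegral.integral_const, smul_eq_mul, mul_comm]
  have hC : 0 ≤ R / (s * h) := div_nonneg hR0 hsh0
  refine SpeedBound.of_grid (c := x₀) hh hint fun k x y hx hxy hy => ?_
  set a := x₀ + k * h with ha
  have hleft : ∀ x y, a ≤ x → x ≤ y → y ≤ a + s * h →
      ‖ι (replaceCurve n ι x₀ h s σ y) - ι (replaceCurve n ι x₀ h s σ x)‖ ≤
        ∫ z in x..y, (R / (s * h) + v z) := by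
    intro x y hx hxy hy
    rw [hR.replaceCurve_of_le hι hh hs hσ hx (hxy.trans hy),
      hR.replaceCurve_of_le hι hh hs hσ (hx.trans hxy) hy, hval]
    have hd := hσ a (a + s * h) (by linarith) (by linarith)
    refine (hR.norm_geo_sub_le hι hd _ _).trans ?_
    have h1 : (edist (σ a) (σ (a + s * h))).toReal ≤ R := by
      have := ENNReal.toReal_mono ENNReal.ofReal_ne_top hd.le
      rwa [ENNReal.toReal_ofReal hR0] at this
    rw [← sub_div, sub_sub_sub_cancel_right, abs_div, abs_of_nonneg (sub_nonneg.2 hxy),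
      abs_of_nonneg hsh0]
    have h2 := hv.integral_nonneg hxy
    have h3 : (edist (σ a) (σ (a + s * h))).toReal * ((y - x) / (s * h)) ≤
        R * ((y - x) / (s * h)) :=
      mul_le_mul_of_nonneg_right h1 (div_nonneg (by linarith) hsh0)
    calc _ ≤ R * ((y - x) / (s * h)) := h3
      _ = R / (s * h) * (y - x) := by ring
      _ ≤ _ := by linarith
  have hright : ∀ x y, a + s * h ≤ x → x ≤ y → y ≤ x₀ + (k + 1) * h →
      ‖ι (replaceCurve n ι x₀ h s σ y) - ι (replaceCurve n ι x₀ h s σ x)‖ ≤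
        ∫ z in x..y, (R / (s * h) + v z) := by
    intro x y hx hxy hy
    rw [hR.replaceCurve_of_ge hι hh hs hσ hx (hxy.trans hy),
      hR.replaceCurve_of_ge hι hh hs hσ (hx.trans hxy) hy, hval]
    have h1 := hv.norm_sub_le x y hxy
    have h2 : 0 ≤ R / (s * h) * (y - x) := mul_nonneg hC (by linarith)
    simp only [Function.comp_apply] at h1
    linarith
  simp only [Function.comp_apply]
  rcases le_total y (a + s * h) with h1 | h1
  · exact hleft x y hx hxy h1
  rcases le_total (a + s * h) x with h2 | h2
  · exact hright x y h2 hxy hy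
  rw [← intervalIntegral.integral_add_adjacent_intervals (hint x (a + s * h)) (hint _ y)]
  refine (norm_sub_le_norm_sub_add_norm_sub _ (ι (replaceCurve n ι x₀ h s σ (a + s * h))) _).trans ?_
  rw [add_comm]
  exact add_le_add (hleft _ _ hx h2 le_rfl) (hright _ _ le_rfl h1 hy)

/-- The geodesic part has constant speed d/(sh), where d is the distance of its ends. In this form
the energy visibly depends continuously on the curve, also for `s = 0`, where the first term is 0.
-/
theorem HasNormalRadius.integral_sq_replaceCurve (hR : HasNormalRadius n ι R)
    (hι : IsIsometricEmbedding n ι) (hh : 0 < h) (hs : s ∈ Icc (0 : ℝ) 1)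
    (hσ : ∀ x y, x ≤ y → y ≤ x + h → edist (σ x) (σ y) < ENNReal.ofReal R) (k : ℤ)
    (hint : ∀ a b, IntervalIntegrable
      (fun x => ‖deriv (ι ∘ replaceCurve n ι x₀ h s σ) x‖ ^ 2) volume a b) :
    ∫ x in x₀ + k * h..x₀ + (k + 1) * h, ‖deriv (ι ∘ replaceCurve n ι x₀ h s σ) x‖ ^ 2 =
      (edist (σ (x₀ + k * h)) (σ (x₀ + k * h + s * h))).toReal ^ 2 / (s * h) +
        ∫ x in x₀ + k * h + s * h..x₀ + (k + 1) * h, ‖deriv (ι ∘ σ) x‖ ^ 2 := by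
  have hsh0 : 0 ≤ s * h := mul_nonneg hs.1 hh.le
  have hsh : s * h ≤ h := mul_le_of_le_one_left hh.le hs.2
  set a := x₀ + k * h with ha
  set d := (edist (σ a) (σ (a + s * h))).toReal with hd
  have hlt := hσ a (a + s * h) (by linarith) (by linarith)
  have hg := hR.isMinimizing_geo hι hlt
  rw [← intervalIntegral.integral_add_adjacent_intervals (hint a (a + s * h)) (hint _ _)]
  congr 1
  · have h1 : ∫ x in a..a + s * h, ‖deriv (ι ∘ replaceCurve n ι x₀ h s σ) x‖ ^ 2 =
        ∫ x in a..a + s * h, (d / (s * h)) ^ 2 := by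
      refine intervalIntegral.integral_congr_Ioo_of_le (by linarith) fun x hx => ?_
      have h2 : (ι ∘ replaceCurve n ι x₀ h s σ) =ᶠ[𝓝 x]
          fun x => (ι ∘ geo n ι (σ a) (σ (a + s * h))) ((s * h)⁻¹ * x + -((s * h)⁻¹ * a)) := by
        filter_upwards [Ioo_mem_nhds hx.1 hx.2] with y hy
        rw [Function.comp_apply, hR.replaceCurve_of_le hι hh hs hσ hy.1.le hy.2.le,
          Function.comp_apply]
        congr 2
        rw [div_eq_inv_mul]; ring
      rw [h2.deriv_eq, deriv_comp_affine, norm_smul, hg.isGeodesic.norm_deriv_eq hι _ 0,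
        hg.speed_eq, norm_inv, Real.norm_of_nonneg hsh0, div_eq_inv_mul]
    rw [h1, intervalIntegral.integral_const, smul_eq_mul, add_sub_cancel_left]
    rcases hsh0.eq_or_lt with h0 | h0
    · rw [← h0]; simp
    · field_simp
  · refine intervalIntegral.integral_congr_Ioo_of_le (by linarith) fun x hx => ?_
    have h2 : (ι ∘ replaceCurve n ι x₀ h s σ) =ᶠ[𝓝 x] ι ∘ σ := by
      filter_upwards [Ioo_mem_nhds hx.1 hx.2] with y hy
      rw [Function.comp_apply, hR.replaceCurve_of_ge hι hh hs hσ hy.1.le hy.2.le,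
        Function.comp_apply]
    rw [h2.deriv_eq]

end Replacement

/-! ### Criteria for sweepouts and homotopies -/

section Families

variable {N : ℕ} {M : Type*} [TopologicalSpace M] {ι : M → Euc N}

/-- The covering of the circle by the line is an open quotient map, so its product with any space is
again a quotient map. -/
theorem exists_continuousMap_circle {X : Type*} [TopologicalSpace X] {F : X → ℝ → M}
    (hper : ∀ p, Function.Periodic (F p) (2 * Real.pi))
    (hc : Continuous fun p : X × ℝ => F p.1 p.2) :
    ∃ G : C(X × Circ, M), ∀ p (x : ℝ), G (p, (x : Circ)) = F p x := by
  have hq : IsOpenQuotientMap (Prod.map id ((↑) : ℝ → Circ) : X × ℝ → X × Circ) :=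
    IsOpenQuotientMap.id.prodMap QuotientAddGroup.isOpenQuotientMap_mk
  refine ⟨⟨fun z => (hper z.1).lift z.2, ?_⟩, fun p x => (hper p).lift_coe x⟩
  rw [hq.isQuotientMap.continuous_iff]
  exact hc

/-- Uniform Hölder bounds and continuity at each point give joint continuity. -/
theorem continuous_of_sq_norm_sub_le {X : Type*} [TopologicalSpace X] {F : X → ℝ → M}
    (hι : IsEmbedding ι) {C : ℝ} (hp : ∀ x, Continuous fun p => F p x)
    (hF : ∀ p x y, x ≤ y → y ≤ x + 1 → ‖ι (F p y) - ι (F p x)‖ ^ 2 ≤ C * (y - x)) :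
    Continuous fun p : X × ℝ => F p.1 p.2 := by
  rw [hι.continuous_iff, continuous_iff_continuousAt]
  rintro ⟨p, x⟩
  rw [ContinuousAt, tendsto_iff_norm_sub_tendsto_zero]
  have h1 : Tendsto (fun z : X × ℝ => Real.sqrt (C * |z.2 - x|) + ‖ι (F z.1 x) - ι (F p x)‖)
      (𝓝 (p, x)) (𝓝 0) := by
    have hc : Continuous fun z : X × ℝ => ι (F z.1 x) :=
      hι.continuous.comp ((hp x).comp continuous_fst)
    refine Continuous.tendsto' (by fun_prop) _ _ (by simp)
  refine squeeze_zero' (Eventually.of_forall fun _ => norm_nonneg _) ?_ h1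
  have h2 : ∀ᶠ z : X × ℝ in 𝓝 (p, x), z.2 ∈ Icc (x - 1) (x + 1) :=
    (continuous_snd.tendsto (p, x)).eventually (Icc_mem_nhds (by simp) (by simp))
  filter_upwards [h2] with z hz
  refine (norm_sub_le_norm_sub_add_norm_sub _ (ι (F z.1 x)) _).trans (add_le_add_left ?_ _)
  refine Real.le_sqrt_of_sq_le ?_
  rcases le_total x z.2 with h | h
  · rw [abs_of_nonneg (sub_nonneg.2 h)]
    exact hF _ _ _ h hz.2
  · rw [abs_sub_comm, abs_of_nonneg (sub_nonneg.2 h), norm_sub_rev]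
    exact hF _ _ _ h (by linarith [hz.1])

/-- Compactness of the circle upgrades joint continuity to uniform convergence of slices; continuity
of the energy then gives convergence in W^{1,2}. -/
theorem IsSweepout.of_continuous_energy {σ : C(Circ × Param, M)} (hι : Continuous ι)
    (hW : ∀ t, IsW12 (ι ∘ slice σ t)) (hE : Continuous fun t => energy (ι ∘ slice σ t))
    (h0 : ∃ p : M, ∀ x, slice σ ⟨-1, by norm_num⟩ x = p)
    (h1 : ∃ p : M, ∀ x, slice σ ⟨1, by norm_num⟩ x = p) : IsSweepout ι σ := by
  have : Fact (0 < 2 * Real.pi) := ⟨Real.two_pi_pos⟩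
  refine ⟨hW, fun t => tendsto_w12Dist hW (hW t) (fun ε hε => ?_) (hE.tendsto t), h0, h1⟩
  have hc : Continuous fun z : Param × Circ => ‖ι (σ (z.2, z.1)) - ι (σ (z.2, t))‖ := by
    have h1 : Continuous fun z : Param × Circ => ι (σ (z.2, z.1)) :=
      hι.comp (σ.continuous.comp (by fun_prop))
    have h2 : Continuous fun z : Param × Circ => ι (σ (z.2, t)) :=
      hι.comp (σ.continuous.comp (by fun_prop))
    exact (h1.sub h2).norm
  have h2 : ∀ᶠ s in 𝓝 t, ∀ x ∈ (univ : Set Circ), ‖ι (σ (x, s)) - ι (σ (x, t))‖ < ε := by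
    refine isCompact_univ.eventually_forall_of_forall_eventually fun x _ => ?_
    exact hc.continuousAt.eventually (gt_mem_nhds (by simpa using hε))
  filter_upwards [h2] with s hs x
  exact (hs _ (mem_univ _)).le

/-- A continuous family of periodic curves of class `W^{1,2}` with continuous energies is a
homotopy in `Ω`. -/
theorem exists_homotopicInΩ (hι : Continuous ι) {σ : C(Circ × Param, M)}
    {F : unitInterval → Param → ℝ → M} {v : unitInterval → Param → ℝ → ℝ} {a : ℝ}
    (hper : ∀ s t, Function.Periodic (F s t) (2 * Real.pi))
    (hc : Continuous fun p : (unitInterval × Param) × ℝ => F p.1.1 p.1.2 p.2)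
    (hv : ∀ s t, SpeedBound (ι ∘ F s t) (v s t))
    (hv2 : ∀ s t a b, IntervalIntegrable (fun x => v s t x ^ 2) volume a b)
    (hE : ∀ s, Continuous fun t => ∫ x in a..a + 2 * Real.pi, ‖deriv (ι ∘ F s t) x‖ ^ 2)
    (h0 : ∀ s, ∃ p : M, ∀ x, F s ⟨-1, by norm_num⟩ x = p)
    (h1 : ∀ s, ∃ p : M, ∀ x, F s ⟨1, by norm_num⟩ x = p)
    (hσ : ∀ t, lift (slice σ t) = F 0 t) :
    ∃ τ : C(Circ × Param, M), (∀ t, lift (slice τ t) = F 1 t) ∧ IsSweepout ι τ ∧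
      HomotopicInΩ ι σ τ := by
  obtain ⟨G, hG⟩ := exists_continuousMap_circle (fun p : unitInterval × Param => hper p.1 p.2) hc
  set H : unitInterval → C(Circ × Param, M) := fun s =>
    ⟨fun z => G ((s, z.2), z.1), G.continuous.comp (by fun_prop)⟩ with hH
  have hlift : ∀ s t, lift (slice (H s) t) = F s t := fun s t => funext fun x => hG (s, t) x
  have hlift' : ∀ s t, lift (ι ∘ slice (H s) t) = ι ∘ F s t := fun s t => by
    rw [← hlift s t]; rfl
  have hsw : ∀ s, IsSweepout ι (H s) := fun s => by
    refine IsSweepout.of_continuous_energy hι (fun t => ?_) ?_ ?_ ?_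
    · exact IsW12.of_speedBound (v := v s t) (by rw [hlift']; exact hv s t) (hv2 s t)
    · simp only [energy_eq_integral _ a, hlift']
      exact hE s
    · obtain ⟨p, hp⟩ := h0 s
      refine ⟨p, fun x => ?_⟩
      obtain ⟨x, rfl⟩ := QuotientAddGroup.mk_surjective x
      exact (congrFun (hlift s _) x).trans (hp x)
    · obtain ⟨p, hp⟩ := h1 s
      refine ⟨p, fun x => ?_⟩
      obtain ⟨x, rfl⟩ := QuotientAddGroup.mk_surjective x
      exact (congrFun (hlift s _) x).trans (hp x)
  have hσ0 : H 0 = σ := by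
    ext ⟨x, t⟩
    obtain ⟨x, rfl⟩ := QuotientAddGroup.mk_surjective x
    exact congrFun ((hlift 0 t).trans (hσ t).symm) x
  refine ⟨H 1, hlift 1, hsw 1, ⟨⟨⟨⟨fun z => G ((z.1, z.2.2), z.2.1), ?_⟩, ?_, ?_⟩, ?_⟩⟩⟩
  · exact G.continuous.comp (by fun_prop)
  · intro z
    rw [← hσ0]; rfl
  · intro z
    rfl
  · intro s
    exact hsw s

theorem IsSweepout.continuous_integral_sq_norm_deriv {σ : C(Circ × Param, M)}
    (hσ : IsSweepout ι σ) {a b : ℝ} (hab : a ≤ b) :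
    Continuous fun t => ∫ x in a..b, ‖deriv (ι ∘ lift (slice σ t)) x‖ ^ 2 :=
  continuous_iff_continuousAt.2 fun t =>
    CurveSweepout.tendsto_integral_sq_norm_deriv hσ.isW12 (hσ.isW12 t) (hσ.continuous_slice t) hab

theorem IsSweepout.continuous_integral_norm_deriv {σ : C(Circ × Param, M)}
    (hσ : IsSweepout ι σ) (a b : ℝ) :
    Continuous fun t => ∫ x in a..b, ‖deriv (ι ∘ lift (slice σ t)) x‖ :=
  continuous_iff_continuousAt.2 fun t =>
    tendsto_integral_norm_deriv hσ.isW12 (hσ.isW12 t) (hσ.continuous_slice t) a b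

end Families

/-! ### The homotopy of geodesic replacement -/

section ReplacementFamily

variable {n N : ℕ} {M : Type*} [EMetricSpace M]
  [ChartedSpace (EuclideanSpace ℝ (Fin n)) M]
  [RiemannianBundle (fun x : M => TangentSpace (𝓡 n) x)]
  {ι : M → Euc N} {R x₀ h : ℝ}

theorem HasNormalRadius.continuous_replaceCurve [CompactSpace M] [IsRiemannianManifold (𝓡 n) M]
    (hR : HasNormalRadius n ι R) (hι : IsIsometricEmbedding n ι) (hh : 0 < h)
    {T : Type*} [TopologicalSpace T] {σ : T → ℝ → M} (hc : ∀ x, Continuous fun t => σ t x)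
    (hσ : ∀ t x y, x ≤ y → y ≤ x + h → edist (σ t x) (σ t y) < ENNReal.ofReal R) (x : ℝ)
    (hcx : Continuous fun p : T × ℝ => σ p.1 p.2) :
    Continuous fun p : unitInterval × T => replaceCurve n ι x₀ h p.1 (σ p.2) x := by
  obtain ⟨k, h1, h2, h3⟩ := exists_cell x₀ hh x
  simp only [replaceCurve, h3]
  set a := x₀ + k * h with ha
  have hb : ∀ s : unitInterval, max (a + s * h) x ≤ a + h := fun s =>
    max_le (by nlinarith [s.2.2]) (by linarith)
  -- At the start of a cell the denominator may vanish, but the value there is always `σ p.2 a`;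
  -- elsewhere it stays positive.
  rcases h1.eq_or_lt with h4 | h4
  · have : ∀ p : unitInterval × T, geo n ι (σ p.2 a) (σ p.2 (max (a + p.1 * h) x))
        ((x - a) / (max (a + p.1 * h) x - a)) = σ p.2 a := fun p => by
      rw [← h4, sub_self, zero_div]
      exact hR.geo_zero hι (hσ _ _ _ (le_max_right _ _) (h4 ▸ hb p.1))
    simp only [this]
    exact (hc a).comp continuous_snd
  · have hpos : ∀ s : ℝ, 0 < max (a + s * h) x - a := fun s => by
      linarith [le_max_right (a + s * h) x]
    refine (hR.continuousOn_geo hι).comp_continuous (f := fun p : unitInterval × T =>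
      ((σ p.2 a, σ p.2 (max (a + p.1 * h) x)), (x - a) / (max (a + p.1 * h) x - a))) ?_ ?_
    · refine ((((hc a).comp continuous_snd)).prodMk
        (hcx.comp (by fun_prop : Continuous fun p : unitInterval × T =>
          (p.2, max (a + p.1 * h) x)))).prodMk ?_
      exact continuous_const.div (by fun_prop) fun p => (hpos p.1).ne'
    · intro p
      refine ⟨hσ _ _ _ (h4.le.trans (le_max_right _ _)) (hb p.1), div_nonneg (by linarith)
        (hpos _).le, (div_le_one (hpos _)).2 ?_⟩
      linarith [le_max_right (a + p.1 * h) x]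

/-- The distance of the endpoints is at most the length of the replaced piece, whose square is at
most the energy of the piece times the length of the parameter interval. -/
theorem HasNormalRadius.integral_sq_replaceCurve_le [IsRiemannianManifold (𝓡 n) M]
    (hR : HasNormalRadius n ι R)
    (hι : IsIsometricEmbedding n ι) (hRpos : 0 < R) (hh : 0 < h) {s : ℝ} (hs : s ∈ Icc (0 : ℝ) 1)
    {σ : ℝ → M}
    (hσ : ∀ x y, x ≤ y → y ≤ x + h → edist (σ x) (σ y) < ENNReal.ofReal R) (k : ℤ)
    (hint : ∀ a b, IntervalIntegrable
      (fun x => ‖deriv (ι ∘ replaceCurve n ι x₀ h s σ) x‖ ^ 2) volume a b)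
    (hv : SpeedBound (ι ∘ σ) fun x => ‖deriv (ι ∘ σ) x‖)
    (hv2 : ∀ a b, IntervalIntegrable (fun x => ‖deriv (ι ∘ σ) x‖ ^ 2) volume a b) :
    ∫ x in x₀ + k * h..x₀ + (k + 1) * h, ‖deriv (ι ∘ replaceCurve n ι x₀ h s σ) x‖ ^ 2 ≤
      ∫ x in x₀ + k * h..x₀ + (k + 1) * h, ‖deriv (ι ∘ σ) x‖ ^ 2 := by
  have hsh0 : 0 ≤ s * h := mul_nonneg hs.1 hh.le
  rw [hR.integral_sq_replaceCurve hι hh hs hσ k hint,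
    ← intervalIntegral.integral_add_adjacent_intervals (hv2 (x₀ + k * h) (x₀ + k * h + s * h))
      (hv2 _ _)]
  refine add_le_add_left ?_ _
  set a := x₀ + k * h
  have hle : a ≤ a + s * h := by linarith
  refine div_le_of_le_mul₀ hsh0
    (intervalIntegral.integral_nonneg hle fun _ _ => sq_nonneg _) ?_
  have h1 := hR.edist_le_integral hι hRpos hv hle
  have h2 := hv.integral_nonneg hle
  have h3 := sq_integral_le hle (hv.intervalIntegrable _ _) (hv2 a (a + s * h))
  have h4 := ENNReal.toReal_mono ENNReal.ofReal_ne_top h1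
  rw [ENNReal.toReal_ofReal h2] at h4
  calc _ ≤ _ := pow_le_pow_left₀ ENNReal.toReal_nonneg h4 2
    _ ≤ _ := h3
    _ = _ := by ring

theorem HasNormalRadius.replaceCurve_const [IsRiemannianManifold (𝓡 n) M]
    (hR : HasNormalRadius n ι R) (hι : IsIsometricEmbedding n ι) (hRpos : 0 < R) (hh : 0 < h)
    (s : ℝ) (p : M) (x : ℝ) : replaceCurve n ι x₀ h s (fun _ => p) x = p := by
  obtain ⟨k, h1, h2, h3⟩ := exists_cell x₀ hh x
  rw [← h3] at h1
  have h4 := le_max_right (cellStart x₀ h x + s * h) x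
  exact hR.geo_self hι hRpos p ⟨div_nonneg (by linarith) (by linarith),
    div_le_one_of_le₀ (by linarith) (by linarith)⟩

variable {L : ℕ}

/-- The square of the length is at most (2π/L) · L = 2π, which is below 64. -/
theorem edist_lift_lt [IsRiemannianManifold (𝓡 n) M] (hR : HasNormalRadius n ι 8)
    (hι : IsIsometricEmbedding n ι)
    (hL : 1 ≤ L) {α : Circ → M} (hα : IsW12 (ι ∘ α)) (hE : energy (ι ∘ α) ≤ L) {x y : ℝ}
    (hxy : x ≤ y) (hy : y ≤ x + 2 * Real.pi / L) :
    edist (lift α x) (lift α y) < ENNReal.ofReal 8 := by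
  have hL0 : (1 : ℝ) ≤ L := by exact_mod_cast hL
  have hpi := Real.pi_pos
  have hv : SpeedBound (ι ∘ lift α) _ := hα.speedBound
  refine (hR.edist_le_integral hι (by norm_num) hv hxy).trans_lt ?_
  rw [ENNReal.ofReal_lt_ofReal_iff (by norm_num)]
  have h1 := sq_integral_le hxy (hv.intervalIntegrable _ _) (hα.sq_intervalIntegrable x y)
  have h2 : y ≤ x + 2 * Real.pi := hy.trans (by
    gcongr
    exact div_le_self (by positivity) hL0)
  have h3 : ∫ z in x..y, ‖deriv (lift (ι ∘ α)) z‖ ^ 2 ≤ energy (ι ∘ α) := by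
    rw [energy_eq_integral _ x]
    exact intervalIntegral.integral_mono_interval le_rfl hxy h2
      (Eventually.of_forall fun _ => sq_nonneg _) (hα.sq_intervalIntegrable _ _)
  have h4 : (y - x) * ∫ z in x..y, ‖deriv (lift (ι ∘ α)) z‖ ^ 2 ≤ 2 * Real.pi / L * L :=
    mul_le_mul (by linarith) (h3.trans hE)
      (intervalIntegral.integral_nonneg hxy fun _ _ => sq_nonneg _) (by positivity)
  rw [div_mul_cancel₀ _ (by positivity)] at h4
  have h5 := Real.pi_lt_d2
  exact lt_of_pow_lt_pow_left₀ 2 (by norm_num) (h1.trans_lt (h4.trans_lt (by norm_num; linarith)))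

/-- The energy bound is part of the conclusion so that the replacement can be repeated on the
shifted partition. -/
theorem exists_isGeodesicReplacement [CompactSpace M] [IsRiemannianManifold (𝓡 n) M]
    (hR : HasNormalRadius n ι 8) (hι : IsIsometricEmbedding n ι) (hL : 1 ≤ L) (x₀ : ℝ)
    {γ : C(Circ × Param, M)} (hγ : IsSweepout ι γ) (hE : ∀ t, energy (ι ∘ slice γ t) ≤ L) :
    ∃ τ : C(Circ × Param, M),
      (∀ t, lift (slice τ t) = replaceCurve n ι x₀ (2 * Real.pi / L) 1 (lift (slice γ t))) ∧
      IsSweepout ι τ ∧ HomotopicInΩ ι γ τ ∧ ∀ t, energy (ι ∘ slice τ t) ≤ L := by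
  have hL0 : (1 : ℝ) ≤ L := by exact_mod_cast hL
  set h := 2 * Real.pi / L with hh'
  have hpi := Real.pi_pos
  have hh : 0 < h := by positivity
  have hLh : L * h = 2 * Real.pi := by rw [hh']; field_simp
  have hσ : ∀ t x y, x ≤ y → y ≤ x + h →
      edist (lift (slice γ t) x) (lift (slice γ t) y) < ENNReal.ofReal 8 :=
    fun t x y h1 h2 => edist_lift_lt hR hι hL (hγ.isW12 t) (hE t) h1 h2
  set F : unitInterval → Param → ℝ → M := fun s t =>
    replaceCurve n ι x₀ h s (lift (slice γ t)) with hF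
  set u : Param → ℝ → ℝ := fun t x => ‖deriv (ι ∘ lift (slice γ t)) x‖ with hu
  have hu1 : ∀ t, SpeedBound (ι ∘ lift (slice γ t)) (u t) := fun t => (hγ.isW12 t).speedBound
  have hu2 : ∀ t a b, IntervalIntegrable (fun x => u t x ^ 2) volume a b := fun t =>
    (hγ.isW12 t).sq_intervalIntegrable
  have hper : ∀ s t, Function.Periodic (F s t) (2 * Real.pi) := fun s t =>
    replaceCurve_periodic ι _ hh (m := L) (by exact_mod_cast hLh) (lift_periodic _)
  have hv : ∀ s t, SpeedBound (ι ∘ F s t) fun x => 8 / (s * h) + u t x := fun s t =>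
    hR.speedBound_replaceCurve hι (by norm_num) hh s.2 (hσ t) (hu1 t)
  have hv2 : ∀ (s : unitInterval) t a b,
      IntervalIntegrable (fun x => (8 / (s * h) + u t x) ^ 2) volume a b := fun s t a b => by
    have : (fun x => (8 / (s * h) + u t x) ^ 2) =
        fun x => (8 / (s * h)) ^ 2 + 2 * (8 / (s * h)) * u t x + u t x ^ 2 := by
      funext x; ring
    rw [this]
    exact (intervalIntegrable_const.add (((hu1 t).intervalIntegrable a b).const_mul _)).add
      (hu2 t a b)
  have hW : ∀ s t, ∃ c : Circ → M, lift c = F s t ∧ IsW12 (ι ∘ c) := fun s t => by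
    refine ⟨(hper s t).lift, rfl, IsW12.of_speedBound (v := fun x => 8 / (s * h) + u t x) ?_ ?_⟩
    · exact hv s t
    · exact hv2 s t
  have hint : ∀ s t a b, IntervalIntegrable (fun x => ‖deriv (ι ∘ F s t) x‖ ^ 2) volume a b :=
    fun s t => by
      obtain ⟨c, hc, hcW⟩ := hW s t
      rw [← hc]
      exact hcW.sq_intervalIntegrable
  have hsum : ∀ w : ℝ → ℝ, (∀ a b, IntervalIntegrable w volume a b) →
      ∫ x in x₀..x₀ + 2 * Real.pi, w x =
        ∑ k ∈ Finset.range L, ∫ x in x₀ + (k : ℤ) * h..x₀ + ((k : ℤ) + 1) * h, w x := by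
    intro w hw
    have := intervalIntegral.sum_integral_adjacent_intervals (μ := volume) (f := w)
      (a := fun k : ℕ => x₀ + k * h) (n := L) fun k _ => hw _ _
    simp only [Nat.cast_zero, zero_mul, add_zero, hLh] at this
    rw [← this]
    push_cast
    rfl
  have hEle : ∀ s t, ∫ x in x₀..x₀ + 2 * Real.pi, ‖deriv (ι ∘ F s t) x‖ ^ 2 ≤ L := fun s t => by
    refine le_trans ?_ (hE t)
    rw [energy_eq_integral _ x₀, hsum _ (hint s t)]
    refine le_trans ?_ (hsum _ (hu2 t)).ge
    exact Finset.sum_le_sum fun k _ =>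
      hR.integral_sq_replaceCurve_le hι (by norm_num) hh s.2 (hσ t) k (hint s t) (hu1 t) (hu2 t)
  have hγc : Continuous fun p : Param × ℝ => lift (slice γ p.1) p.2 :=
    γ.continuous.comp ((continuous_quotient_mk'.comp continuous_snd).prodMk continuous_fst)
  have hpt : ∀ x, Continuous fun t => lift (slice γ t) x := fun x =>
    γ.continuous.comp (by fun_prop)
  -- Energies at most `L` throughout the homotopy give one Hölder constant for all `s` and `t`, so
  -- continuity at each fixed `x` suffices.
  have hFc : Continuous fun p : (unitInterval × Param) × ℝ => F p.1.1 p.1.2 p.2 := by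
    refine continuous_of_sq_norm_sub_le (F := fun p : unitInterval × Param => F p.1 p.2)
      hι.isEmbedding (C := L)
      (fun x => hR.continuous_replaceCurve hι hh hpt hσ x hγc) ?_
    rintro ⟨s, t⟩ x y hxy hy
    obtain ⟨c, hc, hcW⟩ := hW s t
    have h1 := hcW.sq_norm_sub_le hxy
    change ‖ι (lift c y) - ι (lift c x)‖ ^ 2 ≤
      (y - x) * ∫ z in x..y, ‖deriv (ι ∘ lift c) z‖ ^ 2 at h1
    rw [hc] at h1
    refine h1.trans ?_
    rw [mul_comm]
    refine mul_le_mul_of_nonneg_right ?_ (sub_nonneg.2 hxy)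
    refine le_trans ?_ (hEle s t)
    have h2 := energy_eq_integral (ι ∘ c) x
    rw [energy_eq_integral _ x₀] at h2
    change ∫ z in x₀..x₀ + 2 * Real.pi, ‖deriv (ι ∘ lift c) z‖ ^ 2 =
      ∫ z in x..x + 2 * Real.pi, ‖deriv (ι ∘ lift c) z‖ ^ 2 at h2
    rw [hc] at h2
    rw [h2]
    exact intervalIntegral.integral_mono_interval le_rfl hxy (by linarith [Real.pi_gt_three])
      (Eventually.of_forall fun _ => sq_nonneg _) (hint _ _ _ _)
  have hFE : ∀ s, Continuous fun t =>
      ∫ x in x₀..x₀ + 2 * Real.pi, ‖deriv (ι ∘ F s t) x‖ ^ 2 := by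
    intro s
    have hE' : ∀ t, ∫ x in x₀..x₀ + 2 * Real.pi, ‖deriv (ι ∘ F s t) x‖ ^ 2 =
        ∑ k ∈ Finset.range L, ((edist (lift (slice γ t) (x₀ + (k : ℤ) * h))
          (lift (slice γ t) (x₀ + (k : ℤ) * h + s * h))).toReal ^ 2 / (s * h) +
        ∫ x in x₀ + (k : ℤ) * h + s * h..x₀ + ((k : ℤ) + 1) * h,
          ‖deriv (ι ∘ lift (slice γ t)) x‖ ^ 2) := fun t => by
      rw [hsum _ (hint s t)]
      exact Finset.sum_congr rfl fun k _ =>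
        hR.integral_sq_replaceCurve hι hh s.2 (hσ t) k (hint s t)
    simp only [hE']
    refine continuous_finsetSum _ fun k _ => Continuous.add (Continuous.div_const ?_ _) ?_
    · refine Continuous.pow ?_ 2
      refine ENNReal.continuousOn_toReal.comp_continuous ((hpt _).edist (hpt _)) fun t => ?_
      exact ne_top_of_lt (hσ t _ _ (by nlinarith [s.2.1]) (by nlinarith [s.2.2]))
    · exact hγ.continuous_integral_sq_norm_deriv (by nlinarith [s.2.2])
  have hconst : ∀ s t, (∃ p, ∀ x, slice γ t x = p) → ∃ p, ∀ x, F s t x = p := by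
    rintro s t ⟨p, hp⟩
    refine ⟨p, fun x => ?_⟩
    have hl : lift (slice γ t) = fun _ => p := funext fun x => hp x
    rw [hF]
    simp only [hl]
    exact hR.replaceCurve_const hι (by norm_num) hh _ _ _
  -- At `s = 0` nothing is replaced and the homotopy starts at `γ`.
  obtain ⟨τ, hτ, hτs, hτh⟩ := exists_homotopicInΩ hι.contMDiff.continuous hper hFc hv hv2 hFE
    (fun s => hconst s _ hγ.start) (fun s => hconst s _ hγ.finish) (σ := γ) fun t => funext fun x =>
      have ⟨k, h1, h2, _⟩ := exists_cell x₀ hh x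
      (hR.replaceCurve_of_ge hι hh (by simp) (hσ t) (k := k) (by simpa using h1) h2.le).symm
  refine ⟨τ, fun t => ?_, hτs, hτh, fun t => ?_⟩
  · rw [hτ t]; simp [hF]
  · rw [energy_eq_integral _ x₀]
    refine le_trans (le_of_eq ?_) (hEle 1 t)
    rw [← hτ t]; rfl

end ReplacementFamily

/-! ### Uniqueness of geodesic replacement -/

section ReplacementUnique

variable {n N : ℕ} {M : Type*} [EMetricSpace M]
  [ChartedSpace (EuclideanSpace ℝ (Fin n)) M]
  [RiemannianBundle (fun x : M => TangentSpace (𝓡 n) x)] [IsRiemannianManifold (𝓡 n) M]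
  {ι : M → Euc N} {R : ℝ} {L : ℕ}

theorem isGeodesicReplacement_iff (hR : HasNormalRadius n ι R) (hι : IsIsometricEmbedding n ι)
    (hL : 1 ≤ L) (x₀ : ℝ) {α β : Circ → M}
    (hα : ∀ x y, x ≤ y → y ≤ x + 2 * Real.pi / L →
      edist (lift α x) (lift α y) < ENNReal.ofReal R) :
    IsGeodesicReplacement n ι L x₀ α β ↔
      lift β = replaceCurve n ι x₀ (2 * Real.pi / L) 1 (lift α) := by
  have hL0 : (1 : ℝ) ≤ L := by exact_mod_cast hL
  set h := 2 * Real.pi / L with hh'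
  have hpi := Real.pi_pos
  have hh : 0 < h := by positivity
  have hLh : L * h = 2 * Real.pi := by rw [hh']; field_simp
  have hn1 : ∀ j : ℕ, node L x₀ (2 * j) = x₀ + (j : ℤ) * h := fun j => by
    rw [node, hh']; push_cast; ring
  have hn2 : ∀ j : ℕ, node L x₀ (2 * j + 2) = x₀ + (j : ℤ) * h + h := fun j => by
    rw [node, hh']; push_cast; ring
  have hs : (1 : ℝ) ∈ Icc (0 : ℝ) 1 := by simp
  have hrep : ∀ (j : ℤ) x, x₀ + j * h ≤ x → x ≤ x₀ + j * h + h →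
      replaceCurve n ι x₀ h 1 (lift α) x = geo n ι (lift α (x₀ + j * h))
        (lift α (x₀ + j * h + h)) ((x - (x₀ + j * h)) / h) := fun j x h1 h2 => by
    have := hR.replaceCurve_of_le hι hh hs hα h1 (by rwa [one_mul])
    rwa [one_mul] at this
  have hlt : ∀ j : ℤ, edist (lift α (x₀ + j * h)) (lift α (x₀ + j * h + h)) <
      ENNReal.ofReal R := fun j => hα _ _ (by linarith) le_rfl
  simp only [IsGeodesicReplacement, hn1, hn2]
  constructor
  · intro H
    -- The hypothesis covers only the cells 0, …, L - 1. Periodicity of both curves moves the point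
    -- into one of them.
    have hper : Function.Periodic
        (fun x => (lift β x, replaceCurve n ι x₀ h 1 (lift α) x)) (2 * Real.pi) := fun x =>
      Prod.ext (lift_periodic β x)
        (replaceCurve_periodic ι 1 hh (m := L) (by exact_mod_cast hLh) (lift_periodic α) x)
    funext x
    obtain ⟨y, hy, hxy⟩ := hper.exists_mem_Ico (by positivity) x x₀
    rw [Prod.ext_iff] at hxy
    simp only at hxy
    rw [hxy.1, hxy.2]
    obtain ⟨k, h1, h2, -⟩ := exists_cell x₀ hh y
    have hk0 : 0 ≤ k := by
      have : (0 : ℝ) < k + 1 := pos_of_mul_pos_left (by linarith [hy.1]) hh.le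
      exact Int.lt_add_one_iff.1 (by exact_mod_cast this)
    lift k to ℕ using hk0
    have hkL : k < L := by
      have : (k : ℝ) < L := lt_of_mul_lt_mul_right
        (by rw [hLh]; push_cast at h1; linarith [hy.2]) hh.le
      exact_mod_cast this
    obtain ⟨e1, e2, e3⟩ := H k hkL
    rw [hR.isShortestGeodesicOn_iff hι (by linarith) (by rw [e1, e2]; exact hlt k)] at e3
    rw [e3 y ⟨h1, by linarith⟩, e1, e2, hrep k y h1 (by linarith), add_sub_cancel_left]
  · intro H j hj
    have e1 : lift β (x₀ + (j : ℤ) * h) = lift α (x₀ + (j : ℤ) * h) := by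
      rw [H, hrep j _ le_rfl (by linarith), sub_self, zero_div]
      exact hR.geo_zero hι (hlt j)
    have e2 : lift β (x₀ + (j : ℤ) * h + h) = lift α (x₀ + (j : ℤ) * h + h) := by
      rw [H, hrep j _ (by linarith) le_rfl, add_sub_cancel_left, div_self hh.ne']
      exact hR.geo_one hι (hlt j)
    refine ⟨e1, e2, ?_⟩
    rw [hR.isShortestGeodesicOn_iff hι (by linarith) (by rw [e1, e2]; exact hlt j)]
    intro x hx
    rw [e1, e2, add_sub_cancel_left, H]
    exact hrep j x hx.1 hx.2

end ReplacementUnique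

/-! ### Monotone functions on the line -/

section RealFunctions

theorem surjective_of_map_add {f : ℝ → ℝ} (hf : Continuous f) {c d : ℝ} (hd : 0 < d)
    (h : ∀ x, f (x + c) = f x + d) : Function.Surjective f := by
  have h1 : ∀ (k : ℕ) x, f (x + k * c) = f x + k * d := by
    intro k
    induction k with
    | zero => simp
    | succ k ih =>
      intro x
      rw [show x + ((k + 1 : ℕ) : ℝ) * c = x + k * c + c by push_cast; ring, h, ih]
      push_cast; ring
  intro y
  obtain ⟨k, hk⟩ := exists_nat_ge (|y - f 0| / d)
  rw [div_le_iff₀ hd] at hk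
  have h2 := h1 k (0 - k * c)
  rw [sub_add_cancel] at h2
  exact mem_range_of_exists_le_of_exists_ge hf
    ⟨0 - k * c, by linarith [neg_abs_le (y - f 0)]⟩
    ⟨0 + k * c, by rw [h1]; linarith [le_abs_self (y - f 0)]⟩

/-- Monotonicity in the real variable traps nearby values between those at two fixed points, where
continuity in the parameter applies. -/
theorem continuous_uncurry_of_monotone {X : Type*} [TopologicalSpace X] {f : X → ℝ → ℝ}
    (hm : ∀ p, Monotone (f p)) (hc : ∀ p, Continuous (f p)) (hx : ∀ x, Continuous fun p => f p x) :
    Continuous fun p : X × ℝ => f p.1 p.2 := by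
  rw [continuous_iff_continuousAt]
  rintro ⟨p, x⟩
  refine tendsto_order.2 ⟨fun a ha => ?_, fun a ha => ?_⟩
  · obtain ⟨y, hy, hyx⟩ := ((((hc p).tendsto x).eventually (lt_mem_nhds ha)).filter_mono
      nhdsWithin_le_nhds |>.and (self_mem_nhdsWithin : Iio x ∈ 𝓝[<] x)).exists
    have hyx : y < x := hyx
    filter_upwards [prod_mem_nhds (((hx y).tendsto p).eventually (lt_mem_nhds hy))
      (lt_mem_nhds hyx)] with z hz
    exact lt_of_lt_of_le hz.1 (hm z.1 (le_of_lt hz.2))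
  · obtain ⟨y, hy, hyx⟩ := ((((hc p).tendsto x).eventually (gt_mem_nhds ha)).filter_mono
      nhdsWithin_le_nhds |>.and (self_mem_nhdsWithin : Ioi x ∈ 𝓝[>] x)).exists
    have hyx : x < y := hyx
    filter_upwards [prod_mem_nhds (((hx y).tendsto p).eventually (gt_mem_nhds hy))
      (gt_mem_nhds hyx)] with z hz
    exact lt_of_le_of_lt (hm z.1 (le_of_lt hz.2)) hz.1

theorem image_Icc_of_monotone {f : ℝ → ℝ} (hc : Continuous f) (hm : Monotone f) {a b : ℝ}
    (hab : a ≤ b) : f '' Icc a b = Icc (f a) (f b) :=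
  (hm.mapsTo_Icc.image_subset).antisymm (intermediate_value_Icc hab hc.continuousOn)

end RealFunctions

/-! ### Arc length parametrization of a closed curve -/

section ArcLength

variable {N : ℕ}

/-- The length of the curve `u` between the parameters `x₀` and `x`. -/
noncomputable def arcLength (u : ℝ → Euc N) (x₀ x : ℝ) : ℝ := ∫ z in x₀..x, ‖deriv u z‖

/-- The mean speed of a closed curve `u`. -/
noncomputable def meanSpeed (u : ℝ → Euc N) (x₀ : ℝ) : ℝ :=
  arcLength u x₀ (x₀ + 2 * Real.pi) / (2 * Real.pi)

/-- The interpolation between the arc length and its linear version. -/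
noncomputable def arcParam (u : ℝ → Euc N) (x₀ s x : ℝ) : ℝ :=
  (1 - s) * arcLength u x₀ x + s * (meanSpeed u x₀ * (x - x₀))

/-- The curve `α`, whose image in Euclidean space is `u`, as a function of the arc length. -/
noncomputable def arcCurve {M : Type*} (ι : M → Euc N) (x₀ : ℝ) (α : ℝ → M) (r : ℝ) : M :=
  α (Function.invFun (arcLength (ι ∘ α) x₀) r)

variable {u : ℝ → Euc N} {x₀ : ℝ}

@[simp] theorem arcLength_self : arcLength u x₀ x₀ = 0 := intervalIntegral.integral_same

theorem arcLength_sub (hu : SpeedBound u fun x => ‖deriv u x‖) (x y : ℝ) :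
    arcLength u x₀ y - arcLength u x₀ x = ∫ z in x..y, ‖deriv u z‖ :=
  intervalIntegral.integral_interval_sub_left (hu.intervalIntegrable _ _)
    (hu.intervalIntegrable _ _)

theorem arcLength_monotone (hu : SpeedBound u fun x => ‖deriv u x‖) :
    Monotone (arcLength u x₀) := fun x y hxy => by
  have := hu.integral_nonneg hxy
  rw [← arcLength_sub (x₀ := x₀) hu] at this
  linarith

theorem continuous_arcLength (hu : SpeedBound u fun x => ‖deriv u x‖) :
    Continuous (arcLength u x₀) :=
  intervalIntegral.continuous_primitive hu.intervalIntegrable x₀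

/-- Parameters with equal arc length have the same image, so the arbitrary choice made by
`Function.invFun` in `arcCurve` is harmless. -/
theorem norm_sub_le_arcLength (hu : SpeedBound u fun x => ‖deriv u x‖) (x y : ℝ) :
    ‖u y - u x‖ ≤ |arcLength u x₀ y - arcLength u x₀ x| := by
  wlog hxy : x ≤ y generalizing x y
  · rw [norm_sub_rev, abs_sub_comm]
    exact this y x (by linarith)
  rw [arcLength_sub hu]
  exact (hu.norm_sub_le x y hxy).trans (le_abs_self _)

theorem arcLength_nonneg (hu : SpeedBound u fun x => ‖deriv u x‖) {x : ℝ} (hx : x₀ ≤ x) :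
    0 ≤ arcLength u x₀ x := hu.integral_nonneg hx

theorem meanSpeed_nonneg (hu : SpeedBound u fun x => ‖deriv u x‖) : 0 ≤ meanSpeed u x₀ :=
  div_nonneg (arcLength_nonneg hu (by linarith [Real.pi_pos])) (by positivity)

theorem arcLength_add_period (hu : SpeedBound u fun x => ‖deriv u x‖)
    (hper : Function.Periodic u (2 * Real.pi)) (x : ℝ) :
    arcLength u x₀ (x + 2 * Real.pi) = arcLength u x₀ x + meanSpeed u x₀ * (2 * Real.pi) := by
  have h1 : Function.Periodic (fun x => ‖deriv u x‖) (2 * Real.pi) := fun x => by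
    simp only [hper.deriv_periodic x]
  have h2 := h1.intervalIntegral_add_eq x x₀
  rw [← arcLength_sub (x₀ := x₀) hu] at h2
  rw [meanSpeed, div_mul_cancel₀ _ (by positivity)]
  have : arcLength u x₀ (x₀ + 2 * Real.pi) = ∫ z in x₀..x₀ + 2 * Real.pi, ‖deriv u z‖ := rfl
  linarith

/-- With zero mean speed the arc length is both periodic and monotone, hence constant. -/
theorem arcLength_eq_zero (hu : SpeedBound u fun x => ‖deriv u x‖)
    (hper : Function.Periodic u (2 * Real.pi)) (h0 : meanSpeed u x₀ = 0) (x : ℝ) :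
    arcLength u x₀ x = 0 := by
  have hp : Function.Periodic (arcLength u x₀) (2 * Real.pi) := fun x => by
    rw [arcLength_add_period hu hper, h0, zero_mul, add_zero]
  obtain ⟨y, hy, hxy⟩ := hp.exists_mem_Ico (by positivity) x x₀
  rw [hxy]
  have h1 := arcLength_monotone (x₀ := x₀) hu hy.1
  have h2 := arcLength_monotone (x₀ := x₀) hu hy.2.le
  rw [hp x₀] at h2
  rw [arcLength_self] at h1 h2
  exact le_antisymm h2 h1

theorem arcParam_mem_range (hu : SpeedBound u fun x => ‖deriv u x‖)
    (hper : Function.Periodic u (2 * Real.pi)) (s x : ℝ) :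
    arcParam u x₀ s x ∈ range (arcLength u x₀) := by
  rcases (meanSpeed_nonneg (x₀ := x₀) hu).eq_or_lt with h | h
  · exact ⟨x₀, by simp [arcParam, arcLength_eq_zero hu hper h.symm, ← h]⟩
  · exact surjective_of_map_add (continuous_arcLength hu) (by positivity)
      (arcLength_add_period hu hper) _

theorem arcParam_add_period (hu : SpeedBound u fun x => ‖deriv u x‖)
    (hper : Function.Periodic u (2 * Real.pi)) (s x : ℝ) :
    arcParam u x₀ s (x + 2 * Real.pi) =
      arcParam u x₀ s x + meanSpeed u x₀ * (2 * Real.pi) := by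
  rw [arcParam, arcParam, arcLength_add_period hu hper]
  ring

theorem continuous_arcParam (hu : SpeedBound u fun x => ‖deriv u x‖) (s : ℝ) :
    Continuous (arcParam u x₀ s) := by
  have := continuous_arcLength (x₀ := x₀) hu
  unfold arcParam
  fun_prop

theorem arcParam_sub (hu : SpeedBound u fun x => ‖deriv u x‖) (s x y : ℝ) :
    arcParam u x₀ s y - arcParam u x₀ s x =
      ∫ z in x..y, ((1 - s) * ‖deriv u z‖ + s * meanSpeed u x₀) := by
  rw [intervalIntegral.integral_add ((hu.intervalIntegrable x y).const_mul _)
    intervalIntegrable_const, intervalIntegral.integral_const_mul, ← arcLength_sub (x₀ := x₀) hu,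
    intervalIntegral.integral_const, smul_eq_mul, arcParam, arcParam]
  ring

theorem arcParam_monotone (hu : SpeedBound u fun x => ‖deriv u x‖) {s : ℝ}
    (hs : s ∈ Icc (0 : ℝ) 1) : Monotone (arcParam u x₀ s) := fun x y hxy =>
  add_le_add (mul_le_mul_of_nonneg_left (arcLength_monotone hu hxy) (by linarith [hs.2]))
    (mul_le_mul_of_nonneg_left (mul_le_mul_of_nonneg_left (by linarith)
      (meanSpeed_nonneg hu)) hs.1)

section Curve

variable {M : Type*} {ι : M → Euc N} {α : ℝ → M}

theorem norm_arcCurve_sub_le (hu : SpeedBound (ι ∘ α) fun x => ‖deriv (ι ∘ α) x‖) {r : ℝ}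
    (hr : r ∈ range (arcLength (ι ∘ α) x₀)) (z : ℝ) :
    ‖ι (arcCurve ι x₀ α r) - ι (α z)‖ ≤ |r - arcLength (ι ∘ α) x₀ z| := by
  have h1 := norm_sub_le_arcLength (x₀ := x₀) hu z (Function.invFun (arcLength (ι ∘ α) x₀) r)
  rwa [Function.invFun_eq hr] at h1

theorem arcCurve_arcLength (hι : Function.Injective ι)
    (hu : SpeedBound (ι ∘ α) fun x => ‖deriv (ι ∘ α) x‖) (z : ℝ) :
    arcCurve ι x₀ α (arcLength (ι ∘ α) x₀ z) = α z := by
  have := norm_arcCurve_sub_le (x₀ := x₀) hu ⟨z, rfl⟩ z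
  rw [sub_self, abs_zero] at this
  exact hι (sub_eq_zero.1 (norm_le_zero_iff.1 this))

theorem speedBound_arcCurve_arcParam (hι : Function.Injective ι)
    (hu : SpeedBound (ι ∘ α) fun x => ‖deriv (ι ∘ α) x‖)
    (hper : Function.Periodic (ι ∘ α) (2 * Real.pi)) {s : ℝ} (hs : s ∈ Icc (0 : ℝ) 1) :
    SpeedBound (ι ∘ fun x => arcCurve ι x₀ α (arcParam (ι ∘ α) x₀ s x))
      fun x => (1 - s) * ‖deriv (ι ∘ α) x‖ + s * meanSpeed (ι ∘ α) x₀ := by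
  refine ⟨fun a b => ((hu.intervalIntegrable a b).const_mul _).add intervalIntegrable_const,
    fun x y hxy => ?_⟩
  obtain ⟨z, hz⟩ := arcParam_mem_range (x₀ := x₀) hu hper s x
  have h1 := norm_arcCurve_sub_le hu (arcParam_mem_range (x₀ := x₀) hu hper s y) z
  rw [← arcCurve_arcLength (x₀ := x₀) hι hu z, hz,
    abs_of_nonneg (sub_nonneg.2 (arcParam_monotone hu hs hxy)), arcParam_sub hu] at h1
  exact h1

/-- Variation is invariant under monotone reparametrization. Since the curve itself is `arcCurve`
after arc length, the variation of `arcCurve` over an interval of arc lengths is at least its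
length, so the speed bound is sharp. -/
theorem norm_deriv_arcCurve_arcParam (hι : Function.Injective ι)
    (hu : SpeedBound (ι ∘ α) fun x => ‖deriv (ι ∘ α) x‖)
    (hper : Function.Periodic (ι ∘ α) (2 * Real.pi)) {s : ℝ} (hs : s ∈ Icc (0 : ℝ) 1) :
    ∀ᵐ x, ‖deriv (ι ∘ fun x => arcCurve ι x₀ α (arcParam (ι ∘ α) x₀ s x)) x‖ =
      (1 - s) * ‖deriv (ι ∘ α) x‖ + s * meanSpeed (ι ∘ α) x₀ := by
  have hF := speedBound_arcCurve_arcParam (x₀ := x₀) hι hu hper hs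
  refine hF.norm_deriv_eq fun a b hab => le_antisymm (hF.eVariationOn_le hab) ?_
  rw [← arcParam_sub hu]
  have hrm := arcParam_monotone (x₀ := x₀) hu hs
  rcases (hrm hab).eq_or_lt with h | h
  · rw [h, sub_self, ENNReal.ofReal_zero]
    exact zero_le
  obtain ⟨z, hz⟩ := arcParam_mem_range (x₀ := x₀) hu hper s a
  obtain ⟨w, hw⟩ := arcParam_mem_range (x₀ := x₀) hu hper s b
  have hℓ := arcLength_monotone (x₀ := x₀) hu
  have hzw : z ≤ w := (hℓ.reflect_lt (by rw [hz, hw]; exact h)).le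
  have h1 : ι ∘ α = (ι ∘ arcCurve ι x₀ α) ∘ arcLength (ι ∘ α) x₀ := by
    funext x
    simp only [Function.comp_apply]
    rw [arcCurve_arcLength hι hu]
  have h2 := hu.eVariationOn_eq hzw
  rw [← arcLength_sub (x₀ := x₀) hu, hz, hw] at h2
  rw [← h2]
  change _ ≤ eVariationOn ((ι ∘ arcCurve ι x₀ α) ∘ arcParam (ι ∘ α) x₀ s) (Icc a b)
  rw [eVariationOn.comp_eq_of_monotoneOn _ _ (hrm.monotoneOn _),
    image_Icc_of_monotone (continuous_arcParam hu s) hrm hab, ← hz, ← hw]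
  nth_rewrite 1 [h1]
  exact eVariationOn.comp_le_of_monotoneOn _ _ (hℓ.monotoneOn _) hℓ.mapsTo_Icc

/-- A curve of constant speed that `α` factors through is `α` as a function of a multiple of the
arc length. -/
theorem eq_arcCurve_of_comp (hι : Function.Injective ι)
    (hu : SpeedBound (ι ∘ α) fun x => ‖deriv (ι ∘ α) x‖)
    {β : ℝ → M} {S : ℝ} (hb : SpeedBound (ι ∘ β) fun x => ‖deriv (ι ∘ β) x‖)
    (hS : ∀ᵐ x, ‖deriv (ι ∘ β) x‖ = S) {P : ℝ → ℝ} (hPm : Monotone P) (hPc : Continuous P)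
    (hP0 : P x₀ = x₀) (hP : ∀ x, P (x + 2 * Real.pi) = P x + 2 * Real.pi)
    (hαβ : ∀ x, α x = β (P x)) (x : ℝ) :
    β x = arcCurve ι x₀ α (meanSpeed (ι ∘ α) x₀ * (x - x₀)) := by
  have hS0 : 0 ≤ S := by
    obtain ⟨x, hx⟩ := hS.exists
    exact hx ▸ norm_nonneg _
  -- The variation of `α` over `[x, y]` is that of `β` over `[P x, P y]`. Hence `P` is determined by
  -- the arc length up to the factor `S`; over a full period this identifies `S` with the mean
  -- speed.
  have key : ∀ x y, x ≤ y →
      arcLength (ι ∘ α) x₀ y - arcLength (ι ∘ α) x₀ x = S * (P y - P x) := fun x y hxy => by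
    have h1 := hu.eVariationOn_eq hxy
    have h2 : ι ∘ α = (ι ∘ β) ∘ P := by
      funext x
      simp [hαβ]
    have h3 := hb.eVariationOn_eq (hPm hxy)
    rw [intervalIntegral.integral_congr_ae (hS.mono fun z hz _ => hz),
      intervalIntegral.integral_const, smul_eq_mul, mul_comm] at h3
    rw [← arcLength_sub (x₀ := x₀) hu] at h1
    nth_rewrite 1 [h2] at h1
    rw [eVariationOn.comp_eq_of_monotoneOn _ _ (hPm.monotoneOn _),
      image_Icc_of_monotone hPc hPm hxy, h3, ENNReal.ofReal_eq_ofReal_iff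
        (mul_nonneg hS0 (sub_nonneg.2 (hPm hxy)))
        (sub_nonneg.2 (arcLength_monotone hu hxy))] at h1
    exact h1.symm
  have hSm : meanSpeed (ι ∘ α) x₀ = S := by
    have h1 := key x₀ (x₀ + 2 * Real.pi) (by linarith [Real.pi_pos])
    rw [arcLength_self, sub_zero, hP, add_sub_cancel_left] at h1
    rw [meanSpeed, h1, mul_div_cancel_right₀ _ (by positivity)]
  obtain ⟨y, rfl⟩ := surjective_of_map_add hPc (by positivity) hP x
  have h1 : arcLength (ι ∘ α) x₀ y = S * (P y - x₀) := by
    rcases le_total x₀ y with h | h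
    · have := key _ _ h
      rwa [arcLength_self, sub_zero, hP0] at this
    · have := key _ _ h
      rw [arcLength_self, hP0] at this
      linarith
  rw [hSm, ← h1, arcCurve_arcLength hι hu, hαβ]

end Curve

end ArcLength

/-! ### The homotopy of constant speed reparametrization -/

section ReparamFamily

variable {N : ℕ} {M : Type*} [TopologicalSpace M] {ι : M → Euc N}

theorem continuous_arcParam_uncurry {T : Type*} [TopologicalSpace T] {x₀ : ℝ}
    {u : T → ℝ → Euc N} (hu : ∀ t, SpeedBound (u t) fun x => ‖deriv (u t) x‖)
    (hℓt : ∀ x, Continuous fun t => arcLength (u t) x₀ x) :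
    Continuous fun p : (unitInterval × T) × ℝ => arcParam (u p.1.2) x₀ p.1.1 p.2 := by
  have hℓ : Continuous fun p : T × ℝ => arcLength (u p.1) x₀ p.2 :=
    continuous_uncurry_of_monotone (fun t => arcLength_monotone (hu t))
      (fun t => continuous_arcLength (hu t)) hℓt
  have hS : Continuous fun t => meanSpeed (u t) x₀ := (hℓt _).div_const _
  have hsnd : Continuous fun p : (unitInterval × T) × ℝ => p.1.2 := by fun_prop
  have h1 : Continuous fun p : (unitInterval × T) × ℝ => arcLength (u p.1.2) x₀ p.2 := by
    have := hℓ.comp (hsnd.prodMk continuous_snd)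
    exact this
  have h2 : Continuous fun p : (unitInterval × T) × ℝ => meanSpeed (u p.1.2) x₀ :=
    hS.comp hsnd
  have h3 : Continuous fun p : (unitInterval × T) × ℝ => (p.1.1 : ℝ) := by fun_prop
  unfold arcParam
  fun_prop

/-- The chosen inverse of arc length need not be continuous. Comparison with the value at one fixed
parameter `z`, whose arc length is the limiting one, avoids it. -/
theorem continuous_arcCurve_arcParam {T : Type*} [TopologicalSpace T] (hι : IsEmbedding ι)
    {x₀ : ℝ} {α : T → ℝ → M} (hu : ∀ t, SpeedBound (ι ∘ α t) fun x => ‖deriv (ι ∘ α t) x‖)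
    (hper : ∀ t, Function.Periodic (ι ∘ α t) (2 * Real.pi))
    (hℓt : ∀ x, Continuous fun t => arcLength (ι ∘ α t) x₀ x)
    (hα : ∀ x, Continuous fun t => α t x) :
    Continuous fun p : (unitInterval × T) × ℝ =>
      arcCurve ι x₀ (α p.1.2) (arcParam (ι ∘ α p.1.2) x₀ p.1.1 p.2) := by
  have hsnd : Continuous fun p : (unitInterval × T) × ℝ => p.1.2 := by fun_prop
  have hr := continuous_arcParam_uncurry hu hℓt
  rw [hι.continuous_iff, continuous_iff_continuousAt]
  rintro ⟨⟨s, t⟩, x⟩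
  obtain ⟨z, hz⟩ := arcParam_mem_range (x₀ := x₀) (hu t) (hper t) s x
  rw [ContinuousAt, tendsto_iff_norm_sub_tendsto_zero]
  have h1 : Continuous fun p : (unitInterval × T) × ℝ =>
      |arcParam (ι ∘ α p.1.2) x₀ p.1.1 p.2 - arcLength (ι ∘ α p.1.2) x₀ z| +
        ‖ι (α p.1.2 z) - ι (α t z)‖ :=
    (hr.sub (Continuous.comp (g := fun t => arcLength (ι ∘ α t) x₀ z) (hℓt z) hsnd)).abs.add
      ((hι.continuous.comp (Continuous.comp (g := fun t => α t z) (hα z) hsnd)).sub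
        continuous_const).norm
  refine squeeze_zero (fun _ => norm_nonneg _) (fun p => ?_)
    (h1.tendsto' ((s, t), x) 0 (by simp [hz]))
  refine (norm_sub_le_norm_sub_add_norm_sub _ (ι (α p.1.2 z)) _).trans
    (add_le_add (norm_arcCurve_sub_le (hu _) (arcParam_mem_range (hu _) (hper _) _ _) z)
      (le_of_eq ?_))
  simp only [Function.comp_apply]
  rw [← hz, arcCurve_arcLength hι.injective (hu t)]

theorem exists_isConstantSpeedReparam (hι : IsEmbedding ι) (x₀ : ℝ) {σ : C(Circ × Param, M)}
    (hσ : IsSweepout ι σ) :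
    ∃ τ : C(Circ × Param, M),
      (∀ t β, IsConstantSpeedReparam ι x₀ (slice σ t) β ↔ β = slice τ t) ∧
      IsSweepout ι τ ∧ HomotopicInΩ ι σ τ := by
  have hinj := hι.injective
  set α : Param → ℝ → M := fun t => lift (slice σ t) with hα
  have hper : ∀ t, Function.Periodic (ι ∘ α t) (2 * Real.pi) := fun t =>
    (lift_periodic (slice σ t)).comp ι
  have hu : ∀ t, SpeedBound (ι ∘ α t) fun x => ‖deriv (ι ∘ α t) x‖ := fun t =>
    (hσ.isW12 t).speedBound
  have hu2 : ∀ t a b, IntervalIntegrable (fun x => ‖deriv (ι ∘ α t) x‖ ^ 2) volume a b :=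
    fun t => (hσ.isW12 t).sq_intervalIntegrable
  set F : unitInterval → Param → ℝ → M := fun s t x =>
    arcCurve ι x₀ (α t) (arcParam (ι ∘ α t) x₀ s x) with hF
  have hrange : ∀ s t x, arcParam (ι ∘ α t) x₀ s x ∈ range (arcLength (ι ∘ α t) x₀) :=
    fun s t x => arcParam_mem_range (hu t) (hper t) s x
  have hℓt : ∀ x, Continuous fun t => arcLength (ι ∘ α t) x₀ x := fun x =>
    hσ.continuous_integral_norm_deriv x₀ x
  have hS : Continuous fun t => meanSpeed (ι ∘ α t) x₀ := (hℓt _).div_const _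
  have hFper : ∀ s t, Function.Periodic (F s t) (2 * Real.pi) := fun s t x => by
    obtain ⟨z, hz⟩ := hrange s t x
    simp only [hF]
    rw [arcParam_add_period (hu t) (hper t), ← hz, ← arcLength_add_period (hu t) (hper t),
      arcCurve_arcLength hinj (hu t), arcCurve_arcLength hinj (hu t)]
    exact lift_periodic _ z
  have hFc : Continuous fun p : (unitInterval × Param) × ℝ => F p.1.1 p.1.2 p.2 :=
    continuous_arcCurve_arcParam hι hu hper hℓt fun x =>
      σ.continuous.comp (Continuous.prodMk continuous_const continuous_id)
  have hv := fun (s : unitInterval) t =>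
    speedBound_arcCurve_arcParam (x₀ := x₀) hinj (hu t) (hper t) s.2
  have hsq : ∀ (s : unitInterval) t, (fun x =>
      ((1 - (s : ℝ)) * ‖deriv (ι ∘ α t) x‖ + s * meanSpeed (ι ∘ α t) x₀) ^ 2) = fun x =>
      (1 - s) ^ 2 * ‖deriv (ι ∘ α t) x‖ ^ 2 +
        2 * (1 - s) * (s * meanSpeed (ι ∘ α t) x₀) * ‖deriv (ι ∘ α t) x‖ +
        (s * meanSpeed (ι ∘ α t) x₀) ^ 2 := fun s t => by
    funext x; ring
  have hi1 := fun (s : unitInterval) t a b =>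
    (hu2 t a b).const_mul ((1 - (s : ℝ)) ^ 2)
  have hi2 := fun (s : unitInterval) t a b =>
    ((hu t).intervalIntegrable a b).const_mul
      (2 * (1 - (s : ℝ)) * (s * meanSpeed (ι ∘ α t) x₀))
  have hv2 : ∀ (s : unitInterval) t a b, IntervalIntegrable (fun x =>
      ((1 - (s : ℝ)) * ‖deriv (ι ∘ α t) x‖ + s * meanSpeed (ι ∘ α t) x₀) ^ 2) volume a b :=
    fun s t a b => by
      rw [hsq]
      exact ((hi1 s t a b).add (hi2 s t a b)).add intervalIntegrable_const
  -- Expanding the square of the interpolated speed leaves only the energy, the length and the mean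
  -- speed, all continuous in `t`.
  have hFE : ∀ s, Continuous fun t =>
      ∫ x in x₀..x₀ + 2 * Real.pi, ‖deriv (ι ∘ F s t) x‖ ^ 2 := fun s => by
    have h1 : ∀ t, ∫ x in x₀..x₀ + 2 * Real.pi, ‖deriv (ι ∘ F s t) x‖ ^ 2 =
        (1 - s) ^ 2 * (∫ x in x₀..x₀ + 2 * Real.pi, ‖deriv (ι ∘ α t) x‖ ^ 2) +
        2 * (1 - s) * (s * meanSpeed (ι ∘ α t) x₀) *
          (∫ x in x₀..x₀ + 2 * Real.pi, ‖deriv (ι ∘ α t) x‖) +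
        (2 * Real.pi) * (s * meanSpeed (ι ∘ α t) x₀) ^ 2 := fun t => by
      rw [← intervalIntegral.integral_const_mul, ← intervalIntegral.integral_const_mul,
        ← intervalIntegral.integral_add (hi1 s t _ _) (hi2 s t _ _)]
      have h2 : ∫ _ in x₀..x₀ + 2 * Real.pi, ((s : ℝ) * meanSpeed (ι ∘ α t) x₀) ^ 2 =
          (2 * Real.pi) * (s * meanSpeed (ι ∘ α t) x₀) ^ 2 := by
        rw [intervalIntegral.integral_const, add_sub_cancel_left, smul_eq_mul]
      rw [← h2, ← intervalIntegral.integral_add ((hi1 s t _ _).add (hi2 s t _ _))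
        intervalIntegrable_const, ← hsq]
      refine intervalIntegral.integral_congr_ae ?_
      filter_upwards [norm_deriv_arcCurve_arcParam (x₀ := x₀) hinj (hu t) (hper t) s.2] with x hx _
      rw [← hx]
    simp only [h1]
    have h3 := hσ.continuous_integral_sq_norm_deriv
      (by linarith [Real.pi_pos] : x₀ ≤ x₀ + 2 * Real.pi)
    have h4 := hσ.continuous_integral_norm_deriv x₀ (x₀ + 2 * Real.pi)
    fun_prop
  have hconst : ∀ s t, (∃ p, ∀ x, slice σ t x = p) → ∃ p, ∀ x, F s t x = p :=
    fun s t ⟨p, hp⟩ => ⟨p, fun x => hp _⟩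
  obtain ⟨τ, hτ, hτs, hτh⟩ := exists_homotopicInΩ hι.continuous hFper hFc hv hv2 hFE
    (fun s => hconst s _ hσ.start) (fun s => hconst s _ hσ.finish) (σ := σ) fun t =>
      funext fun x => by simp [hF, arcParam, arcCurve_arcLength hinj (hu t)]; rfl
  refine ⟨τ, fun t β => ?_, hτs, hτh⟩
  have hF1 : ∀ x, F 1 t x = arcCurve ι x₀ (α t) (meanSpeed (ι ∘ α t) x₀ * (x - x₀)) := fun x => by
    simp [hF, arcParam]
  constructor
  · rintro ⟨⟨hW, S, hS⟩, P, hPm, hPc, hP0, hP, hαβ⟩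
    funext x
    obtain ⟨x, rfl⟩ := QuotientAddGroup.mk_surjective x
    have h1 := eq_arcCurve_of_comp (β := lift β) hinj (hu t) hW.speedBound hS hPm hPc hP0 hP hαβ x
    rw [← hF1, ← hτ t] at h1
    exact h1
  · rintro rfl
    refine ⟨⟨hτs.isW12 t, meanSpeed (ι ∘ α t) x₀, ?_⟩, ?_⟩
    · have h1 := norm_deriv_arcCurve_arcParam (x₀ := x₀) hinj (hu t) (hper t)
        (right_mem_Icc.2 zero_le_one)
      have h2 : lift (ι ∘ slice τ t) = ι ∘ F 1 t := by
        rw [← hτ t]; rfl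
      rw [h2]
      filter_upwards [h1] with x hx
      refine hx.trans (by simp)
    -- A slice of zero length is constant and the identity serves as `P`; otherwise `P` is the
    -- normalized arc length.
    · rcases (meanSpeed_nonneg (x₀ := x₀) (hu t)).eq_or_lt with h | h
      · refine ⟨id, monotone_id, continuous_id, rfl, fun _ => rfl, fun x => ?_⟩
        rw [hτ t, id, hF1, ← h, zero_mul, ← arcLength_eq_zero (hu t) (hper t) h.symm x,
          arcCurve_arcLength hinj (hu t)]
      · refine ⟨fun x => x₀ + arcLength (ι ∘ α t) x₀ x / meanSpeed (ι ∘ α t) x₀,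
          fun x y hxy => ?_, ?_, by simp, fun x => ?_, fun x => ?_⟩
        · have := arcLength_monotone (x₀ := x₀) (hu t) hxy
          simp only
          gcongr
        · have := continuous_arcLength (x₀ := x₀) (hu t)
          fun_prop
        · simp only [arcLength_add_period (hu t) (hper t)]
          field_simp
          ring
        · rw [hτ t, hF1, add_sub_cancel_left, mul_div_cancel₀ _ h.ne',
            arcCurve_arcLength hinj (hu t)]

end ReparamFamily

end CurveSweepout
-- The tightening construction
theorem lemmaB2 {n N : ℕ} {M : Type*} [EMetricSpace M] [CompactSpace M]
    [ChartedSpace (EuclideanSpace ℝ (Fin n)) M] [IsManifold (𝓡 n) ∞ M]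
    [RiemannianBundle (fun x : M => TangentSpace (𝓡 n) x)]
    [IsContMDiffRiemannianBundle (𝓡 n) ∞ (EuclideanSpace ℝ (Fin n))
      (fun x : M => TangentSpace (𝓡 n) x)]
    [IsRiemannianManifold (𝓡 n) M]
    (ι : M → Euc N) (hι : IsIsometricEmbedding n ι)
    (hinj : ENNReal.ofReal (8 * Real.pi) ≤ injectivityRadius n ι)
    (L : ℕ) (hL : 1 ≤ L) (x₀ : ℝ)
    (γ : C(Circ × Param, M))
    (hγ : IsSweepout ι γ)
    (hE : ∀ t, energy (ι ∘ slice γ t) ≤ L) :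
    ∃ γₑ γₑ' γₒ Ψγ : C(Circ × Param, M),
      -- `γₑ` is the result of geodesic replacement of `γ` on the even intervals
      (∀ t β, IsGeodesicReplacement n ι L x₀ (slice γ t) β ↔
        β = slice γₑ t) ∧
      -- `γₑ'` is the constant speed reparametrization of `γₑ`
      (∀ t β, IsConstantSpeedReparam ι x₀ (slice γₑ t) β ↔
        β = slice γₑ' t) ∧
      -- `γₒ` is the result of geodesic replacement of `γₑ` on the odd intervals
      (∀ t β, IsGeodesicReplacement n ι L (node L x₀ 1)
        (slice γₑ t) β ↔ β = slice γₒ t) ∧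
      -- `Ψγ` is the constant speed reparametrization of `γₒ`
      (∀ t β, IsConstantSpeedReparam ι x₀ (slice γₒ t) β ↔
        β = slice Ψγ t) ∧
      HomotopicInΩ ι γ γₑ ∧
      HomotopicInΩ ι γₑ γₑ' ∧
      HomotopicInΩ ι γ γₑ' ∧
      ∀ σ : C(Circ × Param, M), IsSweepout ι σ →
        γ ∈ homotopyClass ι σ →
          γₑ ∈ homotopyClass ι σ ∧ γₑ' ∈ homotopyClass ι σ ∧
            Ψγ ∈ homotopyClass ι σ := by
  -- Radius 8 suffices; its being strictly below 8π avoids the question whether the supremum in the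
  -- injectivity radius is attained.
  have hR : HasNormalRadius n ι 8 := fun p r hr => by
    refine isNormalRadius_of_le_injectivityRadius hinj p (hr.trans_lt ?_)
    rw [ENNReal.ofReal_lt_ofReal_iff (by positivity)]
    linarith [Real.pi_gt_three]
  obtain ⟨γₑ, he, hes, heh, hee⟩ := exists_isGeodesicReplacement hR hι hL x₀ hγ hE
  obtain ⟨γₑ', he', hes', heh'⟩ := exists_isConstantSpeedReparam hι.isEmbedding x₀ hes
  -- The odd replacement is the even one for the partition based at `node L x₀ 1`, applied to `γₑ`
  -- by its preserved energy bound.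
  obtain ⟨γₒ, ho, hos, hoh, -⟩ := exists_isGeodesicReplacement hR hι hL (node L x₀ 1) hes hee
  obtain ⟨Ψγ, hΨ, hΨs, hΨh⟩ := exists_isConstantSpeedReparam hι.isEmbedding x₀ hos
  have hlift : ∀ {α β : Circ → M}, lift α = lift β ↔ α = β := fun {α β} =>
    ⟨fun h => funext fun x => by
      obtain ⟨x, rfl⟩ := QuotientAddGroup.mk_surjective x
      exact congrFun h x, fun h => h ▸ rfl⟩
  refine ⟨γₑ, γₑ', γₒ, Ψγ, fun t β => ?_, he', fun t β => ?_, hΨ, heh, heh', heh.trans heh',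
    fun σ _ hγσ => ⟨⟨hes, heh.symm.trans hγσ.2⟩, ⟨hes', (heh.trans heh').symm.trans hγσ.2⟩,
      ⟨hΨs, ((heh.trans hoh).trans hΨh).symm.trans hγσ.2⟩⟩⟩
  · rw [isGeodesicReplacement_iff hR hι hL x₀ fun x y =>
      edist_lift_lt hR hι hL (hγ.isW12 t) (hE t), ← he t, hlift]
  · rw [isGeodesicReplacement_iff hR hι hL _ fun x y =>
      edist_lift_lt hR hι hL (hes.isW12 t) (hee t), ← ho t, hlift]
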